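/- **Theorem (sequential empirical CLT for multiple mixing random variables).** Let $(\mathcal X,\mathcal A)$ be a measurable space, let $(X_i)_{i\ge 0}$ be a stationary $\mathcal X$-valued process with marginal distribution $\mu$, and let $\mathcal F$ be a uniformly bounded class of measurable functions $\mathcal X\to\mathbb R$. Put $\mu f=\int f\,d\mu$, let $\|\cdot\|_s$ and $\|\cdot\|_\infty$ be the norms of $L^s(\mu)$ and $L^\infty(\mu)$, and let $$U_n(f,t)=\frac1{\sqrt n}\sum_{i=1}^{[nt]}\bigl(f(X_i)-\mu f\bigr),\qquad (f,t)\in\mathcal F\times[0,1],$$ be the sequential empirical process, regarded as a (possibly non-measurable) map into $\ell^\infty(\mathcal F\times[0,1])$. Let $s\in[1,\infty]$, let $(\mathcal C,\|\cdot\|_{\mathcal C})$ be a normed real vector space of measurable functions $\mathcal X\to\mathbb R$ that contains the constant function $1$, let $\mathcal G\subset\mathcal C$ be bounded in $\|\cdot\|_\infty$, let $d_0\ge 0$ be an integer and $\gamma>d_0+1$. Suppose the following. 1. (Multiple mixing.) There is $\theta\in(0,1)$ such that for every integer $p\ge1$ there are an integer $\ell\ge0$ and a real polynomial $Q$ in $p$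 variables, of total degree at most $d_0$, with $$\bigl|\mathrm{Cov}\bigl(f(X_{i_0})\cdots f(X_{i_{q-1}}),\,f(X_{i_q})\cdots f(X_{i_p})\bigr)\bigr|\le \|f\|_s\,\|f\|_{\mathcal C}^{\ell}\,Q(i_1-i_0,\dots,i_p-i_{p-1})\,\theta^{\,i_q-i_{q-1}}$$ for all $f\in\mathcal C$ with $\mu f=0$ and $\|f\|_\infty\le1$, all integers $0\le i_0\le i_1\le\dots\le i_p$ and all $q\in\{1,\dots,p\}$. 2. (Finite-dimensional sequential CLT.) For all $f_1,\dots,f_k\in\mathcal G$ and $t_1,\dots,t_k\in[0,1]$ the vector $(U_n(f_1,t_1),\dots,U_n(f_k,t_k))$, where $U_n(f,t)$ is given by the same formula, converges in distribution to a normal distribution $N(0,\Sigma)$ with some covariance matrix $\Sigma$. 3. (Exponential entropy condition.) There are $C>0$ and $r>-1$ with $$\int_0^1\varepsilon^{r}\sup_{\varepsilon\le\delta\le1}N\bigl(\delta,\exp(C\delta^{-1/\gamma})\bigr)^2\,d\varepsilon<\infty,$$ where $N(\delta,A)\in\{0,1,\dots,\infty\}$ is the least number of brackets $[l,u]=\{f: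 l(x)\le f(x)\le u(x)\ \text{for all } x\in\mathcal X\}$ with $l,u\in\mathcal G$, $l\le u$, $\|u-l\|_s\le\delta$, $\|l\|_{\mathcal C}\le A$ and $\|u\|_{\mathcal C}\le A$ that are needed to cover $\mathcal F$. Then there is a tight centred Gaussian process $K$ with values in $\ell^\infty(\mathcal F\times[0,1])$ such that $U_n$ converges in distribution to $K$ in $\ell^\infty(\mathcal F\times[0,1])$, that is, $E^*\varphi(U_n)\to E\varphi(K)$ for every bounded continuous $\varphi:\ell^\infty(\mathcal F\times[0,1])\to\mathbb R$, where $E^*$ denotes outer expectation. If, moreover, the matrix $\Sigma$ in 2. is always given by $$\Sigma_{a,b}=\min\{t_a,t_b\}\Bigl\{\sum_{k=0}^\infty\mathrm{Cov}\bigl(f_a(X_0),f_b(X_k)\bigr)+\sum_{k=1}^\infty\mathrm{Cov}\bigl(f_b(X_0),f_a(X_k)\bigr)\Bigr\},$$ and if there are $\theta\in(0,1)$ and $D>0$ with $$\bigl|\mathrm{Cov}\bigl(\phi(X_0),f(X_k)\bigr)\bigr|\le D\,\|\phi\|_s\,\|f\|_{\mathcal C}\,\theta^k\qquad\text{for all }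 f\in\mathcal G\cup(\mathcal G-\mathcal G),\ \phi\in L^s(\mu),\ k\ge0,$$ then, for all $f,g\in\mathcal F$ and $t,u\in[0,1]$, $$\mathrm{Cov}\bigl(K(f,t),K(g,u)\bigr)=\min\{t,u\}\Bigl\{\sum_{k=0}^\infty\mathrm{Cov}\bigl(f(X_0),g(X_k)\bigr)+\sum_{k=1}^\infty\mathrm{Cov}\bigl(g(X_0),f(X_k)\bigr)\Bigr\},$$ where both series converge absolutely. -/

import Mathlib

open MeasureTheory ProbabilityTheory Filter Topology
open scoped ENNReal Pointwise BoundedContinuousFunction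

noncomputable section

namespace SeqEmp

/-! ### Weak convergence in `ℓ^∞(T)` through outer expectations -/

/-- The Banach space `ℓ^∞(T)` of bounded real functions on `T`, with the supremum norm. -/
abbrev LInf (T : Type*) : Type _ := lp (fun _ : T => ℝ) ∞

/-- `ℓ^∞(T)` carries its Borel `σ`-field. -/
instance instMeasurableSpaceLInf (T : Type*) : MeasurableSpace (LInf T) := borel _

instance instBorelSpaceLInf (T : Type*) : BorelSpace (LInf T) := ⟨rfl⟩

/-- The outer expectation `E^* Y` of a bounded, possibly non-measurable `Y : Ω → ℝ`: the infimum
of `E Z` over the measurable integrable `Z ≥ Y`. -/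
def outerExpectation {Ω : Type*} [MeasurableSpace Ω] (P : Measure Ω) (Y : Ω → ℝ) : ℝ :=
  sInf {e : ℝ | ∃ Z : Ω → ℝ, Measurable Z ∧ Integrable Z P ∧ (∀ ω, Y ω ≤ Z ω) ∧ e = ∫ ω, Z ω ∂P}

/-- Convergence in distribution of possibly non-measurable maps `U n : Ω → E` to a Borel law `K`:
`E^* φ(U n) → ∫ φ dK` for all bounded continuous `φ : E → ℝ`. -/
def ConvergesInLaw {Ω E : Type*} [MeasurableSpace Ω] [TopologicalSpace E] [MeasurableSpace E]
    (P : Measure Ω) (U : ℕ → Ω → E) (K : Measure E) : Prop :=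
  ∀ φ : E →ᵇ ℝ,
    Tendsto (fun n => outerExpectation P (fun ω => φ (U n ω))) atTop (𝓝 (∫ z, φ z ∂K))

/-- `K` is the law of a tight centred Gaussian process `(z p)_{p ∈ T}` with values in `ℓ^∞(T)`. -/
structure IsTightCentredGaussian {T : Type*} (K : Measure (LInf T)) : Prop where
  isProbabilityMeasure : IsProbabilityMeasure K
  tight : IsTightMeasureSet {K}
  gaussian : IsGaussianProcess (fun (p : T) (z : LInf T) => z p) K
  centred : ∀ p : T, ∫ z : LInf T, z p ∂K = 0

/-! ### The sequential empirical process -/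

/-- (Strict) stationarity: the shifted process has the same law on the path space. -/
def IsStationary {𝒳 Ω : Type*} [MeasurableSpace 𝒳] [MeasurableSpace Ω]
    (P : Measure Ω) (X : ℕ → Ω → 𝒳) : Prop :=
  P.map (fun ω (i : ℕ) => X (i + 1) ω) = P.map (fun ω (i : ℕ) => X i ω)

/-- `F` is a uniformly bounded class of functions. -/
def UniformlyBounded {𝒳 : Type*} (F : Set (𝒳 → ℝ)) : Prop :=
  ∃ M : ℝ, ∀ f ∈ F, ∀ x, |f x| ≤ M

/-- `U_n(f,t) = n^{-1/2} ∑_{i=1}^{[nt]} (f(X_i) - μ f)`. -/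
def seqEmp {𝒳 Ω : Type*} [MeasurableSpace 𝒳] (μ : Measure 𝒳) (X : ℕ → Ω → 𝒳)
    (n : ℕ) (f : 𝒳 → ℝ) (t : ℝ) (ω : Ω) : ℝ :=
  (1 / √(n : ℝ)) * ∑ i ∈ Finset.Icc 1 ⌊(n : ℝ) * t⌋₊, (f (X i ω) - ∫ x, f x ∂μ)

theorem memℓp_seqEmp {𝒳 Ω : Type*} [MeasurableSpace 𝒳] (μ : Measure 𝒳) [IsProbabilityMeasure μ]
    (X : ℕ → Ω → 𝒳) {F : Set (𝒳 → ℝ)} (hF : UniformlyBounded F) (n : ℕ) (ω : Ω) :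
    Memℓp (fun p : F × unitInterval => seqEmp μ X n p.1 p.2 ω) ∞ := by
  obtain ⟨M, hM⟩ := hF
  apply memℓp_infty
  refine ⟨(1 / √(n : ℝ)) * (n * (M + M)), ?_⟩
  rintro _ ⟨⟨⟨f, hf⟩, ⟨t, ht0, ht1⟩⟩, rfl⟩
  have hb : ∀ x, |f x| ≤ M := hM f hf
  have hint : |∫ x, f x ∂μ| ≤ M := by
    have h := norm_integral_le_of_norm_le_const (μ := μ) (f := f) (C := M)
      (Eventually.of_forall fun x => by simpa [Real.norm_eq_abs] using hb x)
    simpa using h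
  have hM0 : 0 ≤ M := (abs_nonneg _).trans hint
  simp only [seqEmp, Real.norm_eq_abs, abs_mul]
  rw [abs_of_nonneg (by positivity : (0 : ℝ) ≤ 1 / √(n : ℝ))]
  gcongr
  refine (Finset.abs_sum_le_sum_abs _ _).trans ?_
  refine (Finset.sum_le_card_nsmul _ _ (M + M) fun i _ => ?_).trans ?_
  · exact (abs_sub _ _).trans (add_le_add (hb _) hint)
  · rw [nsmul_eq_mul]
    have hle : ⌊(n : ℝ) * t⌋₊ ≤ n := by
      apply Nat.floor_le_of_le
      nlinarith [(Nat.cast_nonneg n : (0 : ℝ) ≤ n)]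
    have hc : ((Finset.Icc 1 ⌊(n : ℝ) * t⌋₊).card : ℝ) ≤ n := by
      simpa using hle
    gcongr

/-- The sequential empirical process `U_n` as a map `Ω → ℓ^∞(F × [0,1])`. -/
def seqEmpProcess {𝒳 Ω : Type*} [MeasurableSpace 𝒳] (μ : Measure 𝒳) [IsProbabilityMeasure μ]
    (X : ℕ → Ω → 𝒳) {F : Set (𝒳 → ℝ)} (hF : UniformlyBounded F) (n : ℕ) (ω : Ω) :
    LInf (F × unitInterval) :=
  ⟨fun p => seqEmp μ X n p.1 p.2 ω, memℓp_seqEmp μ X hF n ω⟩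

/-- The long-run covariance
`min(t,u) (∑_{k ≥ 0} Cov(f(X_0), g(X_k)) + ∑_{k ≥ 1} Cov(g(X_0), f(X_k)))`. -/
def longRunCov {𝒳 Ω : Type*} [MeasurableSpace Ω] (P : Measure Ω) (X : ℕ → Ω → 𝒳)
    (f g : 𝒳 → ℝ) (t u : ℝ) : ℝ :=
  min t u * ((∑' k : ℕ, cov[fun ω => f (X 0 ω), fun ω => g (X k ω); P])
    + ∑' k : ℕ, cov[fun ω => g (X 0 ω), fun ω => f (X (k + 1) ω); P])

/-! ### Normed spaces of functions, brackets, entropy -/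

/-- A normed real vector space `(𝒞, ‖·‖_𝒞)` of measurable real functions on `𝒳`. -/
structure NormedFunctionSpace (𝒳 : Type*) [MeasurableSpace 𝒳] where
  carrier : Submodule ℝ (𝒳 → ℝ)
  norm : Seminorm ℝ carrier
  eq_zero_of_norm_eq_zero : ∀ f : carrier, norm f = 0 → f = 0
  measurable : ∀ f : carrier, Measurable (f : 𝒳 → ℝ)

variable {𝒳 Ω : Type*} [MeasurableSpace 𝒳] [MeasurableSpace Ω]

/-- `G ⊆ 𝒞` is bounded in the essential supremum norm of `μ`. -/
def EssBounded (𝒞 : NormedFunctionSpace 𝒳) (μ : Measure 𝒳) (G : Set 𝒞.carrier) : Prop :=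
  ∃ M : ℝ, ∀ g ∈ G, eLpNorm (g : 𝒳 → ℝ) ∞ μ ≤ ENNReal.ofReal M

/-- `[l,u]` is an `(ε, A, G, L^s(μ))`-bracket. -/
structure IsBracket (𝒞 : NormedFunctionSpace 𝒳) (μ : Measure 𝒳) (s : ℝ≥0∞) (G : Set 𝒞.carrier)
    (ε A : ℝ) (l u : 𝒞.carrier) : Prop where
  le : ∀ x, (l : 𝒳 → ℝ) x ≤ (u : 𝒳 → ℝ) x
  left_mem : l ∈ G
  right_mem : u ∈ G
  size_le : eLpNorm (fun x => (u : 𝒳 → ℝ) x - (l : 𝒳 → ℝ) x) s μ ≤ ENNReal.ofReal ε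
  norm_right_le : 𝒞.norm u ≤ A
  norm_left_le : 𝒞.norm l ≤ A

/-- The bracketing number `N(ε, A, F, G, L^s(μ))`: the least number of brackets that cover `F`
(infinite if no finite number does). -/
def bracketingNumber (𝒞 : NormedFunctionSpace 𝒳) (μ : Measure 𝒳) (s : ℝ≥0∞)
    (F : Set (𝒳 → ℝ)) (G : Set 𝒞.carrier) (ε A : ℝ) : ℕ∞ :=
  ⨅ (B : Finset (𝒞.carrier × 𝒞.carrier))
    (_ : (∀ b ∈ B, IsBracket 𝒞 μ s G ε A b.1 b.2) ∧
      ∀ f ∈ F, ∃ b ∈ B, ∀ x, (b.1 : 𝒳 → ℝ) x ≤ f x ∧ f x ≤ (b.2 : 𝒳 → ℝ) x),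
    (B.card : ℕ∞)

/-- The exponential entropy condition with exponent `γ`: for some `C > 0` and `r > -1`,
`∫_0^1 ε^r sup_{ε ≤ δ ≤ 1} N(δ, exp(C δ^{-1/γ}), F, G, L^s(μ))^2 dε < ∞`. -/
def ExpEntropy (𝒞 : NormedFunctionSpace 𝒳) (μ : Measure 𝒳) (s : ℝ≥0∞)
    (F : Set (𝒳 → ℝ)) (G : Set 𝒞.carrier) (γ : ℝ) : Prop :=
  ∃ C r : ℝ, 0 < C ∧ -1 < r ∧
    ∫⁻ ε in Set.Ioo (0 : ℝ) 1, ENNReal.ofReal (ε ^ r) *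
      (⨆ δ ∈ Set.Icc ε 1,
        (bracketingNumber 𝒞 μ s F G δ (Real.exp (C * δ ^ (-(1 / γ)))) : ℝ≥0∞) ^ 2) < ∞

/-! ### Conditions on the process -/

/-- Multiple mixing with respect to `(𝒞, ‖·‖_𝒞)` and `L^s(μ)`, with polynomials of total degree at
most `d₀`. Only the entries `i 0 ≤ ⋯ ≤ i p` of the sequence `i` play a role. -/
def MultipleMixing (P : Measure Ω) (X : ℕ → Ω → 𝒳) (μ : Measure 𝒳) (s : ℝ≥0∞)
    (𝒞 : NormedFunctionSpace 𝒳) (d₀ : ℕ) : Prop :=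
  ∃ θ : ℝ, 0 < θ ∧ θ < 1 ∧ ∀ p : ℕ, 1 ≤ p →
    ∃ (ℓ : ℕ) (Q : MvPolynomial (Fin p) ℝ), Q.totalDegree ≤ d₀ ∧
      ∀ f : 𝒞.carrier, ∫ x, (f : 𝒳 → ℝ) x ∂μ = 0 → eLpNorm (f : 𝒳 → ℝ) ∞ μ ≤ 1 →
      ∀ i : ℕ → ℕ, Monotone i → ∀ q : ℕ, 1 ≤ q → q ≤ p →
        |cov[fun ω => ∏ j ∈ Finset.range q, (f : 𝒳 → ℝ) (X (i j) ω),
            fun ω => ∏ j ∈ Finset.Icc q p, (f : 𝒳 → ℝ) (X (i j) ω); P]|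
          ≤ (eLpNorm (f : 𝒳 → ℝ) s μ).toReal * 𝒞.norm f ^ ℓ *
            MvPolynomial.eval (fun j : Fin p => (i (j + 1) : ℝ) - (i j : ℝ)) Q *
            θ ^ (i q - i (q - 1))

/-- `(U_n(f_1,t_1), …, U_n(f_k,t_k))` converges in distribution to `N(0, S)`, where `S` is a
covariance (i.e. positive semidefinite) matrix. -/
def FidiLimit (P : Measure Ω) [IsProbabilityMeasure P] (X : ℕ → Ω → 𝒳) (μ : Measure 𝒳)
    {k : ℕ} (f : Fin k → 𝒳 → ℝ) (t : Fin k → unitInterval) (S : Matrix (Fin k) (Fin k) ℝ) : Prop :=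
  S.PosSemidef ∧
    TendstoInDistribution
      (fun (n : ℕ) (ω : Ω) =>
        (WithLp.toLp 2 fun j => seqEmp μ X n (f j) (t j) ω : EuclideanSpace ℝ (Fin k)))
      atTop (fun y : EuclideanSpace ℝ (Fin k) => y) (fun _ => P)
      (multivariateGaussian (0 : EuclideanSpace ℝ (Fin k)) S)

/-- The finite-dimensional sequential CLT for `G`-observables. -/
def FidiCLT (P : Measure Ω) [IsProbabilityMeasure P] (X : ℕ → Ω → 𝒳) (μ : Measure 𝒳)
    (𝒞 : NormedFunctionSpace 𝒳) (G : Set 𝒞.carrier) : Prop :=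
  ∀ (k : ℕ) (f : Fin k → 𝒞.carrier) (t : Fin k → unitInterval), (∀ j, f j ∈ G) →
    ∃ S : Matrix (Fin k) (Fin k) ℝ, FidiLimit P X μ (fun j => (f j : 𝒳 → ℝ)) t S

/-- The covariance matrix in the finite-dimensional sequential CLT for `G`-observables is the
long-run covariance matrix. -/
def FidiCovIsLongRun (P : Measure Ω) [IsProbabilityMeasure P] (X : ℕ → Ω → 𝒳) (μ : Measure 𝒳)
    (𝒞 : NormedFunctionSpace 𝒳) (G : Set 𝒞.carrier) : Prop :=
  ∀ (k : ℕ) (f : Fin k → 𝒞.carrier) (t : Fin k → unitInterval), (∀ j, f j ∈ G) →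
    ∀ S : Matrix (Fin k) (Fin k) ℝ, FidiLimit P X μ (fun j => (f j : 𝒳 → ℝ)) t S →
      ∀ a b, S a b = longRunCov P X (f a : 𝒳 → ℝ) (f b : 𝒳 → ℝ) (t a) (t b)

/-- Geometric decay of covariances against `L^s(μ) × 𝒞` norms, for `φ ∈ L^s(μ)` and
`f ∈ G ∪ (G - G)`. -/
def GeometricCovDecay (P : Measure Ω) (X : ℕ → Ω → 𝒳) (μ : Measure 𝒳) (s : ℝ≥0∞)
    (𝒞 : NormedFunctionSpace 𝒳) (G : Set 𝒞.carrier) : Prop :=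
  ∃ θ D : ℝ, 0 < θ ∧ θ < 1 ∧ 0 < D ∧
    ∀ f ∈ G ∪ (G - G), ∀ φ : 𝒳 → ℝ, Measurable φ → MemLp φ s μ → ∀ k : ℕ,
      |cov[fun ω => φ (X 0 ω), fun ω => (f : 𝒳 → ℝ) (X k ω); P]|
        ≤ D * (eLpNorm φ s μ).toReal * 𝒞.norm f * θ ^ k

/-- The coordinate process under `K` has the Kiefer covariance structure: the two covariance series
converge absolutely and `Cov(K(f,t), K(g,u))` is the long-run covariance. -/
def HasKieferCovariance (P : Measure Ω) (X : ℕ → Ω → 𝒳) {F : Set (𝒳 → ℝ)}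
    (K : Measure (LInf (F × unitInterval))) : Prop :=
  ∀ (f g : F) (t u : unitInterval),
    Summable (fun k : ℕ => cov[fun ω => f.1 (X 0 ω), fun ω => g.1 (X k ω); P]) ∧
    Summable (fun k : ℕ => cov[fun ω => g.1 (X 0 ω), fun ω => f.1 (X (k + 1) ω); P]) ∧
    cov[fun z : LInf (F × unitInterval) => z (f, t), fun z => z (g, u); K]
      = longRunCov P X f.1 g.1 t u

end SeqEmp

end

/-! The proof is chaining by brackets, driven by moment bounds of arbitrarily high order whose
dependence on the 𝒞-norm is only logarithmic.

Moments. A product over an increasing tuple of times is split at its largest gap. Multiple mixing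
bounds the resulting covariance, and the product of the two expectations is handled by recursion.
Truncating the mixing bound by the trivial bound `2‖f‖_s` makes the sum over each gap linear in `L`,
where `‖f‖_𝒞 ≤ exp L`. With `|B|‖f‖_s L ≤ w²` and `1 ≤ L ≤ w` the `p`-th moment of a centred sum
over `B` is then `O(w^p)` (`MultipleMixing.exists_absMoment_le`).

Chaining. The entropy integral gives, at scale `2^{-k}`, at most geometrically many brackets, with
norms up to `exp(C₁ β^k)` where `β = 2^{1/γ}`. Since `γ > 1`, `β < 2`. With time grids of mesh
`4^{-k}`, the `2p`-th moment of an increment between consecutive levels is `O((β/2)^{kp})` as long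
as `4^k = O(n)`. A large `p` beats the geometric number of increments, so Markov's inequality and a
union bound make all increments of level `k` at most `q^k`, with failure probability `O(2^{-k})`
(`BracketChain.exists_increment_measure_le`). The chain stops at a level `N` with `2^N` of order
`√n`. There the bracket bias `√n 2^{-N}` and the time error are small, and monotonicity within the
bracket controls `U_n(f,t)` itself (`BracketChain.eventually_measure_le`).

Limit. Brackets and dyadic times form a countable set, so the finite-dimensional limits come from a
Gaussian law on a countable product. The increment bounds pass to this law through open sets, and
Borel-Cantelli makes the step processes converge uniformly almost surely. The law of their limit is
`K`. Lipschitz test functions transfer the convergence to `U_n` under outer expectation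
(`exists_gaussian_limit`).

Covariance. The covariance of `K` is the limit of those of the step processes, which are long-run
covariances of lower brackets. Dominated convergence applies because approximating by a bracket
whose level grows with the lag `k` gives a bound of order `k^{-γ}` plus a geometric term
(`BracketChain.exists_summable_cov_bound`). -/

noncomputable section

namespace SeqEmp

/-! ### Recursive inequality for absolute mixed moments. -/

section Moments

variable {Ω : Type*} [MeasurableSpace Ω]

/-- The sum of `|E ∏_j Y_{i_j}|` over all `p`-tuples `i` of times in `B`. -/
def absMoment (P : Measure Ω) (Y : ℕ → Ω → ℝ) (B : Finset ℕ) (p : ℕ) : ℝ :=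
  ∑ i : Fin p → B, |∫ ω, ∏ j, Y (i j) ω ∂P|

theorem absMoment_nonneg (P : Measure Ω) (Y : ℕ → Ω → ℝ) (B : Finset ℕ) (p : ℕ) :
    0 ≤ absMoment P Y B p :=
  Finset.sum_nonneg fun _ _ => abs_nonneg _

/-- The extension of a tuple to a sequence, constant after its last entry. -/
def extendTuple {n : ℕ} {α : Type*} (i : Fin (n + 1) → α) (j : ℕ) : α :=
  i ⟨min j n, by omega⟩

theorem extendTuple_val {n : ℕ} {α : Type*} (i : Fin (n + 1) → α) (j : Fin (n + 1)) :
    extendTuple i j = i j := by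
  unfold extendTuple
  congr 1
  ext
  simp
  omega

theorem monotone_extendTuple {n : ℕ} {α : Type*} [Preorder α] {i : Fin (n + 1) → α}
    (hi : Monotone i) : Monotone (extendTuple i) := by
  intro a b hab
  apply hi
  simp only [Fin.mk_le_mk]
  omega

theorem ae_abs_prod_le_one {P : Measure Ω} {Y : ℕ → Ω → ℝ} (hb : ∀ i, ∀ᵐ ω ∂P, |Y i ω| ≤ 1)
    {ι : Type*} (s : Finset ι) (i : ι → ℕ) : ∀ᵐ ω ∂P, |∏ j ∈ s, Y (i j) ω| ≤ 1 := by
  filter_upwards [ae_all_iff.2 hb] with ω hω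
  rw [Finset.abs_prod]
  exact Finset.prod_le_one (fun _ _ => abs_nonneg _) fun j _ => hω _

theorem memLp_prod {P : Measure Ω} [IsFiniteMeasure P] {Y : ℕ → Ω → ℝ}
    (hm : ∀ i, Measurable (Y i)) (hb : ∀ i, ∀ᵐ ω ∂P, |Y i ω| ≤ 1)
    {ι : Type*} (s : Finset ι) (i : ι → ℕ) (r : ℝ≥0∞) :
    MemLp (fun ω => ∏ j ∈ s, Y (i j) ω) r P :=
  MemLp.of_bound (Finset.measurable_fun_prod _ fun j _ => hm _).aestronglyMeasurable 1
    (by simpa only [Real.norm_eq_abs] using ae_abs_prod_le_one hb s i)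

theorem integral_sum_pow_le_absMoment {P : Measure Ω} [IsFiniteMeasure P] {Y : ℕ → Ω → ℝ}
    (hm : ∀ i, Measurable (Y i)) (hb : ∀ i, ∀ᵐ ω ∂P, |Y i ω| ≤ 1) (B : Finset ℕ) (p : ℕ) :
    ∫ ω, (∑ i ∈ B, Y i ω) ^ p ∂P ≤ absMoment P Y B p := by
  have h : ∀ ω, (∑ i ∈ B, Y i ω) ^ p = ∑ i : Fin p → B, ∏ j, Y (i j) ω := by
    intro ω
    rw [← Finset.sum_coe_sort, Fintype.sum_pow]
  simp_rw [h]
  rw [integral_finsetSum _ fun i _ =>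
    memLp_one_iff_integrable.1 (memLp_prod hm hb _ (fun j => (i j : ℕ)) 1)]
  exact Finset.sum_le_sum fun i _ => le_abs_self _

/-- Every tuple is sorted by at least one of the `p!` permutations, and reindexing by a fixed
permutation is a bijection of tuples. -/
theorem sum_le_factorial_mul_sum_monotone {p : ℕ} {α : Type*} [Fintype α] [LinearOrder α]
    (f : (Fin p → α) → ℝ) (hf : ∀ i, 0 ≤ f i)
    (hsymm : ∀ i (σ : Equiv.Perm (Fin p)), f (i ∘ σ) = f i) :
    ∑ i, f i ≤ p.factorial * ∑ i with Monotone i, f i := by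
  classical
  calc ∑ i, f i ≤ ∑ i, ∑ σ : Equiv.Perm (Fin p), if Monotone (i ∘ σ) then f (i ∘ σ) else 0 := by
        refine Finset.sum_le_sum fun i _ => ?_
        refine le_trans ?_ (Finset.single_le_sum (f := fun σ : Equiv.Perm (Fin p) =>
          if Monotone (i ∘ σ) then f (i ∘ σ) else 0) ?_ (Finset.mem_univ (Tuple.sort i)))
        · simp only [Tuple.monotone_sort, if_true, hsymm, le_refl]
        · intro σ _
          split_ifs
          exacts [hf _, le_rfl]
    _ = ∑ σ : Equiv.Perm (Fin p), ∑ i with Monotone i, f i := by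
        rw [Finset.sum_comm]
        refine Finset.sum_congr rfl fun σ _ => ?_
        rw [Finset.sum_filter]
        exact Fintype.sum_equiv (Equiv.arrowCongr σ.symm (Equiv.refl α)) _ _ fun i => by
          simp [Equiv.arrowCongr]
    _ = _ := by
        rw [Finset.sum_const, Finset.card_univ, Fintype.card_perm, Fintype.card_fin, nsmul_eq_mul]

theorem absMoment_le_factorial_mul (P : Measure Ω) (Y : ℕ → Ω → ℝ) (B : Finset ℕ) (p : ℕ) :
    absMoment P Y B p ≤
      p.factorial * ∑ i : Fin p → B with Monotone i, |∫ ω, ∏ j, Y (i j) ω ∂P| := by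
  refine sum_le_factorial_mul_sum_monotone _ (fun _ => abs_nonneg _) fun i σ => ?_
  congr 2
  ext ω
  exact Equiv.prod_comp σ fun j => Y (i j) ω

/-- Cutting a tuple at `q` maps tuples injectively into pairs of shorter tuples, and the sum over
all pairs factorises. -/
theorem sum_abs_mul_le_absMoment_mul (P : Measure Ω) (Y : ℕ → Ω → ℝ) (B : Finset ℕ) {n q : ℕ}
    (hq : q ≤ n + 1) :
    ∑ i : Fin (n + 1) → B, |∫ ω, ∏ j ∈ Finset.range q, Y ↑(extendTuple i j) ω ∂P| *
        |∫ ω, ∏ j ∈ Finset.Icc q n, Y ↑(extendTuple i j) ω ∂P|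
      ≤ absMoment P Y B q * absMoment P Y B (n + 1 - q) := by
  classical
  let e : (Fin (n + 1) → B) → (Fin q → B) × (Fin (n + 1 - q) → B) := fun i =>
    (fun j => extendTuple i j, fun j => extendTuple i (q + j))
  have he : Function.Injective e := by
    intro i i' h
    ext j
    rcases lt_or_ge (j : ℕ) q with hj | hj
    · have := congrFun (congrArg Prod.fst h) ⟨j, hj⟩
      simp only [e, extendTuple_val] at this
      rw [this]
    · have := congrFun (congrArg Prod.snd h) ⟨j - q, by omega⟩
      simp only [e] at this
      rw [show q + (j - q) = (j : ℕ) by omega, extendTuple_val, extendTuple_val] at this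
      rw [this]
  have h := Finset.sum_le_sum_of_subset_of_nonneg (Finset.subset_univ (Finset.univ.image e))
    (f := fun x => |∫ ω, ∏ j, Y (x.1 j) ω ∂P| * |∫ ω, ∏ j, Y (x.2 j) ω ∂P|)
    fun x _ _ => by positivity
  rw [Finset.sum_image fun a _ b _ hab => he hab, Fintype.sum_prod_type] at h
  simp only [← Finset.mul_sum, ← Finset.sum_mul] at h
  refine le_trans (le_of_eq (Finset.sum_congr rfl fun i _ => ?_)) h
  congr 3
  · ext ω
    exact Finset.prod_range _
  · ext ω
    have : Finset.Icc q n = Finset.Ico q (n + 1) := by ext; simp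
    rw [this, Finset.prod_Ico_eq_prod_range]
    exact Finset.prod_range _

/-- Summing out the first entry with the others fixed costs a factor `K`; after `n` such steps one
free entry remains and contributes the cardinality of `B`. -/
theorem sum_prod_dist_le (B : Finset ℕ) (κ : ℕ → ℝ) (hκ : ∀ g, 0 ≤ κ g) {K : ℝ}
    (hK : ∀ b : ℕ, ∑ a ∈ B, κ (Nat.dist a b) ≤ K) (n : ℕ) :
    ∑ i : Fin (n + 1) → B, ∏ j : Fin n, κ (Nat.dist (i j.castSucc) (i j.succ)) ≤ B.card * K ^ n := by
  induction n with
  | zero => simp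
  | succ n ih =>
    have hK0 : 0 ≤ K := (Finset.sum_nonneg fun a _ => hκ _).trans (hK 0)
    rw [← (Fin.consEquiv fun _ => (B : Type)).sum_comp, Fintype.sum_prod_type_right]
    simp only [Fin.consEquiv, Equiv.coe_fn_mk, Fin.prod_univ_succ (n := n), Fin.castSucc_zero, Fin.cons_zero,
      Fin.cons_succ, ← Fin.succ_castSucc]
    calc _ ≤ ∑ i : Fin (n + 1) → B, K * ∏ j : Fin n, κ (Nat.dist (i j.castSucc) (i j.succ)) := by
          refine Finset.sum_le_sum fun i _ => ?_
          rw [← Finset.sum_mul]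
          refine mul_le_mul_of_nonneg_right ?_ (Finset.prod_nonneg fun _ _ => hκ _)
          rw [Finset.sum_coe_sort B fun a => κ (Nat.dist a (i 0))]
          exact hK _
      _ = K * ∑ i : Fin (n + 1) → B, ∏ j : Fin n, κ (Nat.dist (i j.castSucc) (i j.succ)) := by
          rw [Finset.mul_sum]
      _ ≤ K * (B.card * K ^ n) := by gcongr
      _ = _ := by ring

/-- The recursive bound for absolute moments: a monotone tuple is split at its largest gap. -/
theorem absMoment_succ_le {P : Measure Ω} [IsProbabilityMeasure P] {Y : ℕ → Ω → ℝ}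
    (hm : ∀ i, Measurable (Y i)) (hb : ∀ i, ∀ᵐ ω ∂P, |Y i ω| ≤ 1) (B : Finset ℕ) {n : ℕ}
    (hn : 1 ≤ n) (κ : ℕ → ℝ) (hκ : ∀ g, 0 ≤ κ g) {K D : ℝ} (hD : 0 ≤ D)
    (hK : ∀ b : ℕ, ∑ a ∈ B, κ (Nat.dist a b) ≤ K)
    (hcov : ∀ i : ℕ → ℕ, Monotone i → ∀ q, 1 ≤ q → q ≤ n →
      (∀ j < n, i (j + 1) - i j ≤ i q - i (q - 1)) →
      |cov[fun ω => ∏ j ∈ Finset.range q, Y (i j) ω,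
        fun ω => ∏ j ∈ Finset.Icc q n, Y (i j) ω; P]| ≤
          D * ∏ j ∈ Finset.range n, κ (i (j + 1) - i j)) :
    absMoment P Y B (n + 1) ≤ (n + 1).factorial *
      (∑ q ∈ Finset.Icc 1 n, absMoment P Y B q * absMoment P Y B (n + 1 - q)
        + D * (B.card * K ^ n)) := by
  classical
  refine (absMoment_le_factorial_mul P Y B (n + 1)).trans ?_
  gcongr
  have key : ∀ i : Fin (n + 1) → B, Monotone i → |∫ ω, ∏ j, Y (i j) ω ∂P| ≤
      ∑ q ∈ Finset.Icc 1 n, |∫ ω, ∏ j ∈ Finset.range q, Y ↑(extendTuple i j) ω ∂P| *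
        |∫ ω, ∏ j ∈ Finset.Icc q n, Y ↑(extendTuple i j) ω ∂P|
      + D * ∏ j : Fin n, κ (Nat.dist (i j.castSucc) (i j.succ)) := by
    intro i hi
    have hmono : Monotone fun j => ((extendTuple i j : B) : ℕ) := fun a b hab =>
      monotone_extendTuple hi hab
    obtain ⟨q, hq, hmax⟩ := (Finset.Icc 1 n).exists_max_image
      (fun q => ((extendTuple i q : B) : ℕ) - (extendTuple i (q - 1) : B)) ⟨1, by simp [hn]⟩
    rw [Finset.mem_Icc] at hq
    -- The covariance hypothesis is only available at a gap that dominates all the others, hence the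
    -- maximising `q`.
    have hc := hcov (fun j => ↑(extendTuple i j)) hmono q hq.1 hq.2 fun j hj => by
      simpa using hmax (j + 1) (by simp; omega)
    rw [covariance_eq_sub (memLp_prod hm hb _ _ 2) (memLp_prod hm hb _ _ 2)] at hc
    have hprod : ∀ ω, ∏ j, Y (i j) ω = (∏ j ∈ Finset.range q, Y ↑(extendTuple i j) ω) *
        ∏ j ∈ Finset.Icc q n, Y ↑(extendTuple i j) ω := by
      intro ω
      have h1 : Finset.Icc q n = Finset.Ico q (n + 1) := by ext; simp
      rw [h1, Finset.prod_range_mul_prod_Ico _ (by omega : q ≤ n + 1), Finset.prod_range]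
      exact Finset.prod_congr rfl fun j _ => by rw [extendTuple_val]
    have hgap : ∏ j : Fin n, κ (Nat.dist (i j.castSucc) (i j.succ)) =
        ∏ j ∈ Finset.range n, κ (↑(extendTuple i (j + 1)) - ↑(extendTuple i j)) := by
      rw [Finset.prod_range]
      refine Finset.prod_congr rfl fun j _ => ?_
      have h1 := extendTuple_val i j.castSucc
      have h2 := extendTuple_val i j.succ
      simp only [Fin.val_castSucc, Fin.val_succ] at h1 h2
      rw [h1, h2, Nat.dist_eq_sub_of_le]
      exact hi (Fin.castSucc_le_succ j)
    rw [hgap]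
    have hsplit := Finset.single_le_sum (f := fun q =>
      |∫ ω, ∏ j ∈ Finset.range q, Y ↑(extendTuple i j) ω ∂P| *
        |∫ ω, ∏ j ∈ Finset.Icc q n, Y ↑(extendTuple i j) ω ∂P|)
        (fun _ _ => by positivity) (Finset.mem_Icc.2 hq)
    simp_rw [hprod]
    simp only [Pi.mul_apply] at hc
    rw [← abs_mul] at hsplit
    have := abs_sub_abs_le_abs_sub
      (∫ ω, (∏ j ∈ Finset.range q, Y ↑(extendTuple i j) ω) *
        ∏ j ∈ Finset.Icc q n, Y ↑(extendTuple i j) ω ∂P)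
      ((∫ ω, ∏ j ∈ Finset.range q, Y ↑(extendTuple i j) ω ∂P) *
        ∫ ω, ∏ j ∈ Finset.Icc q n, Y ↑(extendTuple i j) ω ∂P)
    linarith
  calc _ ≤ ∑ i : Fin (n + 1) → B with Monotone i,
        (∑ q ∈ Finset.Icc 1 n, |∫ ω, ∏ j ∈ Finset.range q, Y ↑(extendTuple i j) ω ∂P| *
        |∫ ω, ∏ j ∈ Finset.Icc q n, Y ↑(extendTuple i j) ω ∂P|
        + D * ∏ j : Fin n, κ (Nat.dist (i j.castSucc) (i j.succ))) :=
        Finset.sum_le_sum fun i hi => key i (Finset.mem_filter.1 hi).2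
    _ ≤ ∑ i : Fin (n + 1) → B,
        (∑ q ∈ Finset.Icc 1 n, |∫ ω, ∏ j ∈ Finset.range q, Y ↑(extendTuple i j) ω ∂P| *
        |∫ ω, ∏ j ∈ Finset.Icc q n, Y ↑(extendTuple i j) ω ∂P|
        + D * ∏ j : Fin n, κ (Nat.dist (i j.castSucc) (i j.succ))) :=
        Finset.sum_le_sum_of_subset_of_nonneg (Finset.filter_subset _ _) fun i _ _ =>
          add_nonneg (Finset.sum_nonneg fun _ _ => by positivity)
            (mul_nonneg hD (Finset.prod_nonneg fun _ _ => hκ _))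
    _ ≤ _ := by
        rw [Finset.sum_add_distrib, Finset.sum_comm, ← Finset.mul_sum]
        gcongr with q hq
        · exact sum_abs_mul_le_absMoment_mul P Y B (by have := (Finset.mem_Icc.1 hq).2; omega)
        · exact sum_prod_dist_le B κ hκ hK n

end Moments

/-! ### Moment bounds from multiple mixing. -/

section MomentBound

/-- Each distance to `b` occurs at most once on either side of `b`. -/
theorem sum_dist_le_two_mul (B : Finset ℕ) (b : ℕ) (φ : ℕ → ℝ) (hφ : ∀ g, 0 ≤ φ g) {S : ℝ}
    (hS : ∀ N, ∑ g ∈ Finset.range N, φ g ≤ S) : ∑ a ∈ B, φ (Nat.dist a b) ≤ 2 * S := by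
  classical
  have key : ∀ (s : Finset ℕ), Set.InjOn (fun a => Nat.dist a b) s →
      ∑ a ∈ s, φ (Nat.dist a b) ≤ S := by
    intro s hs
    rw [← Finset.sum_image (f := φ) hs]
    refine le_trans (Finset.sum_le_sum_of_subset_of_nonneg
      (t := Finset.range ((s.image fun a => Nat.dist a b).sup id + 1)) ?_ fun _ _ _ => hφ _) (hS _)
    intro x hx
    rw [Finset.mem_range, Nat.lt_succ_iff]
    exact Finset.le_sup (f := id) hx
  rw [← Finset.sum_filter_add_sum_filter_not B (fun a => a ≤ b), two_mul]
  refine add_le_add (key _ ?_) (key _ ?_)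
  · intro x hx y hy hxy
    simp only [Finset.coe_filter, Set.mem_ofPred_eq] at hx hy
    simp only [Nat.dist] at hxy
    omega
  · intro x hx y hy hxy
    simp only [Finset.coe_filter, Set.mem_ofPred_eq] at hx hy
    simp only [Nat.dist] at hxy
    omega

/-- About `A / |log ρ|` terms are bounded by 1, and the rest are dominated by a geometric series.
Linearity in `A` is what turns the 𝒞-norm into its logarithm in the moment bounds. -/
theorem exists_sum_min_one_geometric_le {ρ : ℝ} (h0 : 0 < ρ) (h1 : ρ < 1) :
    ∃ C : ℝ, 0 ≤ C ∧ ∀ A : ℝ, 0 ≤ A → ∀ N : ℕ,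
      ∑ g ∈ Finset.range N, min 1 (Real.exp A * ρ ^ g) ≤ C * (1 + A) := by
  have hl : 0 < -Real.log ρ := by linarith [Real.log_neg h0 h1]
  have h1' : 0 < 1 - ρ := by linarith
  refine ⟨(-Real.log ρ)⁻¹ + 1 + (1 - ρ)⁻¹, by positivity, fun A hA N => ?_⟩
  set m := ⌈A * (-Real.log ρ)⁻¹⌉₊ with hm
  have hm1 : A * (-Real.log ρ)⁻¹ ≤ m := Nat.le_ceil _
  have hm2 : (m : ℝ) ≤ A * (-Real.log ρ)⁻¹ + 1 := (Nat.ceil_lt_add_one (by positivity)).le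
  have hexp : Real.exp A * ρ ^ m ≤ 1 := by
    rw [← Real.exp_log h0, ← Real.exp_nat_mul, ← Real.exp_add, Real.exp_le_one_iff]
    have : A ≤ m * (-Real.log ρ) := by
      rw [← div_eq_mul_inv, div_le_iff₀ hl] at hm1
      exact hm1
    linarith
  have hmono : ∑ g ∈ Finset.range N, min 1 (Real.exp A * ρ ^ g) ≤
      ∑ g ∈ Finset.range (m + N), min 1 (Real.exp A * ρ ^ g) :=
    Finset.sum_le_sum_of_subset_of_nonneg (Finset.range_mono (by omega)) fun _ _ _ => by positivity
  refine hmono.trans ?_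
  rw [Finset.sum_range_add]
  have e1 : ∑ g ∈ Finset.range m, min 1 (Real.exp A * ρ ^ g) ≤ m := by
    refine (Finset.sum_le_sum fun g _ => min_le_left _ _).trans ?_
    simp
  have e2 : ∑ g ∈ Finset.range N, min 1 (Real.exp A * ρ ^ (m + g)) ≤ (1 - ρ)⁻¹ := by
    calc _ ≤ ∑ g ∈ Finset.range N, ρ ^ g := by
          refine Finset.sum_le_sum fun g _ => (min_le_right _ _).trans ?_
          rw [pow_add, ← mul_assoc]
          exact mul_le_of_le_one_left (by positivity) hexp
      _ ≤ _ := by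
          rw [← tsum_geometric_of_lt_one h0.le h1]
          exact (summable_geometric_of_lt_one h0.le h1).sum_le_tsum _ fun _ _ => by positivity
  have : 0 ≤ (1 - ρ)⁻¹ * A := by positivity
  have : 0 ≤ (-Real.log ρ)⁻¹ := by positivity
  nlinarith

theorem exists_eval_le {n : ℕ} (Q : MvPolynomial (Fin n) ℝ) :
    ∃ (c : ℝ) (d : ℕ), 0 ≤ c ∧ ∀ (x : Fin n → ℝ) (g : ℝ), 0 ≤ g → (∀ j, 0 ≤ x j ∧ x j ≤ g) →
      MvPolynomial.eval x Q ≤ c * (1 + g) ^ d := by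
  refine ⟨∑ m ∈ Q.support, |Q.coeff m|, Q.totalDegree, Finset.sum_nonneg fun _ _ => abs_nonneg _,
    fun x g hg hx => ?_⟩
  rw [MvPolynomial.eval_eq, Finset.sum_mul]
  refine Finset.sum_le_sum fun m hm => ?_
  have hp : 0 ≤ ∏ j ∈ m.support, x j ^ m j := Finset.prod_nonneg fun j _ => pow_nonneg (hx j).1 _
  have hle : ∏ j ∈ m.support, x j ^ m j ≤ (1 + g) ^ Q.totalDegree := by
    calc _ ≤ ∏ j ∈ m.support, (1 + g) ^ m j :=
          Finset.prod_le_prod (fun j _ => pow_nonneg (hx j).1 _) fun j _ =>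
            pow_le_pow_left₀ (hx j).1 (by linarith [(hx j).2]) _
      _ = (1 + g) ^ (m.sum fun _ e => e) := by
          rw [Finset.prod_pow_eq_pow_sum]
          rfl
      _ ≤ _ := pow_le_pow_right₀ (by linarith) (MvPolynomial.le_totalDegree hm)
  calc _ ≤ |Q.coeff m| * ∏ j ∈ m.support, x j ^ m j :=
        mul_le_mul_of_nonneg_right (le_abs_self _) hp
    _ ≤ _ := by gcongr

theorem exists_pow_mul_pow_le (d : ℕ) {r : ℝ} (h0 : 0 ≤ r) (h1 : r < 1) :
    ∃ c : ℝ, 0 ≤ c ∧ ∀ g : ℕ, (1 + (g : ℝ)) ^ d * r ^ g ≤ c := by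
  have h := tendsto_pow_const_mul_const_pow_of_lt_one d h0 h1
  obtain ⟨c, hc⟩ := h.bddAbove_range
  have hc' : ∀ g : ℕ, (g : ℝ) ^ d * r ^ g ≤ c := fun g => hc ⟨g, rfl⟩
  have hc0 : 0 ≤ c := le_trans (by positivity) (hc' 0)
  refine ⟨2 ^ d * c + 1, by positivity, fun g => ?_⟩
  rcases Nat.eq_zero_or_pos g with rfl | hg
  · simp
    positivity
  · have : (1 : ℝ) ≤ g := by exact_mod_cast hg
    calc (1 + (g : ℝ)) ^ d * r ^ g ≤ (2 * g) ^ d * r ^ g := by gcongr; linarith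
      _ = 2 ^ d * (g ^ d * r ^ g) := by rw [mul_pow]; ring
      _ ≤ 2 ^ d * c := by gcongr; exact hc' g
      _ ≤ _ := by linarith

/-- The weight of a gap of length `g` in the covariance bounds. -/
def gapWeight (A ρ : ℝ) (g : ℕ) : ℝ := min 1 (Real.exp A * ρ ^ g)

theorem gapWeight_nonneg {A ρ : ℝ} (hρ : 0 ≤ ρ) (g : ℕ) : 0 ≤ gapWeight A ρ g := by
  unfold gapWeight
  positivity

/-- The decay in the largest gap `G` is shared equally among the `n` gaps, none of which exceeds
`G`. Replacing `exp A` by `exp (n A)` only enlarges the bound because `A ≥ 0`. -/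
theorem min_one_le_prod_gapWeight {A ρ : ℝ} (hA : 0 ≤ A) (h0 : 0 ≤ ρ) (h1 : ρ ≤ 1) {n : ℕ}
    (hn : 1 ≤ n) (g : ℕ → ℕ) (G : ℕ) (hg : ∀ j < n, g j ≤ G) :
    min 1 (Real.exp A * (ρ ^ n) ^ G) ≤ ∏ j ∈ Finset.range n, gapWeight A ρ (g j) := by
  calc min 1 (Real.exp A * (ρ ^ n) ^ G) ≤ gapWeight A ρ G ^ n := by
        unfold gapWeight
        rcases le_total 1 (Real.exp A * ρ ^ G) with h | h
        · rw [min_eq_left h, one_pow]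
          exact min_le_left _ _
        · rw [min_eq_right h, mul_pow, ← pow_mul, mul_comm n G, pow_mul]
          refine (min_le_right _ _).trans ?_
          gcongr
          exact le_self_pow₀ (Real.one_le_exp hA) (by omega)
    _ = ∏ j ∈ Finset.range n, gapWeight A ρ G := by simp
    _ ≤ _ := by
        refine Finset.prod_le_prod (fun _ _ => gapWeight_nonneg h0 _) fun j hj => ?_
        unfold gapWeight
        refine min_le_min le_rfl (mul_le_mul_of_nonneg_left ?_ (Real.exp_nonneg _))
        exact pow_le_pow_of_le_one h0 h1 (hg j (Finset.mem_range.1 hj))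

variable {𝒳 Ω : Type*} [MeasurableSpace 𝒳] [MeasurableSpace Ω]

theorem IsStationary.map_eq {P : Measure Ω} {X : ℕ → Ω → 𝒳} (h : IsStationary P X)
    (hX : ∀ i, Measurable (X i)) (i : ℕ) : P.map (X i) = P.map (X 0) := by
  induction i with
  | zero => rfl
  | succ i ih =>
    rw [← ih]
    have h' := congrArg (fun ν => ν.map fun x : ℕ → 𝒳 => x i) h
    rw [Measure.map_map (measurable_pi_apply i) (measurable_pi_lambda _ fun j => hX (j + 1)),
      Measure.map_map (measurable_pi_apply i) (measurable_pi_lambda _ hX)] at h'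
    exact h'

theorem ae_abs_le_of_eLpNorm_top_le {μ : Measure 𝒳} {f : 𝒳 → ℝ} {M : ℝ} (hM : 0 ≤ M)
    (h : eLpNorm f ∞ μ ≤ ENNReal.ofReal M) : ∀ᵐ x ∂μ, |f x| ≤ M := by
  rw [eLpNorm_exponent_top] at h
  filter_upwards [enorm_ae_le_eLpNormEssSup f μ] with x hx
  have := hx.trans h
  rw [← ofReal_norm, ENNReal.ofReal_le_ofReal_iff hM] at this
  simpa using this

theorem integral_abs_le_eLpNorm_toReal {μ : Measure 𝒳} [IsProbabilityMeasure μ] {f : 𝒳 → ℝ}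
    {s : ℝ≥0∞} (hs : 1 ≤ s) (hf : MemLp f s μ) : ∫ x, |f x| ∂μ ≤ (eLpNorm f s μ).toReal := by
  have h := eLpNorm_le_eLpNorm_of_exponent_le hs hf.1
  have h2 := ENNReal.toReal_mono hf.2.ne h
  rw [eLpNorm_one_eq_lintegral_enorm, ← integral_norm_eq_lintegral_enorm hf.1] at h2
  simpa using h2

/-- Multiple mixing in a form adapted to the recursive moment bound. -/
theorem MultipleMixing.exists_cov_le {P : Measure Ω} [IsProbabilityMeasure P] {μ : Measure 𝒳}
    [IsProbabilityMeasure μ] {X : ℕ → Ω → 𝒳} (hX : ∀ i, Measurable (X i))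
    (hlaw : ∀ i, P.map (X i) = μ) {s : ℝ≥0∞} (hs : 1 ≤ s) {𝒞 : NormedFunctionSpace 𝒳} {d₀ : ℕ}
    (hmix : MultipleMixing P X μ s 𝒞 d₀) {n : ℕ} (hn : 1 ≤ n) :
    ∃ (ℓ : ℕ) (ρ D : ℝ), 0 < ρ ∧ ρ < 1 ∧ 0 ≤ D ∧
      ∀ f : 𝒞.carrier, ∫ x, (f : 𝒳 → ℝ) x ∂μ = 0 → eLpNorm (f : 𝒳 → ℝ) ∞ μ ≤ 1 →
      ∀ L : ℝ, 0 ≤ L → 𝒞.norm f ≤ Real.exp L →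
      ∀ i : ℕ → ℕ, Monotone i → ∀ q, 1 ≤ q → q ≤ n →
      (∀ j < n, i (j + 1) - i j ≤ i q - i (q - 1)) →
      |cov[fun ω => ∏ j ∈ Finset.range q, (f : 𝒳 → ℝ) (X (i j) ω),
        fun ω => ∏ j ∈ Finset.Icc q n, (f : 𝒳 → ℝ) (X (i j) ω); P]| ≤
          D * (eLpNorm (f : 𝒳 → ℝ) s μ).toReal *
            ∏ j ∈ Finset.range n, gapWeight (ℓ * L) ρ (i (j + 1) - i j) := by
  obtain ⟨θ, hθ0, hθ1, hmix⟩ := hmix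
  obtain ⟨ℓ, Q, -, hQ⟩ := hmix n hn
  have hn0 : (0 : ℝ) < n := by exact_mod_cast hn
  have hlog : Real.log θ < 0 := Real.log_neg hθ0 hθ1
  -- Chosen so that `θ = ρ^n ρ^n`: one factor `ρ^n` absorbs the polynomial in the gaps, the other is
  -- distributed over the `n` gaps.
  set ρ := Real.exp (Real.log θ / (2 * n)) with hρ
  have hρ1 : ρ < 1 := by
    rw [hρ, Real.exp_lt_one_iff]
    exact div_neg_of_neg_of_pos hlog (by positivity)
  have hρ0 : 0 < ρ := Real.exp_pos _
  have hρn : ρ ^ n = Real.exp (Real.log θ / 2) := by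
    rw [hρ, ← Real.exp_nat_mul]
    congr 1
    field_simp
  have hθρ : θ = ρ ^ n * ρ ^ n := by
    rw [hρn, ← Real.exp_add, add_halves, Real.exp_log hθ0]
  have hρn1 : ρ ^ n < 1 := pow_lt_one₀ hρ0.le hρ1 (by omega)
  obtain ⟨c, d, hc0, hc⟩ := exists_eval_le Q
  obtain ⟨c', hc'0, hc'⟩ := exists_pow_mul_pow_le d (by positivity : 0 ≤ ρ ^ n) hρn1
  refine ⟨ℓ, ρ, c * c' + 2, hρ0, hρ1, by positivity, ?_⟩
  intro f hf0 hf1 L hL hfL i hi q hq1 hqn hmax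
  set σ := (eLpNorm (f : 𝒳 → ℝ) s μ).toReal with hσ
  set G := i q - i (q - 1) with hG
  have hfm : Measurable (f : 𝒳 → ℝ) := 𝒞.measurable f
  have hfae : ∀ᵐ x ∂μ, |(f : 𝒳 → ℝ) x| ≤ 1 :=
    ae_abs_le_of_eLpNorm_top_le zero_le_one (by simpa using hf1)
  have hfs : MemLp (f : 𝒳 → ℝ) s μ := MemLp.of_bound hfm.aestronglyMeasurable 1 hfae
  set Y : ℕ → Ω → ℝ := fun j ω => (f : 𝒳 → ℝ) (X j ω) with hY
  have hYm : ∀ j, Measurable (Y j) := fun j => hfm.comp (hX j)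
  have hYb : ∀ j, ∀ᵐ ω ∂P, |Y j ω| ≤ 1 := by
    intro j
    have := hlaw j ▸ hfae
    exact ae_of_ae_map (hX j).aemeasurable this
  have hYint : ∀ j, ∫ ω, |Y j ω| ∂P ≤ σ := by
    intro j
    have : ∫ ω, |Y j ω| ∂P = ∫ x, |(f : 𝒳 → ℝ) x| ∂μ := by
      rw [← hlaw j, integral_map (hX j).aemeasurable (by fun_prop)]
    rw [this]
    exact integral_abs_le_eLpNorm_toReal hs hfs
  have hσ0 : 0 ≤ σ := ENNReal.toReal_nonneg
  -- The bound without mixing: one factor is kept for its mean absolute value, at most `σ`, and all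
  -- others are bounded by 1. It supplies the 1 in the truncated weights while keeping the factor
  -- `σ`.
  have htriv : |cov[fun ω => ∏ j ∈ Finset.range q, Y (i j) ω,
      fun ω => ∏ j ∈ Finset.Icc q n, Y (i j) ω; P]| ≤ 2 * σ := by
    rw [covariance_eq_sub (memLp_prod hYm hYb _ _ 2) (memLp_prod hYm hYb _ _ 2)]
    have hle : ∀ᵐ ω ∂P, |∏ j ∈ Finset.range q, Y (i j) ω| ≤ |Y (i 0) ω| := by
      filter_upwards [ae_all_iff.2 hYb] with ω hω
      rw [Finset.abs_prod, ← Finset.mul_prod_erase _ _ (Finset.mem_range.2 (by omega : 0 < q))]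
      exact mul_le_of_le_one_right (abs_nonneg _)
        (Finset.prod_le_one (fun _ _ => abs_nonneg _) fun j _ => hω _)
    have hYi : Integrable (fun ω => |Y (i 0) ω|) P :=
      (memLp_one_iff_integrable.1 (MemLp.of_bound (hYm _).aestronglyMeasurable 1 (hYb _))).abs
    have h1 : |∫ ω, ∏ j ∈ Finset.range q, Y (i j) ω ∂P| ≤ σ := by
      refine (abs_integral_le_integral_abs).trans ((integral_mono_ae ?_ hYi hle).trans (hYint _))
      exact (memLp_one_iff_integrable.1 (memLp_prod hYm hYb _ _ 1)).abs
    have h2 : |∫ ω, ∏ j ∈ Finset.Icc q n, Y (i j) ω ∂P| ≤ 1 := by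
      have := norm_integral_le_of_norm_le_const (μ := P) (C := 1)
        (f := fun ω => ∏ j ∈ Finset.Icc q n, Y (i j) ω)
        (by simpa only [Real.norm_eq_abs] using ae_abs_prod_le_one hYb (Finset.Icc q n) i)
      simpa using this
    have h3 : |∫ ω, (∏ j ∈ Finset.range q, Y (i j) ω) * ∏ j ∈ Finset.Icc q n, Y (i j) ω ∂P| ≤ σ := by
      refine (abs_integral_le_integral_abs).trans ((integral_mono_ae ?_ hYi ?_).trans (hYint (i 0)))
      · exact ((memLp_prod hYm hYb _ _ 2).integrable_mul (memLp_prod hYm hYb _ _ 2)).abs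
      · filter_upwards [hle, ae_abs_prod_le_one hYb (Finset.Icc q n) i] with ω h h'
        rw [abs_mul]
        exact (mul_le_of_le_one_right (abs_nonneg _) h').trans h
    calc _ ≤ |∫ ω, (∏ j ∈ Finset.range q, Y (i j) ω) * ∏ j ∈ Finset.Icc q n, Y (i j) ω ∂P| +
          |(∫ ω, ∏ j ∈ Finset.range q, Y (i j) ω ∂P) * ∫ ω, ∏ j ∈ Finset.Icc q n, Y (i j) ω ∂P| :=
          abs_sub _ _
      _ ≤ σ + σ * 1 := by
          rw [abs_mul]
          gcongr
      _ = 2 * σ := by ring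
  have hev : MvPolynomial.eval (fun j : Fin n => (i (j + 1) : ℝ) - (i j : ℝ)) Q ≤
      c * (1 + (G : ℝ)) ^ d := by
    refine hc _ _ (Nat.cast_nonneg _) fun j => ?_
    have h1 : i j ≤ i (j + 1) := hi (Nat.le_succ _)
    have h2 := hmax j j.2
    rw [← Nat.cast_sub h1]
    exact ⟨Nat.cast_nonneg _, by exact_mod_cast h2⟩
  have hmixed : |cov[fun ω => ∏ j ∈ Finset.range q, Y (i j) ω,
      fun ω => ∏ j ∈ Finset.Icc q n, Y (i j) ω; P]| ≤
      (c * c') * σ * (Real.exp (ℓ * L) * (ρ ^ n) ^ G) := by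
    refine (hQ f hf0 hf1 i hi q hq1 hqn).trans ?_
    have hnorm : 𝒞.norm f ^ ℓ ≤ Real.exp (ℓ * L) := by
      rw [Real.exp_nat_mul]
      exact pow_le_pow_left₀ (apply_nonneg _ _) hfL _
    have hQθ : MvPolynomial.eval (fun j : Fin n => (i (j + 1) : ℝ) - (i j : ℝ)) Q * θ ^ G ≤
        c * c' * (ρ ^ n) ^ G := by
      calc _ ≤ c * (1 + (G : ℝ)) ^ d * θ ^ G := by gcongr
        _ = c * ((1 + (G : ℝ)) ^ d * (ρ ^ n) ^ G) * (ρ ^ n) ^ G := by rw [hθρ, mul_pow]; ring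
        _ ≤ c * c' * (ρ ^ n) ^ G := by gcongr; exact hc' G
    calc _ = σ * 𝒞.norm f ^ ℓ *
          (MvPolynomial.eval (fun j : Fin n => (i (j + 1) : ℝ) - (i j : ℝ)) Q * θ ^ G) := by ring
      _ ≤ σ * 𝒞.norm f ^ ℓ * (c * c' * (ρ ^ n) ^ G) := by
          exact mul_le_mul_of_nonneg_left hQθ (mul_nonneg hσ0 (pow_nonneg (apply_nonneg _ _) _))
      _ ≤ σ * Real.exp (ℓ * L) * (c * c' * (ρ ^ n) ^ G) := by gcongr
      _ = _ := by ring
  calc _ ≤ (c * c' + 2) * σ * min 1 (Real.exp (ℓ * L) * (ρ ^ n) ^ G) := by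
        have hcc : 0 ≤ c * c' * σ := by positivity
        rcases min_choice 1 (Real.exp (ℓ * L) * (ρ ^ n) ^ G) with h | h <;> rw [h]
        · linarith
        · have : 0 ≤ σ * (Real.exp (ℓ * L) * (ρ ^ n) ^ G) := by positivity
          linarith
    _ ≤ _ := by
        gcongr
        exact min_one_le_prod_gapWeight (by positivity) hρ0.le hρ1.le hn _ G hmax

/-- The moment bound under multiple mixing. -/
theorem MultipleMixing.exists_absMoment_le {P : Measure Ω} [IsProbabilityMeasure P] {μ : Measure 𝒳}
    [IsProbabilityMeasure μ] {X : ℕ → Ω → 𝒳} (hX : ∀ i, Measurable (X i))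
    (hlaw : ∀ i, P.map (X i) = μ) {s : ℝ≥0∞} (hs : 1 ≤ s) {𝒞 : NormedFunctionSpace 𝒳} {d₀ : ℕ}
    (hmix : MultipleMixing P X μ s 𝒞 d₀) (p : ℕ) :
    ∃ C : ℝ, 0 ≤ C ∧ ∀ r ≤ p, ∀ f : 𝒞.carrier, ∫ x, (f : 𝒳 → ℝ) x ∂μ = 0 →
      eLpNorm (f : 𝒳 → ℝ) ∞ μ ≤ 1 → ∀ L w : ℝ, 1 ≤ L → L ≤ w → 𝒞.norm f ≤ Real.exp L →
      ∀ B : Finset ℕ, B.card * (eLpNorm (f : 𝒳 → ℝ) s μ).toReal * L ≤ w ^ 2 →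
      absMoment P (fun i ω => (f : 𝒳 → ℝ) (X i ω)) B r ≤ C * w ^ r := by
  induction p with
  | zero =>
    refine ⟨1, zero_le_one, fun r hr f _ _ L w _ _ _ B _ => ?_⟩
    obtain rfl : r = 0 := by omega
    simp [absMoment]
  | succ n ih =>
    obtain ⟨C, hC0, hC⟩ := ih
    rcases Nat.eq_zero_or_pos n with rfl | hn
    -- A tuple of length one has no gap to split at; its moment vanishes because `f` is centred.
    · refine ⟨C, hC0, fun r hr f hf0 hf1 L w hL hLw hfL B hB => ?_⟩
      rcases Nat.lt_or_ge r 1 with hr' | hr'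
      · exact hC r (by omega) f hf0 hf1 L w hL hLw hfL B hB
      · obtain rfl : r = 1 := by omega
        have h0 : ∀ i, ∫ ω, (f : 𝒳 → ℝ) (X i ω) ∂P = 0 := by
          intro i
          rw [← hf0, ← hlaw i, integral_map (hX i).aemeasurable
            (𝒞.measurable f).aestronglyMeasurable]
        simp only [absMoment, Finset.univ_unique, Finset.prod_singleton, h0, abs_zero,
          Finset.sum_const_zero]
        have : 0 ≤ w := by linarith
        positivity
    · obtain ⟨ℓ, ρ, D, hρ0, hρ1, hD0, hcov⟩ := hmix.exists_cov_le hX hlaw hs hn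
      obtain ⟨Cκ, hCκ0, hCκ⟩ := exists_sum_min_one_geometric_le hρ0 hρ1
      set C' := (n + 1).factorial * (n * C ^ 2 + D * (2 * Cκ * (1 + ℓ)) ^ n) with hC'
      have hC'0 : 0 ≤ C' := by positivity
      refine ⟨C + C', by positivity, fun r hr f hf0 hf1 L w hL hLw hfL B hB => ?_⟩
      have hw : 0 ≤ w := by linarith
      rcases Nat.lt_or_ge r (n + 1) with hr' | hr'
      · refine (hC r (by omega) f hf0 hf1 L w hL hLw hfL B hB).trans ?_
        gcongr
        linarith
      · obtain rfl : r = n + 1 := by omega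
        set σ := (eLpNorm (f : 𝒳 → ℝ) s μ).toReal with hσ
        have hσ0 : 0 ≤ σ := ENNReal.toReal_nonneg
        have hfae : ∀ᵐ x ∂μ, |(f : 𝒳 → ℝ) x| ≤ 1 :=
          ae_abs_le_of_eLpNorm_top_le zero_le_one (by simpa using hf1)
        have hK : ∀ b : ℕ, ∑ a ∈ B, gapWeight (ℓ * L) ρ (Nat.dist a b) ≤
            2 * (Cκ * (1 + ℓ * L)) := fun b =>
          sum_dist_le_two_mul B b _ (fun g => gapWeight_nonneg hρ0.le g)
            fun N => hCκ (ℓ * L) (by positivity) N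
        have hrec := absMoment_succ_le (P := P) (Y := fun i ω => (f : 𝒳 → ℝ) (X i ω))
          (fun i => (𝒞.measurable f).comp (hX i))
          (fun i => ae_of_ae_map (hX i).aemeasurable ((hlaw i).symm ▸ hfae))
          B hn (gapWeight (ℓ * L) ρ) (fun g => gapWeight_nonneg hρ0.le g)
          (D := D * σ) (by positivity) hK
          (fun i hi q hq1 hqn hmax => hcov f hf0 hf1 L (by linarith) hfL i hi q hq1 hqn hmax)
        refine hrec.trans ?_
        have hsum : ∑ q ∈ Finset.Icc 1 n, absMoment P (fun i ω => (f : 𝒳 → ℝ) (X i ω)) B q *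
            absMoment P (fun i ω => (f : 𝒳 → ℝ) (X i ω)) B (n + 1 - q) ≤ n * C ^ 2 * w ^ (n + 1) := by
          refine (Finset.sum_le_card_nsmul _ _ (C ^ 2 * w ^ (n + 1)) fun q hq => ?_).trans ?_
          · rw [Finset.mem_Icc] at hq
            calc _ ≤ (C * w ^ q) * (C * w ^ (n + 1 - q)) := by
                  gcongr
                  · exact absMoment_nonneg _ _ _ _
                  · exact hC q hq.2 f hf0 hf1 L w hL hLw hfL B hB
                  · exact hC _ (by omega) f hf0 hf1 L w hL hLw hfL B hB
              _ = C ^ 2 * (w ^ q * w ^ (n + 1 - q)) := by ring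
              _ = _ := by rw [← pow_add]; congr 2; omega
          · rw [Nat.card_Icc, nsmul_eq_mul]
            simp
            ring_nf
            rfl
        -- Of the `n` factors `L`, one combines with `|B| σ` to give at most `w²`, and the other `n
        -- - 1` are each at most `w`.
        have hdiag : D * σ * (B.card * (2 * (Cκ * (1 + ℓ * L))) ^ n) ≤
            D * (2 * Cκ * (1 + ℓ)) ^ n * w ^ (n + 1) := by
          have h1 : 2 * (Cκ * (1 + ℓ * L)) ≤ 2 * Cκ * (1 + ℓ) * L := by
            have : 1 + ℓ * L ≤ (1 + ℓ) * L := by linarith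
            calc _ = 2 * Cκ * (1 + ℓ * L) := by ring
              _ ≤ 2 * Cκ * ((1 + ℓ) * L) := by gcongr
              _ = _ := by ring
          have h2 : (L : ℝ) ^ n = L * L ^ (n - 1) := by
            rw [← pow_succ']; congr 1; omega
          have h3 : w ^ (n + 1) = w ^ 2 * w ^ (n - 1) := by
            rw [← pow_add]; congr 1; omega
          calc _ ≤ D * σ * (B.card * (2 * Cκ * (1 + ℓ) * L) ^ n) := by gcongr
            _ = D * (2 * Cκ * (1 + ℓ)) ^ n * ((B.card * σ * L) * L ^ (n - 1)) := by
                rw [mul_pow _ L, h2]; ring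
            _ ≤ D * (2 * Cκ * (1 + ℓ)) ^ n * (w ^ 2 * w ^ (n - 1)) := by gcongr
            _ = _ := by rw [h3]
        calc _ ≤ ((n + 1).factorial : ℝ) * (n * C ^ 2 * w ^ (n + 1) +
              D * (2 * Cκ * (1 + ℓ)) ^ n * w ^ (n + 1)) := by gcongr
          _ = C' * w ^ (n + 1) := by rw [hC']; ring
          _ ≤ _ := by gcongr; linarith

end MomentBound

/-! ### Moments of increments of the empirical process. -/

section Increments

variable {𝒳 Ω : Type*} [MeasurableSpace 𝒳] [MeasurableSpace Ω]

theorem exists_ae_abs_sum_le {P : Measure Ω} {μ : Measure 𝒳}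
    {X : ℕ → Ω → 𝒳} (hX : ∀ i, Measurable (X i)) (hlaw : ∀ i, P.map (X i) = μ)
    {g : 𝒳 → ℝ} {M : ℝ} (hM : 0 ≤ M) (hg : eLpNorm g ∞ μ ≤ ENNReal.ofReal M)
    (B : Finset ℕ) (c : ℝ) : ∃ b : ℝ, ∀ᵐ ω ∂P, |∑ i ∈ B, (g (X i ω) - c)| ≤ b := by
  have hb : ∀ i, ∀ᵐ ω ∂P, |g (X i ω)| ≤ M := fun i =>
    ae_of_ae_map (hX i).aemeasurable ((hlaw i).symm ▸ ae_abs_le_of_eLpNorm_top_le hM hg)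
  refine ⟨B.card • (M + |c|), ?_⟩
  filter_upwards [ae_all_iff.2 hb] with ω hω
  refine (Finset.abs_sum_le_sum_abs _ _).trans (Finset.sum_le_card_nsmul _ _ _ fun i _ => ?_)
  exact (abs_sub _ _).trans (by gcongr; exact hω i)

theorem integrable_sum_pow {P : Measure Ω} [IsFiniteMeasure P] {μ : Measure 𝒳}
    {X : ℕ → Ω → 𝒳} (hX : ∀ i, Measurable (X i)) (hlaw : ∀ i, P.map (X i) = μ)
    {g : 𝒳 → ℝ} (hgm : Measurable g) {M : ℝ} (hM : 0 ≤ M)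
    (hg : eLpNorm g ∞ μ ≤ ENNReal.ofReal M) (B : Finset ℕ) (c : ℝ) (r : ℕ) :
    Integrable (fun ω => (∑ i ∈ B, (g (X i ω) - c)) ^ r) P := by
  obtain ⟨b, hb⟩ := exists_ae_abs_sum_le hX hlaw hM hg B c
  have hm : Measurable fun ω => (∑ i ∈ B, (g (X i ω) - c)) ^ r :=
    (Finset.measurable_fun_sum _ fun i _ => (hgm.comp (hX i)).sub_const c).pow_const r
  refine Integrable.of_bound hm.aestronglyMeasurable (b ^ r) ?_
  filter_upwards [hb] with ω hω
  rw [Real.norm_eq_abs, abs_pow]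
  exact pow_le_pow_left₀ (abs_nonneg _) hω _

/-- Moments of centred sums of an essentially bounded function in `𝒞`. -/
theorem MultipleMixing.exists_integral_sum_pow_le {P : Measure Ω} [IsProbabilityMeasure P]
    {μ : Measure 𝒳} [IsProbabilityMeasure μ] {X : ℕ → Ω → 𝒳} (hX : ∀ i, Measurable (X i))
    (hlaw : ∀ i, P.map (X i) = μ) {s : ℝ≥0∞} (hs : 1 ≤ s) {𝒞 : NormedFunctionSpace 𝒳} {d₀ : ℕ}
    (hmix : MultipleMixing P X μ s 𝒞 d₀) (hone : (1 : 𝒳 → ℝ) ∈ 𝒞.carrier) {M : ℝ} (hM : 1 ≤ M)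
    (p : ℕ) :
    ∃ C : ℝ, 0 ≤ C ∧ ∀ g : 𝒞.carrier, eLpNorm (g : 𝒳 → ℝ) ∞ μ ≤ ENNReal.ofReal M →
      ∀ L w : ℝ, 1 ≤ L → L ≤ w → 𝒞.norm g + 𝒞.norm ⟨1, hone⟩ ≤ Real.exp L →
      ∀ B : Finset ℕ, B.card * (eLpNorm (g : 𝒳 → ℝ) s μ).toReal * L ≤ w ^ 2 →
      ∫ ω, (∑ i ∈ B, ((g : 𝒳 → ℝ) (X i ω) - ∫ x, (g : 𝒳 → ℝ) x ∂μ)) ^ p ∂P ≤ C * w ^ p := by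
  obtain ⟨C, hC0, hC⟩ := hmix.exists_absMoment_le hX hlaw hs p
  have hM0 : 0 < M := by linarith
  refine ⟨(2 * M) ^ p * C, by positivity, fun g hg L w hL hLw hgL B hB => ?_⟩
  set m := ∫ x, (g : 𝒳 → ℝ) x ∂μ with hm
  have hgm := 𝒞.measurable g
  have hgae := ae_abs_le_of_eLpNorm_top_le hM0.le hg
  have hgs : MemLp (g : 𝒳 → ℝ) s μ := MemLp.of_bound hgm.aestronglyMeasurable M hgae
  have hgi : Integrable (g : 𝒳 → ℝ) μ := hgs.integrable hs
  have hmσ : |m| ≤ (eLpNorm (g : 𝒳 → ℝ) s μ).toReal :=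
    abs_integral_le_integral_abs.trans (integral_abs_le_eLpNorm_toReal hs hgs)
  have hmM : |m| ≤ M := by
    have := norm_integral_le_of_norm_le_const (μ := μ) (C := M) (f := (g : 𝒳 → ℝ)) hgae
    simpa using this
  -- Centring stays inside 𝒞 because it contains the constants. The factor `(2M)⁻¹` makes `h`
  -- essentially bounded by 1 and, since `|m| ≤ ‖g‖_s` and `M ≥ 1`, also gives `‖h‖_s ≤ ‖g‖_s`.
  set h : 𝒞.carrier := (2 * M)⁻¹ • (g - m • ⟨1, hone⟩) with hh
  have hhv : (h : 𝒳 → ℝ) = fun x => (2 * M)⁻¹ * ((g : 𝒳 → ℝ) x - m) := by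
    ext x
    simp [hh]
  have hh0 : ∫ x, (h : 𝒳 → ℝ) x ∂μ = 0 := by
    rw [hhv, integral_const_mul, integral_sub hgi (integrable_const _)]
    simp [hm]
  have hh1 : eLpNorm (h : 𝒳 → ℝ) ∞ μ ≤ 1 := by
    rw [eLpNorm_exponent_top, ← ENNReal.ofReal_one]
    refine eLpNormEssSup_le_of_ae_bound (C := 1) ?_
    filter_upwards [hgae] with x hx
    rw [hhv, Real.norm_eq_abs, abs_mul, abs_of_pos (by positivity), inv_mul_le_iff₀ (by positivity)]
    exact (abs_sub _ _).trans (by linarith)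
  have hhn : 𝒞.norm h ≤ Real.exp L := by
    refine le_trans ?_ hgL
    rw [hh, map_smul_eq_mul, Real.norm_eq_abs, abs_of_pos (by positivity),
      inv_mul_le_iff₀ (by positivity)]
    refine (map_sub_le_add 𝒞.norm _ _).trans ?_
    rw [map_smul_eq_mul, Real.norm_eq_abs]
    have h1 : 0 ≤ 𝒞.norm g := apply_nonneg _ _
    have h2 : 0 ≤ 𝒞.norm ⟨1, hone⟩ := apply_nonneg _ _
    nlinarith
  have hhσ : (eLpNorm (h : 𝒳 → ℝ) s μ).toReal ≤ (eLpNorm (g : 𝒳 → ℝ) s μ).toReal := by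
    have e1 : eLpNorm (h : 𝒳 → ℝ) s μ ≤
        ENNReal.ofReal (2 * M)⁻¹ * (eLpNorm (g : 𝒳 → ℝ) s μ + ENNReal.ofReal |m|) := by
      have : (h : 𝒳 → ℝ) = (2 * M)⁻¹ • ((g : 𝒳 → ℝ) - fun _ => m) := by
        rw [hhv]; rfl
      rw [this, eLpNorm_const_smul, ← Real.enorm_of_nonneg (by positivity : 0 ≤ (2 * M)⁻¹)]
      gcongr
      refine (eLpNorm_sub_le hgm.aestronglyMeasurable aestronglyMeasurable_const hs).trans ?_
      gcongr
      rw [eLpNorm_const _ (by positivity) (NeZero.ne μ)]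
      simp [Real.enorm_eq_ofReal_abs]
    have e2 := ENNReal.toReal_mono (by finiteness [hgs.2.ne]) e1
    rw [ENNReal.toReal_mul, ENNReal.toReal_add hgs.2.ne (by finiteness),
      ENNReal.toReal_ofReal (by positivity), ENNReal.toReal_ofReal (by positivity)] at e2
    refine e2.trans ?_
    rw [inv_mul_le_iff₀ (by positivity)]
    have : 0 ≤ (eLpNorm (g : 𝒳 → ℝ) s μ).toReal := ENNReal.toReal_nonneg
    nlinarith
  have hBh : B.card * (eLpNorm (h : 𝒳 → ℝ) s μ).toReal * L ≤ w ^ 2 := by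
    refine le_trans ?_ hB
    gcongr
  have hhae : ∀ᵐ x ∂μ, |(h : 𝒳 → ℝ) x| ≤ 1 :=
    ae_abs_le_of_eLpNorm_top_le zero_le_one (by simpa using hh1)
  have key := (integral_sum_pow_le_absMoment (P := P) (Y := fun i ω => (h : 𝒳 → ℝ) (X i ω))
    (fun i => (𝒞.measurable h).comp (hX i))
    (fun i => ae_of_ae_map (hX i).aemeasurable ((hlaw i).symm ▸ hhae)) B p).trans
    (hC p le_rfl h hh0 hh1 L w hL hLw hhn B hBh)
  have hsum : ∀ ω, (∑ i ∈ B, ((g : 𝒳 → ℝ) (X i ω) - m)) ^ p =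
      (2 * M) ^ p * (∑ i ∈ B, (h : 𝒳 → ℝ) (X i ω)) ^ p := by
    intro ω
    rw [← mul_pow, hhv, ← Finset.mul_sum, ← mul_assoc, mul_inv_cancel₀ (by positivity), one_mul]
  simp_rw [hsum]
  rw [integral_const_mul, mul_assoc]
  gcongr

theorem measurable_seqEmp {μ : Measure 𝒳} {X : ℕ → Ω → 𝒳} (hX : ∀ i, Measurable (X i))
    {f : 𝒳 → ℝ} (hf : Measurable f) (n : ℕ) (t : ℝ) : Measurable (seqEmp μ X n f t) :=
  (Finset.measurable_fun_sum _ fun i _ => (hf.comp (hX i)).sub_const _).const_mul _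

/-- The increment splits into a change of function on the old time block and the new function on the
added block. The first is small through the size of `g - f`, the second through the length of the
block. -/
theorem seqEmp_sub_seqEmp {𝒳 Ω : Type*} [MeasurableSpace 𝒳] {μ : Measure 𝒳} (X : ℕ → Ω → 𝒳)
    {f g : 𝒳 → ℝ} (hf : Integrable f μ) (hg : Integrable g μ) (n : ℕ) {t u : ℝ} (htu : t ≤ u) (ω : Ω) :
    seqEmp μ X n g u ω - seqEmp μ X n f t ω = (1 / √(n : ℝ)) *
      ((∑ i ∈ Finset.Icc 1 ⌊(n : ℝ) * t⌋₊, ((g - f) (X i ω) - ∫ x, (g - f) x ∂μ)) +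
        ∑ i ∈ Finset.Ioc ⌊(n : ℝ) * t⌋₊ ⌊(n : ℝ) * u⌋₊, (g (X i ω) - ∫ x, g x ∂μ)) := by
  have hle : ⌊(n : ℝ) * t⌋₊ ≤ ⌊(n : ℝ) * u⌋₊ := Nat.floor_mono (by gcongr)
  have h1 : Finset.Icc 1 ⌊(n : ℝ) * u⌋₊ = Finset.Ioc 0 ⌊(n : ℝ) * u⌋₊ := by ext; simp; omega
  have h2 : Finset.Icc 1 ⌊(n : ℝ) * t⌋₊ = Finset.Ioc 0 ⌊(n : ℝ) * t⌋₊ := by ext; simp; omega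
  simp only [seqEmp, Pi.sub_apply]
  rw [integral_sub hg hf, h1, h2, ← Finset.sum_Ioc_consecutive _ (Nat.zero_le _) hle]
  simp only [Finset.sum_sub_distrib]
  ring

/-- With `L = c₃ β^k` and `w²` of order `n (β/2)^k`, the first three bounds are the requirements of
the moment bound: `L ≤ w`, and `|B| ‖·‖_s L ≤ w²` for the change of function and for the added time
block. The last one pays for rounding the block length to an integer. -/
theorem increment_scales {c₃ c₀ M β : ℝ} (hc₃ : 1 ≤ c₃) (hc₀ : 1 ≤ c₀) (hM : 1 ≤ M) (hβ1 : 1 ≤ β)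
    (hβ2 : β ≤ 2) {k n : ℕ} (hkn : (4 : ℝ) ^ k ≤ c₀ * n) :
    (c₃ * β ^ k) ^ 2 ≤ c₃ ^ 2 * (1 + c₀) * (2 * M) * (n * (β / 2) ^ k) ∧
    n * (2 * (1 / 2) ^ k) * (c₃ * β ^ k) ≤ c₃ ^ 2 * (1 + c₀) * (2 * M) * (n * (β / 2) ^ k) ∧
    (1 + c₀) * (n * (1 / 2) ^ k) * M * (c₃ * β ^ k) ≤
      c₃ ^ 2 * (1 + c₀) * (2 * M) * (n * (β / 2) ^ k) ∧
    1 ≤ c₀ * n * (1 / 4) ^ k := by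
  have hβ0 : 0 < β := by linarith
  have hβ2k : (β / 2) ^ k = β ^ k * (1 / 2) ^ k := by
    rw [← mul_pow]; congr 1; ring
  have h4 : (1 / 4 : ℝ) ^ k = (1 / 2) ^ k * (1 / 2) ^ k := by rw [← mul_pow]; norm_num
  have h42 : (4 : ℝ) ^ k * (1 / 4) ^ k = 1 := by rw [← mul_pow]; norm_num
  have hnk : 1 ≤ c₀ * n * (1 / 4) ^ k := by
    calc (1 : ℝ) = (4 : ℝ) ^ k * (1 / 4) ^ k := h42.symm
      _ ≤ _ := by gcongr
  have hβhalf : β ^ k * (1 / 2) ^ k ≤ 1 := by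
    rw [← hβ2k]; exact pow_le_one₀ (by positivity) (by linarith)
  have hβk : β ^ k ≤ c₀ * n * (1 / 2) ^ k := by
    calc β ^ k ≤ β ^ k * (c₀ * n * (1 / 4) ^ k) := le_mul_of_one_le_right (by positivity) hnk
      _ = (β ^ k * (1 / 2) ^ k) * (c₀ * n * (1 / 2) ^ k) := by rw [h4]; ring
      _ ≤ 1 * (c₀ * n * (1 / 2) ^ k) := by gcongr
      _ = _ := one_mul _
  have hsq : c₃ ≤ c₃ ^ 2 := le_self_pow₀ hc₃ (by norm_num)
  refine ⟨?_, ?_, ?_, hnk⟩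
  · calc (c₃ * β ^ k) ^ 2 = c₃ ^ 2 * (β ^ k * β ^ k) := by ring
      _ ≤ c₃ ^ 2 * (β ^ k * (c₀ * n * (1 / 2) ^ k)) := by gcongr
      _ = c₃ ^ 2 * c₀ * 1 * (n * (β / 2) ^ k) := by rw [hβ2k]; ring
      _ ≤ c₃ ^ 2 * (1 + c₀) * (2 * M) * (n * (β / 2) ^ k) := by
          gcongr <;> linarith
  · calc _ = c₃ * 1 * 2 * (n * (β / 2) ^ k) := by rw [hβ2k]; ring
      _ ≤ c₃ ^ 2 * (1 + c₀) * (2 * M) * (n * (β / 2) ^ k) := by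
          gcongr <;> linarith
  · calc _ = c₃ * (1 + c₀) * (1 * M) * (n * (β / 2) ^ k) := by rw [hβ2k]; ring
      _ ≤ c₃ ^ 2 * (1 + c₀) * (2 * M) * (n * (β / 2) ^ k) := by
          gcongr
          linarith

set_option maxHeartbeats 1000000 in
/-- Moments of the increments of the sequential empirical process between two brackets of
consecutive levels. -/
theorem MultipleMixing.exists_increment_moment_le {P : Measure Ω} [IsProbabilityMeasure P]
    {μ : Measure 𝒳} [IsProbabilityMeasure μ] {X : ℕ → Ω → 𝒳} (hX : ∀ i, Measurable (X i))
    (hlaw : ∀ i, P.map (X i) = μ) {s : ℝ≥0∞} (hs : 1 ≤ s) {𝒞 : NormedFunctionSpace 𝒳} {d₀ : ℕ}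
    (hmix : MultipleMixing P X μ s 𝒞 d₀) (hone : (1 : 𝒳 → ℝ) ∈ 𝒞.carrier) {M : ℝ} (hM : 1 ≤ M)
    {C₁ β : ℝ} (hC₁ : 0 ≤ C₁) (hβ1 : 1 ≤ β) (hβ2 : β ≤ 2) {c₀ : ℝ} (hc₀ : 1 ≤ c₀) (p : ℕ) :
    ∃ C : ℝ, 0 ≤ C ∧ ∀ k n : ℕ, (4 : ℝ) ^ k ≤ c₀ * n → ∀ g g' : 𝒞.carrier,
      eLpNorm (g : 𝒳 → ℝ) ∞ μ ≤ ENNReal.ofReal M → eLpNorm (g' : 𝒳 → ℝ) ∞ μ ≤ ENNReal.ofReal M →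
      eLpNorm (fun x => (g' : 𝒳 → ℝ) x - (g : 𝒳 → ℝ) x) s μ ≤ ENNReal.ofReal (2 * (1 / 2) ^ k) →
      𝒞.norm g ≤ Real.exp (C₁ * β ^ (k + 1)) → 𝒞.norm g' ≤ Real.exp (C₁ * β ^ (k + 1)) →
      ∀ t t' : ℝ, 0 ≤ t → t ≤ t' → t' ≤ 1 → t' - t ≤ (1 / 4) ^ k →
      ∫ ω, (seqEmp μ X n (g' : 𝒳 → ℝ) t' ω - seqEmp μ X n (g : 𝒳 → ℝ) t ω) ^ (2 * p) ∂P
        ≤ C * ((β / 2) ^ k) ^ p := by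
  have hM0 : 0 < M := by linarith
  obtain ⟨Ca, hCa0, hCa⟩ := hmix.exists_integral_sum_pow_le hX hlaw hs hone
    (by linarith : 1 ≤ 2 * M) (2 * p)
  set m₁ := 𝒞.norm ⟨1, hone⟩ with hm₁
  have hm₁0 : 0 ≤ m₁ := apply_nonneg _ _
  -- Large enough for `exp (c₃ β^k)` to dominate `2 exp (C₁ β^(k+1)) + ‖1‖_𝒞`, which bounds the norm
  -- of the difference of two bracket functions plus that of the constant.
  set c₃ := C₁ * β + Real.log (2 + m₁) + 1 with hc₃
  have hc₃1 : 1 ≤ c₃ := by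
    have : 0 ≤ Real.log (2 + m₁) := Real.log_nonneg (by linarith)
    have : 0 ≤ C₁ * β := by positivity
    linarith
  set c₄ := c₃ ^ 2 * (1 + c₀) * (2 * M) with hc₄
  have hc₄0 : 0 ≤ c₄ := by positivity
  refine ⟨2 ^ (2 * p - 1) * (2 * Ca * c₄ ^ p), by positivity, ?_⟩
  intro k n hkn g g' hg hg' hgg' hgn hgn' t t' ht htt' ht' htk
  have hn : (0 : ℝ) < n := by
    by_contra h
    have h0 : (n : ℝ) ≤ 0 := not_lt.1 h
    have : (0 : ℝ) < 4 ^ k := by positivity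
    nlinarith
  have hβk : 1 ≤ β ^ k := one_le_pow₀ hβ1
  set L := c₃ * β ^ k with hL
  have hL1 : 1 ≤ L := by nlinarith
  have hhalf : (0 : ℝ) < (1 / 2) ^ k := by positivity
  set w := √(c₄ * (n * (β / 2) ^ k)) with hw
  have hβ0 : 0 < β := by linarith
  have hw2 : w ^ 2 = c₄ * (n * (β / 2) ^ k) := Real.sq_sqrt (by positivity)
  obtain ⟨hs1, hs2, hs3, hnk⟩ := increment_scales hc₃1 hc₀ hM hβ1 hβ2 hkn
  have hLw : L ≤ w := Real.le_sqrt_of_sq_le hs1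
  have hexp : 2 * Real.exp (C₁ * β ^ (k + 1)) + m₁ ≤ Real.exp L := by
    have e1 : 1 ≤ Real.exp (C₁ * β ^ (k + 1)) := Real.one_le_exp (by positivity)
    have e2 : Real.exp (C₁ * β ^ (k + 1)) * (2 + m₁) ≤ Real.exp L := by
      have hpos : 0 < 2 + m₁ := by linarith
      rw [← Real.exp_log hpos, ← Real.exp_add, Real.exp_le_exp, hL, hc₃]
      have : 0 ≤ Real.log (2 + m₁) := Real.log_nonneg (by linarith)
      calc _ = C₁ * β * β ^ k + Real.log (2 + m₁) * 1 := by rw [pow_succ]; ring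
        _ ≤ C₁ * β * β ^ k + Real.log (2 + m₁) * β ^ k := by gcongr
        _ ≤ _ := by linarith
    nlinarith
  have hgi : ∀ f : 𝒞.carrier, eLpNorm (f : 𝒳 → ℝ) ∞ μ ≤ ENNReal.ofReal M →
      Integrable (f : 𝒳 → ℝ) μ := fun f hf =>
    memLp_one_iff_integrable.1 (MemLp.of_bound (𝒞.measurable f).aestronglyMeasurable M
      (ae_abs_le_of_eLpNorm_top_le hM0.le hf))
  have hdiff : eLpNorm ((g' - g : 𝒞.carrier) : 𝒳 → ℝ) ∞ μ ≤ ENNReal.ofReal (2 * M) := by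
    refine (eLpNorm_sub_le (𝒞.measurable g').aestronglyMeasurable
      (𝒞.measurable g).aestronglyMeasurable le_top).trans ?_
    rw [two_mul, ENNReal.ofReal_add hM0.le hM0.le]
    exact add_le_add hg' hg
  have hg'2 : eLpNorm (g' : 𝒳 → ℝ) ∞ μ ≤ ENNReal.ofReal (2 * M) :=
    hg'.trans (ENNReal.ofReal_le_ofReal (by linarith))
  have hfl : ⌊(n : ℝ) * t⌋₊ ≤ ⌊(n : ℝ) * t'⌋₊ := Nat.floor_mono (by gcongr)
  have m1 := hCa (g' - g) hdiff L w hL1 hLw (by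
    have := map_sub_le_add 𝒞.norm g' g
    linarith) (Finset.Icc 1 ⌊(n : ℝ) * t⌋₊) (by
    have hc : ((Finset.Icc 1 ⌊(n : ℝ) * t⌋₊).card : ℝ) ≤ n := by
      rw [Nat.card_Icc, Nat.add_sub_cancel]
      refine (Nat.floor_le (by positivity)).trans ?_
      exact mul_le_of_le_one_right hn.le (htt'.trans ht')
    have hσ : (eLpNorm ((g' - g : 𝒞.carrier) : 𝒳 → ℝ) s μ).toReal ≤ 2 * (1 / 2) ^ k := by
      have := ENNReal.toReal_mono (by finiteness) hgg'
      rwa [ENNReal.toReal_ofReal (by positivity)] at this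
    calc _ ≤ (n : ℝ) * (2 * (1 / 2) ^ k) * L := by gcongr
      _ ≤ w ^ 2 := hs2.trans hw2.ge)
  have m2 := hCa g' hg'2 L w hL1 hLw (by
    have : 0 < Real.exp (C₁ * β ^ (k + 1)) := Real.exp_pos _
    linarith) (Finset.Ioc ⌊(n : ℝ) * t⌋₊ ⌊(n : ℝ) * t'⌋₊) (by
    have hc : ((Finset.Ioc ⌊(n : ℝ) * t⌋₊ ⌊(n : ℝ) * t'⌋₊).card : ℝ) ≤
        (1 + c₀) * (n * (1 / 2) ^ k) := by
      rw [Nat.card_Ioc, Nat.cast_sub hfl]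
      have f1 : (⌊(n : ℝ) * t'⌋₊ : ℝ) ≤ n * t' := Nat.floor_le (mul_nonneg hn.le (ht.trans htt'))
      have f2 : (n : ℝ) * t < ⌊(n : ℝ) * t⌋₊ + 1 := Nat.lt_floor_add_one _
      have f3 : (n : ℝ) * (t' - t) ≤ n * (1 / 4) ^ k := by gcongr
      have f4 : (n : ℝ) * (1 / 4) ^ k ≤ n * (1 / 2) ^ k := by
        gcongr; norm_num
      have f5 : c₀ * ((n : ℝ) * (1 / 4) ^ k) ≤ c₀ * (n * (1 / 2) ^ k) := by gcongr
      linarith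
    have hσ : (eLpNorm (g' : 𝒳 → ℝ) s μ).toReal ≤ M := by
      have h1 : eLpNorm (g' : 𝒳 → ℝ) s μ ≤ ENNReal.ofReal M :=
        (eLpNorm_le_eLpNorm_of_exponent_le le_top (𝒞.measurable g').aestronglyMeasurable).trans hg'
      have := ENNReal.toReal_mono (by finiteness) h1
      rwa [ENNReal.toReal_ofReal hM0.le] at this
    calc _ ≤ (1 + c₀) * (n * (1 / 2) ^ k) * M * L := by gcongr
      _ ≤ w ^ 2 := hs3.trans hw2.ge)
  have hw2p : w ^ (2 * p) = c₄ ^ p * ((n : ℝ) ^ p * ((β / 2) ^ k) ^ p) := by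
    rw [pow_mul, hw2, mul_pow c₄, mul_pow (n : ℝ)]
  have i1 := integrable_sum_pow (P := P) hX hlaw (𝒞.measurable (g' - g)) (by positivity) hdiff
    (Finset.Icc 1 ⌊(n : ℝ) * t⌋₊) (∫ x, ((g' - g : 𝒞.carrier) : 𝒳 → ℝ) x ∂μ) (2 * p)
  have i2 := integrable_sum_pow (P := P) hX hlaw (𝒞.measurable g') (by positivity) hg'2
    (Finset.Ioc ⌊(n : ℝ) * t⌋₊ ⌊(n : ℝ) * t'⌋₊) (∫ x, (g' : 𝒳 → ℝ) x ∂μ) (2 * p)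
  have hsq : (1 / √(n : ℝ)) ^ (2 * p) = ((n : ℝ) ^ p)⁻¹ := by
    rw [pow_mul, div_pow, Real.sq_sqrt hn.le, one_pow, one_div, inv_pow]
  have hpt : ∀ ω, (seqEmp μ X n (g' : 𝒳 → ℝ) t' ω - seqEmp μ X n (g : 𝒳 → ℝ) t ω) ^ (2 * p) ≤
      ((n : ℝ) ^ p)⁻¹ * (2 ^ (2 * p - 1) *
        ((∑ i ∈ Finset.Icc 1 ⌊(n : ℝ) * t⌋₊, (((g' - g : 𝒞.carrier) : 𝒳 → ℝ) (X i ω) -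
            ∫ x, ((g' - g : 𝒞.carrier) : 𝒳 → ℝ) x ∂μ)) ^ (2 * p) +
          (∑ i ∈ Finset.Ioc ⌊(n : ℝ) * t⌋₊ ⌊(n : ℝ) * t'⌋₊,
            ((g' : 𝒳 → ℝ) (X i ω) - ∫ x, (g' : 𝒳 → ℝ) x ∂μ)) ^ (2 * p))) := by
    intro ω
    rw [seqEmp_sub_seqEmp X (hgi g hg) (hgi g' hg') n htt', mul_pow, hsq]
    gcongr
    exact Even.add_pow_le (even_two_mul p)
  calc _ ≤ ∫ ω, ((n : ℝ) ^ p)⁻¹ * (2 ^ (2 * p - 1) *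
        ((∑ i ∈ Finset.Icc 1 ⌊(n : ℝ) * t⌋₊, (((g' - g : 𝒞.carrier) : 𝒳 → ℝ) (X i ω) -
            ∫ x, ((g' - g : 𝒞.carrier) : 𝒳 → ℝ) x ∂μ)) ^ (2 * p) +
          (∑ i ∈ Finset.Ioc ⌊(n : ℝ) * t⌋₊ ⌊(n : ℝ) * t'⌋₊,
            ((g' : 𝒳 → ℝ) (X i ω) - ∫ x, (g' : 𝒳 → ℝ) x ∂μ)) ^ (2 * p))) ∂P := by
        refine integral_mono_of_nonneg (ae_of_all _ fun ω => (even_two_mul p).pow_nonneg _)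
          (((i1.add i2).const_mul _).const_mul _) (ae_of_all _ hpt)
    _ ≤ ((n : ℝ) ^ p)⁻¹ * (2 ^ (2 * p - 1) * (Ca * w ^ (2 * p) + Ca * w ^ (2 * p))) := by
        rw [integral_const_mul, integral_const_mul, integral_add i1 i2]
        gcongr
    _ = _ := by
        rw [hw2p]
        field_simp
        ring

end Increments

/-! ### Bracketing numbers at dyadic scales. -/

section Entropy

variable {𝒳 : Type*} [MeasurableSpace 𝒳]

theorem exists_finset_of_bracketingNumber_le {𝒞 : NormedFunctionSpace 𝒳} {μ : Measure 𝒳} {s : ℝ≥0∞}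
    {F : Set (𝒳 → ℝ)} {G : Set 𝒞.carrier} {ε A : ℝ} {N : ℕ}
    (h : bracketingNumber 𝒞 μ s F G ε A ≤ N) :
    ∃ B : Finset (𝒞.carrier × 𝒞.carrier), (∀ b ∈ B, IsBracket 𝒞 μ s G ε A b.1 b.2) ∧
      (∀ f ∈ F, ∃ b ∈ B, ∀ x, (b.1 : 𝒳 → ℝ) x ≤ f x ∧ f x ≤ (b.2 : 𝒳 → ℝ) x) ∧ B.card ≤ N := by
  have h' : bracketingNumber 𝒞 μ s F G ε A < ((N + 1 : ℕ) : ℕ∞) :=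
    h.trans_lt (by exact_mod_cast Nat.lt_succ_self N)
  unfold bracketingNumber at h'
  rw [iInf_lt_iff] at h'
  obtain ⟨B, hB⟩ := h'
  rw [iInf_lt_iff] at hB
  obtain ⟨hB, hcard⟩ := hB
  refine ⟨B, hB.1, hB.2, ?_⟩
  have : B.card < N + 1 := by exact_mod_cast hcard
  omega

/-- Under the exponential entropy condition the bracketing numbers at dyadic scales grow at most
geometrically. -/
theorem ExpEntropy.exists_brackets {𝒞 : NormedFunctionSpace 𝒳} {μ : Measure 𝒳} {s : ℝ≥0∞}
    {F : Set (𝒳 → ℝ)} {G : Set 𝒞.carrier} {γ : ℝ} (h : ExpEntropy 𝒞 μ s F G γ) :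
    ∃ (C₁ c : ℝ) (R : ℕ) (B : ℕ → Finset (𝒞.carrier × 𝒞.carrier)), 0 < C₁ ∧ 0 ≤ c ∧ ∀ k,
      (∀ b ∈ B k, IsBracket 𝒞 μ s G ((1 / 2) ^ k) (Real.exp (C₁ * ((2 : ℝ) ^ (1 / γ)) ^ k))
        b.1 b.2) ∧
      (∀ f ∈ F, ∃ b ∈ B k, ∀ x, (b.1 : 𝒳 → ℝ) x ≤ f x ∧ f x ≤ (b.2 : 𝒳 → ℝ) x) ∧
      ((B k).card : ℝ) ≤ c * ((2 : ℝ) ^ R) ^ k := by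
  obtain ⟨C, r, hC, -, hI⟩ := h
  set I := ∫⁻ ε in Set.Ioo (0 : ℝ) 1, ENNReal.ofReal (ε ^ r) *
      (⨆ δ ∈ Set.Icc ε 1,
        (bracketingNumber 𝒞 μ s F G δ (Real.exp (C * δ ^ (-(1 / γ)))) : ℝ≥0∞) ^ 2) with hIdef
  -- An integer exponent with `ε^m ≤ ε^r` for `0 < ε ≤ 1`, whatever the sign of `r`.
  set m := ⌈|r|⌉₊ with hm
  have hmr : |r| ≤ m := Nat.le_ceil _
  have hscale : ∀ k : ℕ, ((1 / 2 : ℝ) ^ k) ^ (-(1 / γ)) = ((2 : ℝ) ^ (1 / γ)) ^ k := by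
    intro k
    rw [Real.rpow_neg (by positivity), ← Real.inv_rpow (by positivity), ← inv_pow,
      ← Real.rpow_natCast, ← Real.rpow_natCast, ← Real.rpow_mul (by norm_num),
      ← Real.rpow_mul (by norm_num), mul_comm]
    norm_num
  have key : ∀ k : ℕ, ∃ B : Finset (𝒞.carrier × 𝒞.carrier),
      (∀ b ∈ B, IsBracket 𝒞 μ s G ((1 / 2) ^ k) (Real.exp (C * ((2 : ℝ) ^ (1 / γ)) ^ k)) b.1 b.2) ∧
      (∀ f ∈ F, ∃ b ∈ B, ∀ x, (b.1 : 𝒳 → ℝ) x ≤ f x ∧ f x ≤ (b.2 : 𝒳 → ℝ) x) ∧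
      (B.card : ℝ) ≤ I.toReal * 2 ^ (m + 1) * ((2 : ℝ) ^ (m + 1)) ^ k := by
    intro k
    set N := bracketingNumber 𝒞 μ s F G ((1 / 2) ^ k) (Real.exp (C * ((2 : ℝ) ^ (1 / γ)) ^ k))
      with hN
    set a : ℝ := (1 / 2) ^ (k + 1) with ha
    have ha0 : 0 < a := by positivity
    have ha2 : (1 / 2 : ℝ) ^ k = 2 * a := by rw [ha, pow_succ]; ring
    have hk1 : (1 / 2 : ℝ) ^ k ≤ 1 := pow_le_one₀ (by norm_num) (by norm_num)
    -- Only `ε` between `2^{-(k+1)}` and `2^{-k}` is retained in the integral; there the supremum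
    -- includes `δ = 2^{-k}`.
    have hle : ENNReal.ofReal (a ^ m) * (N : ℝ≥0∞) ^ 2 * ENNReal.ofReal a ≤ I := by
      calc ENNReal.ofReal (a ^ m) * (N : ℝ≥0∞) ^ 2 * ENNReal.ofReal a
          = ∫⁻ ε in Set.Ioo a (2 * a), ENNReal.ofReal (a ^ m) * (N : ℝ≥0∞) ^ 2 := by
            rw [setLIntegral_const, Real.volume_Ioo]
            congr 2
            ring
        _ ≤ ∫⁻ ε in Set.Ioo a (2 * a), ENNReal.ofReal (ε ^ r) * (⨆ δ ∈ Set.Icc ε 1,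
              (bracketingNumber 𝒞 μ s F G δ (Real.exp (C * δ ^ (-(1 / γ)))) : ℝ≥0∞) ^ 2) := by
            refine setLIntegral_mono' measurableSet_Ioo fun ε hε => ?_
            have hε0 : 0 < ε := ha0.trans hε.1
            have hε1 : ε ≤ 1 := by linarith [hε.2]
            gcongr
            · calc a ^ m ≤ ε ^ m := by gcongr; exact hε.1.le
                _ = ε ^ (m : ℝ) := (Real.rpow_natCast _ _).symm
                _ ≤ ε ^ r := Real.rpow_le_rpow_of_exponent_ge hε0 hε1 ((le_abs_self r).trans hmr)
            · refine le_trans ?_ (le_iSup₂ (f := fun δ (_ : δ ∈ Set.Icc ε 1) =>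
                (bracketingNumber 𝒞 μ s F G δ (Real.exp (C * δ ^ (-(1 / γ)))) : ℝ≥0∞) ^ 2)
                ((1 / 2 : ℝ) ^ k) ⟨by rw [ha2]; exact hε.2.le, hk1⟩)
              rw [hscale]
        _ ≤ I := by
            refine lintegral_mono_set fun ε hε => ⟨ha0.trans hε.1, ?_⟩
            linarith [hε.2]
    have hNI : (N : ℝ≥0∞) ^ 2 ≤ I * ENNReal.ofReal (2 ^ (m + 1) * ((2 : ℝ) ^ (m + 1)) ^ k) := by
      have hinv : (a ^ m * a) * (2 ^ (m + 1) * ((2 : ℝ) ^ (m + 1)) ^ k) = 1 := by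
        rw [← pow_succ, ha, ← pow_succ', ← pow_mul, ← pow_mul, mul_comm (k + 1), ← mul_pow]
        norm_num
      calc (N : ℝ≥0∞) ^ 2 = (N : ℝ≥0∞) ^ 2 * ENNReal.ofReal ((a ^ m * a) *
            (2 ^ (m + 1) * ((2 : ℝ) ^ (m + 1)) ^ k)) := by rw [hinv]; simp
        _ = ENNReal.ofReal (a ^ m) * (N : ℝ≥0∞) ^ 2 * ENNReal.ofReal a *
            ENNReal.ofReal (2 ^ (m + 1) * ((2 : ℝ) ^ (m + 1)) ^ k) := by
            rw [ENNReal.ofReal_mul (by positivity), ENNReal.ofReal_mul (by positivity)]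
            ring
        _ ≤ _ := by gcongr
    have hNtop : N ≠ ⊤ := by
      intro h
      rw [h] at hNI
      have : I * ENNReal.ofReal (2 ^ (m + 1) * ((2 : ℝ) ^ (m + 1)) ^ k) < ∞ :=
        ENNReal.mul_lt_top hI (by finiteness)
      rw [ENat.toENNReal_top, ENNReal.top_pow (by norm_num)] at hNI
      exact absurd hNI (not_le.2 this)
    obtain ⟨j, hj⟩ := ENat.ne_top_iff_exists.1 hNtop
    obtain ⟨B, hB1, hB2, hB3⟩ := exists_finset_of_bracketingNumber_le (hN ▸ hj.ge)
    refine ⟨B, hB1, hB2, ?_⟩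
    rw [← hj] at hNI
    have hreal := ENNReal.toReal_mono (ENNReal.mul_lt_top hI (by finiteness)).ne hNI
    rw [ENNReal.toReal_mul, ENNReal.toReal_ofReal (by positivity)] at hreal
    -- For a natural number the bound on the square already bounds the number itself.
    have hjj : ((j : ℝ)) ≤ (j : ℝ) ^ 2 := by
      exact_mod_cast Nat.le_self_pow (by norm_num) j
    have hBj : (B.card : ℝ) ≤ j := by exact_mod_cast hB3
    simp at hreal
    linarith
  choose B hB using key
  exact ⟨C, I.toReal * 2 ^ (m + 1), m + 1, B, hC, by positivity, hB⟩

end Entropy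

/-! ### Outer expectations and Lipschitz test functions. -/

section OuterExpectation

variable {Ω : Type*} [MeasurableSpace Ω] {P : Measure Ω} [IsProbabilityMeasure P]

/-- The lower bound on `Y` keeps the integrals of majorants bounded below, so that the real infimum
is not a default value. -/
theorem outerExpectation_le {Y Z : Ω → ℝ} {b : ℝ} (hb : ∀ ω, -b ≤ Y ω) (hZm : Measurable Z)
    (hZi : Integrable Z P) (hYZ : ∀ ω, Y ω ≤ Z ω) : outerExpectation P Y ≤ ∫ ω, Z ω ∂P := by
  refine csInf_le ⟨-b, ?_⟩ ⟨Z, hZm, hZi, hYZ, rfl⟩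
  rintro _ ⟨W, -, hWi, hYW, rfl⟩
  have := integral_mono (μ := P) (integrable_const (-b)) hWi fun ω => (hb ω).trans (hYW ω)
  simpa using this

theorem le_outerExpectation {Y : Ω → ℝ} {b c : ℝ} (hb : ∀ ω, Y ω ≤ b)
    (h : ∀ Z : Ω → ℝ, Integrable Z P → (∀ ω, Y ω ≤ Z ω) → c ≤ ∫ ω, Z ω ∂P) :
    c ≤ outerExpectation P Y := by
  refine le_csInf ⟨_, fun _ => b, measurable_const, integrable_const _, hb, rfl⟩ ?_
  rintro _ ⟨Z, -, hZi, hYZ, rfl⟩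
  exact h Z hZi hYZ

theorem outerExpectation_mono {Y Y' : Ω → ℝ} {b : ℝ} (hb : ∀ ω, |Y ω| ≤ b)
    (hb' : ∀ ω, |Y' ω| ≤ b) (h : ∀ ω, Y ω ≤ Y' ω) :
    outerExpectation P Y ≤ outerExpectation P Y' := by
  refine csInf_le_csInf ⟨-b, ?_⟩ ⟨_, fun _ => b, measurable_const, integrable_const _,
    fun ω => (abs_le.1 (hb' ω)).2, rfl⟩ ?_
  · rintro _ ⟨W, -, hWi, hYW, rfl⟩
    have := integral_mono (μ := P) (integrable_const (-b)) hWi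
      fun ω => (abs_le.1 (hb ω)).1.trans (hYW ω)
    simpa using this
  · rintro _ ⟨W, hWm, hWi, hYW, rfl⟩
    exact ⟨W, hWm, hWi, fun ω => (h ω).trans (hYW ω), rfl⟩

/-- A Lipschitz functional of a map that is close in outer probability to a measurable one. -/
theorem abs_outerExpectation_sub_integral_le {E : Type*} [PseudoMetricSpace E] {U V : Ω → E}
    {φ : E → ℝ} {b L ε δ : ℝ} (hb : ∀ x, |φ x| ≤ b) (hφ : ∀ x y, φ x - φ y ≤ L * dist x y)
    (hL : 0 ≤ L) (hε : 0 ≤ ε) (hδ : 0 ≤ δ)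
    (hV : Measurable fun ω => φ (V ω))
    (hUV : P {ω | ε < dist (U ω) (V ω)} ≤ ENNReal.ofReal δ) :
    |outerExpectation P (fun ω => φ (U ω)) - ∫ ω, φ (V ω) ∂P| ≤ L * ε + 2 * b * δ := by
  -- The exceptional set need not be measurable; its measurable hull has the same measure and makes
  -- `φ(V) + Lε + 2b 1_A` an admissible majorant.
  set A := toMeasurable P {ω | ε < dist (U ω) (V ω)} with hA
  have hAm : MeasurableSet A := measurableSet_toMeasurable _ _
  have hAP : P.real A ≤ δ := by
    have : P A ≤ ENNReal.ofReal δ := by rw [hA, measure_toMeasurable]; exact hUV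
    exact ENNReal.toReal_le_of_le_ofReal hδ this
  have hVi : Integrable (fun ω => φ (V ω)) P :=
    Integrable.of_bound hV.aestronglyMeasurable b (ae_of_all _ fun ω => hb _)
  have hIi : Integrable (A.indicator fun _ => (2 * b : ℝ)) P :=
    (integrable_const _).indicator hAm
  have hIint : ∫ ω, A.indicator (fun _ => (2 * b : ℝ)) ω ∂P = P.real A * (2 * b) := by
    rw [integral_indicator hAm, setIntegral_const, smul_eq_mul]
  have hadd : ∀ {W : Ω → ℝ}, Integrable W P →
      ∫ ω, (W ω + (L * ε + A.indicator (fun _ => (2 * b : ℝ)) ω)) ∂P =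
        ∫ ω, W ω ∂P + (L * ε + P.real A * (2 * b)) := by
    intro W hW
    have h1 : Integrable (fun ω => L * ε + A.indicator (fun _ => (2 * b : ℝ)) ω) P :=
      (integrable_const _).add hIi
    rw [integral_add hW h1, integral_add (integrable_const _) hIi, hIint]
    simp
  have hb0 : ∀ ω : Ω, 0 ≤ b := fun ω => (abs_nonneg _).trans (hb (U ω))
  have hbb : 0 ≤ b := hb0 (nonempty_of_isProbabilityMeasure P).some
  have hpt : ∀ ω, |φ (U ω) - φ (V ω)| ≤ L * ε + A.indicator (fun _ => (2 * b : ℝ)) ω := by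
    intro ω
    by_cases hω : ω ∈ A
    · rw [Set.indicator_of_mem hω]
      refine (abs_sub _ _).trans ?_
      have := hb (U ω)
      have := hb (V ω)
      have : 0 ≤ L * ε := by positivity
      linarith
    · rw [Set.indicator_of_notMem hω, add_zero]
      have hd : dist (U ω) (V ω) ≤ ε := by
        by_contra h
        exact hω (subset_toMeasurable _ _ (not_le.1 h))
      rw [abs_sub_le_iff]
      exact ⟨(hφ _ _).trans (by gcongr), (hφ _ _).trans (by rw [dist_comm]; gcongr)⟩
  rw [abs_sub_le_iff]
  constructor
  · have h := outerExpectation_le (P := P) (Y := fun ω => φ (U ω))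
      (Z := fun ω => φ (V ω) + (L * ε + A.indicator (fun _ => (2 * b : ℝ)) ω)) (b := b)
      (fun ω => (abs_le.1 (hb _)).1)
      (hV.add (measurable_const.add (measurable_const.indicator hAm)))
      (hVi.add ((integrable_const _).add hIi))
      (fun ω => by linarith [(abs_le.1 (hpt ω)).2])
    rw [hadd hVi] at h
    nlinarith
  · have h := le_outerExpectation (P := P) (Y := fun ω => φ (U ω)) (b := b)
      (c := ∫ ω, φ (V ω) ∂P - (L * ε + 2 * b * δ)) (fun ω => (abs_le.1 (hb _)).2) ?_
    · linarith
    · intro Z hZ hYZ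
      have h := integral_mono (μ := P) hVi
        ((hZ.add ((integrable_const (L * ε)).add hIi)))
        (fun ω => by
          have := (abs_le.1 (hpt ω)).1
          have := hYZ ω
          simp only [Pi.add_apply]
          linarith)
      simp only [Pi.add_apply] at h
      rw [hadd hZ] at h
      nlinarith

/-- The `k`-Lipschitz minorant `x ↦ inf_y (φ y + k d(x,y))` of a bounded function. -/
def lipMinorant {E : Type*} [PseudoMetricSpace E] (φ : E → ℝ) (k : ℕ) (x : E) : ℝ :=
  ⨅ y, (φ y + k * dist x y)

section LipMinorant

variable {E : Type*} [PseudoMetricSpace E] {φ : E → ℝ} {b : ℝ}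

theorem bddBelow_lipMinorant (hb : ∀ x, |φ x| ≤ b) (k : ℕ) (x : E) :
    BddBelow (Set.range fun y => φ y + k * dist x y) := by
  refine ⟨-b, ?_⟩
  rintro _ ⟨y, rfl⟩
  have := (abs_le.1 (hb y)).1
  have : 0 ≤ k * dist x y := by positivity
  dsimp only
  linarith

theorem lipMinorant_le (hb : ∀ x, |φ x| ≤ b) (k : ℕ) (x : E) : lipMinorant φ k x ≤ φ x := by
  have := ciInf_le (bddBelow_lipMinorant hb k x) x
  simpa [lipMinorant] using this

theorem abs_lipMinorant_le (hb : ∀ x, |φ x| ≤ b) (k : ℕ) (x : E) : |lipMinorant φ k x| ≤ b := by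
  have : Nonempty E := ⟨x⟩
  rw [abs_le]
  refine ⟨le_ciInf fun y => ?_, (lipMinorant_le hb k x).trans (abs_le.1 (hb x)).2⟩
  have := (abs_le.1 (hb y)).1
  have : 0 ≤ k * dist x y := by positivity
  linarith

theorem lipMinorant_sub_le (hb : ∀ x, |φ x| ≤ b) (k : ℕ) (x y : E) :
    lipMinorant φ k x - lipMinorant φ k y ≤ k * dist x y := by
  have : Nonempty E := ⟨x⟩
  rw [sub_le_iff_le_add, ← sub_le_iff_le_add']
  refine le_ciInf fun z => ?_
  have h1 : lipMinorant φ k x ≤ φ z + k * dist x z := ciInf_le (bddBelow_lipMinorant hb k x) z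
  have h2 : (k : ℝ) * dist x z ≤ k * (dist x y + dist y z) := by gcongr; exact dist_triangle _ _ _
  linarith

/-- Points at distance at least `δ` from `x` cannot lower the infimum below `φ x` once `k δ ≥ 2b`,
and nearer points change it by at most `ε / 2`. -/
theorem tendsto_lipMinorant (hb : ∀ x, |φ x| ≤ b) (hφ : Continuous φ) (x : E) :
    Tendsto (fun k => lipMinorant φ k x) atTop (𝓝 (φ x)) := by
  have : Nonempty E := ⟨x⟩
  rw [Metric.tendsto_atTop]
  intro ε hε
  obtain ⟨δ, hδ, hδφ⟩ := Metric.continuous_iff.1 hφ x (ε / 2) (by positivity)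
  obtain ⟨k₀, hk₀⟩ := exists_nat_ge (2 * b / δ)
  refine ⟨k₀, fun k hk => ?_⟩
  have hkδ : 2 * b ≤ k * δ := by
    rw [div_le_iff₀ hδ] at hk₀
    refine hk₀.trans ?_
    gcongr
  have h1 : φ x - ε / 2 ≤ lipMinorant φ k x := by
    refine le_ciInf fun y => ?_
    rcases lt_or_ge (dist y x) δ with h | h
    · have := hδφ y h
      rw [Real.dist_eq, abs_lt] at this
      have : 0 ≤ k * dist x y := by positivity
      linarith
    · have : (k : ℝ) * δ ≤ k * dist x y := by rw [dist_comm x y]; gcongr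
      have := (abs_le.1 (hb x)).2
      have := (abs_le.1 (hb y)).1
      linarith
  rw [Real.dist_eq, abs_lt]
  have := lipMinorant_le hb k x
  constructor <;> linarith

theorem continuous_lipMinorant (hb : ∀ x, |φ x| ≤ b) (k : ℕ) :
    Continuous (lipMinorant φ k) := by
  refine (LipschitzWith.of_dist_le_mul (K := k) fun x y => ?_).continuous
  rw [Real.dist_eq, abs_sub_le_iff]
  have h1 := lipMinorant_sub_le hb k x y
  have h2 := lipMinorant_sub_le hb k y x
  rw [dist_comm y x] at h2
  exact ⟨by simpa using h1, by simpa using h2⟩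

end LipMinorant

/-- For convergence in law it suffices to consider bounded Lipschitz functions. -/
theorem convergesInLaw_of_lipschitz {E : Type*} [PseudoMetricSpace E] [MeasurableSpace E]
    [BorelSpace E] {U : ℕ → Ω → E} {K : Measure E} [IsProbabilityMeasure K]
    (h : ∀ (φ : E → ℝ) (b L : ℝ), 0 ≤ L → (∀ x, |φ x| ≤ b) →
      (∀ x y, φ x - φ y ≤ L * dist x y) → Continuous φ →
      Tendsto (fun n => outerExpectation P fun ω => φ (U n ω)) atTop (𝓝 (∫ z, φ z ∂K))) :
    ConvergesInLaw P U K := by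
  intro φ
  have hb : ∀ x, |φ x| ≤ ‖φ‖ := fun x => by simpa using φ.norm_coe_le_norm x
  have hb' : ∀ x, |(-φ) x| ≤ ‖φ‖ := fun x => by simpa using hb x
  have hlow := fun k : ℕ => h (lipMinorant φ k) ‖φ‖ k (by positivity) (abs_lipMinorant_le hb k)
    (lipMinorant_sub_le hb k) (continuous_lipMinorant hb k)
  have hup := fun k : ℕ => h (fun x => -lipMinorant (-φ) k x) ‖φ‖ k (by positivity)
    (fun x => by rw [abs_neg]; exact abs_lipMinorant_le hb' k x)
    (fun x y => by
      have := lipMinorant_sub_le hb' k y x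
      rw [dist_comm] at this
      linarith) (continuous_lipMinorant hb' k).neg
  have ilow : Tendsto (fun k => ∫ z, lipMinorant φ k z ∂K) atTop (𝓝 (∫ z, φ z ∂K)) :=
    tendsto_integral_of_dominated_convergence (fun _ => ‖φ‖)
      (fun k => (continuous_lipMinorant hb k).aestronglyMeasurable) (integrable_const _)
      (fun k => ae_of_all _ fun x => abs_lipMinorant_le hb k x)
      (ae_of_all _ fun x => tendsto_lipMinorant hb φ.continuous x)
  have iup : Tendsto (fun k => ∫ z, -lipMinorant (-φ) k z ∂K) atTop (𝓝 (∫ z, φ z ∂K)) :=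
    tendsto_integral_of_dominated_convergence (fun _ => ‖φ‖)
      (fun k => (continuous_lipMinorant hb' k).neg.aestronglyMeasurable) (integrable_const _)
      (fun k => ae_of_all _ fun x => by
        rw [Real.norm_eq_abs, abs_neg]
        exact abs_lipMinorant_le hb' k x)
      (ae_of_all _ fun x => by
        simpa using (tendsto_lipMinorant hb' (-φ).continuous x).neg)
  rw [tendsto_order]
  constructor
  · intro a ha
    obtain ⟨k, hk⟩ := (ilow.eventually (lt_mem_nhds ha)).exists
    filter_upwards [(hlow k).eventually (lt_mem_nhds hk)] with n hn
    exact hn.trans_le (outerExpectation_mono (fun ω => abs_lipMinorant_le hb k _)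
      (fun ω => hb _) fun ω => lipMinorant_le hb k _)
  · intro a ha
    obtain ⟨k, hk⟩ := (iup.eventually (gt_mem_nhds ha)).exists
    filter_upwards [(hup k).eventually (gt_mem_nhds hk)] with n hn
    refine lt_of_le_of_lt (outerExpectation_mono (fun ω => hb _)
      (fun ω => by rw [abs_neg]; exact abs_lipMinorant_le hb' k _) fun ω => ?_) hn
    have := lipMinorant_le hb' k (U n ω)
    simp only [BoundedContinuousFunction.coe_neg, Pi.neg_apply] at this
    rw [le_neg]
    exact this

end OuterExpectation

/-! ### Tightness of image laws and limits of Gaussian variables. -/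

section Limits

variable {Ω : Type*} [MeasurableSpace Ω]

/-- The law of a strongly measurable map into a complete metric space is tight. -/
theorem isTightMeasureSet_map {E : Type*} [MetricSpace E] [CompleteSpace E]
    [MeasurableSpace E] [BorelSpace E] {ν : Measure Ω} [IsFiniteMeasure ν] {f : Ω → E}
    (hf : StronglyMeasurable f) : IsTightMeasureSet {ν.map f} := by
  set s := closure (Set.range f) with hs
  have hsc : IsClosed s := isClosed_closure
  have hsep : TopologicalSpace.IsSeparable s := hf.isSeparable_range.closure
  have : CompleteSpace s := hsc.completeSpace_coe
  have : TopologicalSpace.SeparableSpace s := hsep.separableSpace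
  have : SecondCountableTopology s := UniformSpace.secondCountable_of_separable s
  let g : Ω → s := fun ω => ⟨f ω, subset_closure ⟨ω, rfl⟩⟩
  have hg : Measurable g := hf.measurable.subtype_mk
  have ht : IsTightMeasureSet {ν.map g} := isTightMeasureSet_singleton
  rw [isTightMeasureSet_iff_exists_isCompact_measure_compl_le] at ht ⊢
  intro ε hε
  obtain ⟨K, hK, hKε⟩ := ht ε hε
  refine ⟨Subtype.val '' K, hK.image continuous_subtype_val, ?_⟩
  rintro _ rfl
  have h := hKε _ rfl
  rw [Measure.map_apply hg hK.isClosed.measurableSet.compl] at h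
  rw [Measure.map_apply hf.measurable
    (hK.image continuous_subtype_val).isClosed.measurableSet.compl]
  refine le_trans (measure_mono fun ω hω => ?_) h
  intro hω'
  exact hω ⟨g ω, hω', rfl⟩

/-- Almost sure limits of centred Gaussian variables are centred Gaussian, and the variances
converge. -/
theorem exists_map_eq_gaussianReal_of_tendsto {ν : Measure Ω} [IsProbabilityMeasure ν]
    {Y : ℕ → Ω → ℝ} {Z : Ω → ℝ} {v : ℕ → NNReal} (hY : ∀ m, AEMeasurable (Y m) ν)
    (hZ : AEMeasurable Z ν) (hlaw : ∀ m, ν.map (Y m) = gaussianReal 0 (v m))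
    (hlim : ∀ᵐ ω ∂ν, Tendsto (fun m => Y m ω) atTop (𝓝 (Z ω))) :
    ∃ w : NNReal, ν.map Z = gaussianReal 0 w ∧ Tendsto v atTop (𝓝 w) := by
  have hd := ProbabilityMeasure.tendsto_iff_tendsto_charFun.1
    (tendstoInDistribution_of_ae_tendsto hY hZ hlim).tendsto
  have : IsProbabilityMeasure (ν.map Z) := Measure.isProbabilityMeasure_map hZ
  have hc : ∀ t : ℝ, Tendsto (fun m => Complex.exp (-((v m : ℝ) * t ^ 2 / 2 : ℝ))) atTop
      (𝓝 (charFun (ν.map Z) t)) := by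
    intro t
    refine (hd t).congr fun m => ?_
    rw [ProbabilityMeasure.coe_mk, hlaw, charFun_gaussianReal]
    congr 1
    push_cast
    ring
  have hcont : Continuous (charFun (ν.map Z)) := by fun_prop
  have h0 : charFun (ν.map Z) 0 ≠ 0 := by
    rw [charFun_zero]
    simp
  -- At such a `t` the limit of `exp(-v_m t²/2)` is nonzero, so taking logarithms shows that the
  -- variances converge.
  obtain ⟨t, ht, ht0⟩ : ∃ t : ℝ, charFun (ν.map Z) t ≠ 0 ∧ t ≠ 0 := by
    have hev : ∀ᶠ t in 𝓝[≠] (0 : ℝ), charFun (ν.map Z) t ≠ 0 :=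
      (hcont.continuousAt.eventually_ne h0).filter_mono nhdsWithin_le_nhds
    exact (hev.and self_mem_nhdsWithin).exists
  have hv : ∃ w : ℝ, Tendsto (fun m => (v m : ℝ)) atTop (𝓝 w) := by
    have h1 := (hc t).norm
    simp only [← Complex.ofReal_neg, Complex.norm_exp_ofReal] at h1
    have h2 := ((Real.continuousAt_log (norm_ne_zero_iff.2 ht)).tendsto.comp h1)
    have h3 := h2.const_mul (-2 / t ^ 2)
    refine ⟨_, h3.congr fun m => ?_⟩
    simp only [Function.comp, Real.log_exp]
    field_simp
  obtain ⟨w, hw⟩ := hv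
  have hw0 : 0 ≤ w := ge_of_tendsto' hw fun m => (v m).2
  lift w to NNReal using hw0
  refine ⟨w, Measure.ext_of_charFun ?_, by exact_mod_cast hw⟩
  ext t
  refine tendsto_nhds_unique (hc t) ?_
  rw [charFun_gaussianReal]
  have hcc : Continuous fun x : ℝ => Complex.exp (-(x * t ^ 2 / 2 : ℝ)) := by fun_prop
  have h := (hcc.tendsto w).comp hw
  have he : Complex.exp (t * (0 : ℝ) * Complex.I - ((w : ℝ) : ℂ) * t ^ 2 / 2) =
      Complex.exp (-((w : ℝ) * t ^ 2 / 2 : ℝ)) := by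
    congr 1
    push_cast
    ring
  rw [he]
  exact h

end Limits

/-! ### Almost sure limits of centred Gaussian processes. -/

section GaussianLimits

variable {Ω T : Type*} [MeasurableSpace Ω] {ν : Measure Ω}

theorem HasGaussianLaw_map_eq_of_centred {Y : Ω → ℝ} (hY : HasGaussianLaw Y ν)
    (h0 : ∫ ω, Y ω ∂ν = 0) : ν.map Y = gaussianReal 0 Var[Y; ν].toNNReal := by
  rw [hY.map_eq_gaussianReal, h0]

theorem integral_dual_restrict_eq_zero {Y : T → Ω → ℝ} (hY : IsGaussianProcess Y ν)
    (h0 : ∀ p, ∫ ω, Y p ω ∂ν = 0) (A : Finset T) (L : (A → ℝ) →L[ℝ] ℝ) :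
    ∫ ω, L (A.restrict (Y · ω)) ∂ν = 0 := by
  have hi : Integrable (fun ω => A.restrict (Y · ω)) ν := (hY.hasGaussianLaw A).integrable
  rw [ContinuousLinearMap.integral_comp_comm L hi]
  have : ∫ ω, A.restrict (Y · ω) ∂ν = 0 := by
    ext p
    have := (ContinuousLinearMap.proj (R := ℝ) (φ := fun _ : A => ℝ) p).integral_comp_comm hi
    simp only [ContinuousLinearMap.proj_apply, Finset.restrict] at this
    rw [Pi.zero_apply, ← h0 p]
    exact this.symm
  rw [this, map_zero]

/-- Almost sure limits of centred Gaussian processes. -/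
theorem isGaussianProcess_of_tendsto [IsProbabilityMeasure ν] {Y : ℕ → T → Ω → ℝ} {Z : T → Ω → ℝ}
    (hY : ∀ m, IsGaussianProcess (Y m) ν) (h0 : ∀ m p, ∫ ω, Y m p ω ∂ν = 0)
    (hZ : ∀ p, AEMeasurable (Z p) ν)
    (hlim : ∀ p, ∀ᵐ ω ∂ν, Tendsto (fun m => Y m p ω) atTop (𝓝 (Z p ω))) :
    IsGaussianProcess Z ν ∧ (∀ p, ∫ ω, Z p ω ∂ν = 0) ∧
      ∀ p q, Tendsto (fun m => cov[Y m p, Y m q; ν]) atTop (𝓝 cov[Z p, Z q; ν]) := by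
  have hG : IsGaussianProcess Z ν := by
    -- Testing with linear functionals of finitely many coordinates reduces the claim to real
    -- variables.
    refine ⟨fun A => ⟨isGaussian_of_map_eq_gaussianReal fun L => ?_⟩⟩
    have hlimA : ∀ᵐ ω ∂ν, Tendsto (fun m => L (A.restrict (Y m · ω))) atTop
        (𝓝 (L (A.restrict (Z · ω)))) := by
      have := (ae_all_iff.2 fun p : A => hlim p)
      filter_upwards [this] with ω hω
      exact (L.continuous.tendsto _).comp (tendsto_pi_nhds.2 fun p => hω p)
    have hZA : AEMeasurable (fun ω => A.restrict (Z · ω)) ν := aemeasurable_pi_lambda _ fun p => hZ p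
    have hYA : ∀ m, HasGaussianLaw (fun ω => L (A.restrict (Y m · ω))) ν := fun m =>
      ((hY m).hasGaussianLaw A).map_fun L
    obtain ⟨w, hw, -⟩ := exists_map_eq_gaussianReal_of_tendsto (fun m => (hYA m).aemeasurable)
      (L.continuous.measurable.comp_aemeasurable hZA)
      (fun m => HasGaussianLaw_map_eq_of_centred (hYA m)
        (integral_dual_restrict_eq_zero (hY m) (h0 m) A L)) hlimA
    refine ⟨0, w, ?_⟩
    rw [AEMeasurable.map_map_of_aemeasurable L.continuous.aemeasurable hZA, ← hw]
  have hpos : ∀ {W : Ω → ℝ} {w : NNReal}, AEMeasurable W ν → ν.map W = gaussianReal 0 w →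
      ∫ ω, W ω ∂ν = 0 ∧ Var[W; ν] = w := by
    intro W w hW hw
    constructor
    · have : ∫ ω, W ω ∂ν = ∫ x, x ∂(ν.map W) := (integral_map hW aestronglyMeasurable_id).symm
      rw [this, hw, integral_id_gaussianReal]
    · have : Var[W; ν] = Var[id; ν.map W] := by
        rw [variance_map aemeasurable_id hW]
        rfl
      rw [this, hw, variance_id_gaussianReal]
  have hvar : ∀ {y : ℕ → Ω → ℝ} {W : Ω → ℝ}, (∀ m, HasGaussianLaw (y m) ν) →
      (∀ m, ∫ ω, y m ω ∂ν = 0) → AEMeasurable W ν →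
      (∀ᵐ ω ∂ν, Tendsto (fun m => y m ω) atTop (𝓝 (W ω))) →
      ∫ ω, W ω ∂ν = 0 ∧ Tendsto (fun m => Var[y m; ν]) atTop (𝓝 Var[W; ν]) := by
    intro y W hy hy0 hW hyW
    obtain ⟨w, hw, hvw⟩ := exists_map_eq_gaussianReal_of_tendsto (fun m => (hy m).aemeasurable) hW
      (fun m => HasGaussianLaw_map_eq_of_centred (hy m) (hy0 m)) hyW
    obtain ⟨h1, h2⟩ := hpos hW hw
    refine ⟨h1, ?_⟩
    rw [h2]
    refine (NNReal.tendsto_coe.2 hvw).congr fun m => ?_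
    rw [Real.coe_toNNReal _ (variance_nonneg _ _)]
  refine ⟨hG, fun p => (hvar (fun m => (hY m).hasGaussianLaw_eval p) (fun m => h0 m p) (hZ p)
    (hlim p)).1, fun p q => ?_⟩
  have hp := (hvar (fun m => (hY m).hasGaussianLaw_eval p) (fun m => h0 m p) (hZ p) (hlim p)).2
  have hq := (hvar (fun m => (hY m).hasGaussianLaw_eval q) (fun m => h0 m q) (hZ q) (hlim q)).2
  have hpq := (hvar (y := fun m => Y m p + Y m q) (W := Z p + Z q)
    (fun m => (hY m).hasGaussianLaw_add)
    (fun m => by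
      simp only [Pi.add_apply]
      rw [integral_add ((hY m).hasGaussianLaw_eval p).integrable
        ((hY m).hasGaussianLaw_eval q).integrable, h0, h0, add_zero])
    ((hZ p).add (hZ q))
    (by filter_upwards [hlim p, hlim q] with ω h1 h2 using h1.add h2)).2
  have hcov : ∀ {Y : T → Ω → ℝ}, IsGaussianProcess Y ν →
      cov[Y p, Y q; ν] = (Var[Y p + Y q; ν] - Var[Y p; ν] - Var[Y q; ν]) / 2 := by
    intro Y hY
    rw [variance_add (hY.hasGaussianLaw_eval p).memLp_two (hY.hasGaussianLaw_eval q).memLp_two]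
    ring
  rw [hcov hG]
  simp_rw [fun m => hcov (hY m)]
  exact ((hpq.sub hp).sub hq).div_const 2

end GaussianLimits

/-! ### A limit law on a countable product. -/

section LimitLaw

variable {Ω I : Type*} [MeasurableSpace Ω]

/-- A product of compact sets is compact, and over a countable index set the exceptional
probabilities can be chosen with sum below `ε`. -/
theorem isTightMeasureSet_range_map_pi [Countable I] {P : Measure Ω} {V : ℕ → I → Ω → ℝ}
    (hV : ∀ n i, Measurable (V n i))
    (h : ∀ i, IsTightMeasureSet (Set.range fun n => P.map (V n i))) :
    IsTightMeasureSet (Set.range fun n => P.map fun ω i => V n i ω) := by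
  rw [isTightMeasureSet_iff_exists_isCompact_measure_compl_le]
  intro ε hε
  obtain ⟨δ, hδ, hδε⟩ := ENNReal.exists_pos_sum_of_countable' hε.ne' I
  have h' := fun i => (isTightMeasureSet_iff_exists_isCompact_measure_compl_le.1 (h i)) _ (hδ i)
  choose C hC hCδ using h'
  have hCK : IsCompact (Set.univ.pi C) := isCompact_univ_pi hC
  refine ⟨Set.univ.pi C, hCK, ?_⟩
  rintro _ ⟨n, rfl⟩
  rw [Measure.map_apply (measurable_pi_lambda _ (hV n)) hCK.isClosed.measurableSet.compl]
  calc P ((fun ω i => V n i ω) ⁻¹' (Set.univ.pi C)ᶜ) ≤ P (⋃ i, V n i ⁻¹' (C i)ᶜ) := by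
        refine measure_mono fun ω hω => ?_
        simp only [Set.mem_preimage, Set.mem_compl_iff, Set.mem_univ_pi, not_forall] at hω
        simpa using hω
    _ ≤ ∑' i, P (V n i ⁻¹' (C i)ᶜ) := measure_iUnion_le _
    _ ≤ ∑' i, δ i := by
        refine ENNReal.tsum_le_tsum fun i => ?_
        have := hCδ i _ ⟨n, rfl⟩
        rwa [Measure.map_apply (hV n i) (hC i).isClosed.measurableSet.compl] at this
    _ ≤ ε := hδε.le

/-- The finite-dimensional distribution of `V n` at `i` converges to `N(0, S)`. -/
def FidiTendsto (P : Measure Ω) [IsProbabilityMeasure P] (V : ℕ → I → Ω → ℝ) {k : ℕ}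
    (i : Fin k → I) (S : Matrix (Fin k) (Fin k) ℝ) : Prop :=
  S.PosSemidef ∧
    TendstoInDistribution
      (fun (n : ℕ) (ω : Ω) => (WithLp.toLp 2 fun j => V n (i j) ω : EuclideanSpace ℝ (Fin k)))
      atTop (fun y : EuclideanSpace ℝ (Fin k) => y) (fun _ => P)
      (multivariateGaussian (0 : EuclideanSpace ℝ (Fin k)) S)

/-- A convergent sequence of laws together with its limit is compact, hence tight by the converse
half of Prokhorov's theorem. -/
theorem FidiTendsto.isTightMeasureSet {P : Measure Ω} [IsProbabilityMeasure P]
    {V : ℕ → I → Ω → ℝ} (i : I)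
    {S : Matrix (Fin 1) (Fin 1) ℝ} (h : FidiTendsto P V (fun _ => i) S) :
    IsTightMeasureSet (Set.range fun n => P.map (V n i)) := by
  have hd := (h.2.continuous_comp (g := fun y : EuclideanSpace ℝ (Fin 1) => y 0)
    (by fun_prop)).tendsto
  have hc := hd.isCompact_insert_range
  have ht := isTightMeasureSet_of_isCompact_closure
    (IsCompact.closure_of_subset hc (Set.subset_insert _ _))
  refine ht.subset ?_
  rintro _ ⟨n, rfl⟩
  exact ⟨_, ⟨n, rfl⟩, rfl⟩

/-- A process on a countable index set all of whose finite-dimensional distributions converge to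
centred normal distributions has a Gaussian limit law on the path space. -/
theorem exists_limit_law [Countable I] {P : Measure Ω} [IsProbabilityMeasure P]
    {V : ℕ → I → Ω → ℝ} (hV : ∀ n i, Measurable (V n i))
    (hfidi : ∀ (k : ℕ) (i : Fin k → I), ∃ S, FidiTendsto P V i S) :
    ∃ ν : Measure (I → ℝ), IsProbabilityMeasure ν ∧
      (∀ (k : ℕ) (i : Fin k → I) (S), FidiTendsto P V i S →
        ν.map (fun z => (WithLp.toLp 2 fun j => z (i j) : EuclideanSpace ℝ (Fin k))) =
          multivariateGaussian 0 S) ∧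
      ∀ (O : Set (I → ℝ)) (η : ℝ≥0∞), IsOpen O →
        (∀ᶠ n in atTop, P {ω | (fun i => V n i ω) ∈ O} ≤ η) → ν O ≤ η := by
  have hm : ∀ n, Measurable fun ω i => V n i ω := fun n => measurable_pi_lambda _ (hV n)
  let law : ℕ → ProbabilityMeasure (I → ℝ) := fun n =>
    ⟨P.map fun ω i => V n i ω, Measure.isProbabilityMeasure_map (hm n).aemeasurable⟩
  have ht : IsTightMeasureSet {((μ : ProbabilityMeasure (I → ℝ)) : Measure (I → ℝ)) |
      μ ∈ Set.range law} := by
    refine (isTightMeasureSet_range_map_pi (P := P) hV fun i => ?_).subset ?_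
    · exact FidiTendsto.isTightMeasureSet i (hfidi 1 fun _ => i).choose_spec
    · rintro _ ⟨_, ⟨n, rfl⟩, rfl⟩
      exact ⟨n, rfl⟩
  have hc := isCompact_closure_of_isTightMeasureSet ht
  -- A limit along an ultrafilter replaces the extraction of a subsequence. Uniqueness of limits
  -- identifies its finite-dimensional laws, and open sets are handled by the portmanteau
  -- inequality.
  set 𝒰 : Ultrafilter ℕ := Ultrafilter.of atTop
  have h𝒰 : (𝒰 : Filter ℕ) ≤ atTop := Ultrafilter.of_le _
  obtain ⟨ν, -, hν⟩ := hc.ultrafilter_le_nhds (𝒰.map law) (by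
    rw [le_principal_iff]
    exact Filter.mem_map.2 (Filter.univ_mem' fun n => subset_closure ⟨n, rfl⟩))
  have hlim : Tendsto law 𝒰 (𝓝 ν) := hν
  refine ⟨ν, ν.2, fun k i S hS => ?_, fun O η hO hη => ?_⟩
  · have hcont : Continuous fun z : I → ℝ =>
        (WithLp.toLp 2 fun j => z (i j) : EuclideanSpace ℝ (Fin k)) := by fun_prop
    have h1 := ProbabilityMeasure.tendsto_map_of_tendsto_of_continuous _ _ hlim hcont
    have h2 := hS.2.tendsto.mono_left h𝒰
    have h3 := tendsto_nhds_unique (h1.congr fun n => ?_) h2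
    · have := congrArg (fun ρ : ProbabilityMeasure _ => (ρ : Measure (EuclideanSpace ℝ (Fin k)))) h3
      simpa using this
    · refine Subtype.ext ?_
      change Measure.map _ (P.map fun ω i => V n i ω) = _
      rw [Measure.map_map hcont.measurable (hm n)]
      rfl
  · have h1 := ProbabilityMeasure.le_liminf_measure_open_of_tendsto hlim hO
    refine h1.trans (liminf_le_of_frequently_le' (Eventually.frequently ?_))
    filter_upwards [h𝒰 hη] with n hn
    simp only [law, ProbabilityMeasure.coe_mk]
    rw [Measure.map_apply (hm n) hO.measurableSet]
    exact hn

end LimitLaw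

/-! ### From step processes to a tight Gaussian limit. -/

section GaussianLimit

variable {Ω T I : Type*} [MeasurableSpace Ω]

/-- The element of `ℓ^∞(T)` that takes the value `y (r p)` at `p`. -/
def stepMap {k : ℕ} (r : T → Fin k) (y : EuclideanSpace ℝ (Fin k)) : LInf T :=
  ⟨fun p => y (r p), memℓp_infty ⟨‖y‖, by
    rintro _ ⟨p, rfl⟩
    exact PiLp.norm_apply_le y (r p)⟩⟩

@[simp]
theorem stepMap_apply {k : ℕ} (r : T → Fin k) (y : EuclideanSpace ℝ (Fin k)) (p : T) :
    stepMap r y p = y (r p) := rfl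

theorem continuous_stepMap {k : ℕ} (r : T → Fin k) : Continuous (stepMap r) := by
  refine (LipschitzWith.of_dist_le_mul (K := 1) fun x y => ?_).continuous
  rw [NNReal.coe_one, one_mul, dist_eq_norm, dist_eq_norm]
  exact lp.norm_le_of_forall_le (norm_nonneg _) fun p => PiLp.norm_apply_le (x - y) (r p)

theorem continuous_linf_apply (p : T) : Continuous fun z : LInf T => z p := by
  refine (LipschitzWith.of_dist_le_mul (K := 1) fun x y => ?_).continuous
  rw [NNReal.coe_one, one_mul, dist_eq_norm, dist_eq_norm]
  exact lp.norm_apply_le_norm ENNReal.top_ne_zero (x - y) p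

theorem measurable_toLp_comp {k : ℕ} (i : Fin k → I) : Measurable fun z : I → ℝ =>
    (WithLp.toLp 2 fun j => z (i j) : EuclideanSpace ℝ (Fin k)) := by
  fun_prop

theorem isGaussianProcess_of_fidi {ν : Measure (I → ℝ)} [IsProbabilityMeasure ν]
    (h : ∀ (k : ℕ) (i : Fin k → I), ∃ S : Matrix (Fin k) (Fin k) ℝ, S.PosSemidef ∧
      ν.map (fun z => (WithLp.toLp 2 fun j => z (i j) : EuclideanSpace ℝ (Fin k))) =
          multivariateGaussian 0 S) :
    IsGaussianProcess (fun (i : I) (z : I → ℝ) => z i) ν ∧ ∀ i, ∫ z, z i ∂ν = 0 := by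
  constructor
  · refine ⟨fun J => ?_⟩
    obtain ⟨S, -, hS⟩ := h J.card fun j => (J.equivFin.symm j : I)
    have hg : HasGaussianLaw (fun z : I → ℝ => (WithLp.toLp 2 fun j =>
        z (J.equivFin.symm j : I) : EuclideanSpace ℝ (Fin J.card))) ν :=
      ⟨by rw [hS]; infer_instance⟩
    have := hg.map_fun (ContinuousLinearMap.pi fun j : J =>
      (EuclideanSpace.proj (J.equivFin j) : EuclideanSpace ℝ (Fin J.card) →L[ℝ] ℝ))
    refine this.congr (ae_of_all _ fun z => ?_)
    ext j
    simp
  · intro i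
    obtain ⟨S, hSp, hS⟩ := h 1 fun _ => i
    have h1 := (measurePreserving_eval_multivariateGaussian (μ := 0) hSp (i := 0))
    have h2 : ∫ z, z i ∂ν = ∫ y : EuclideanSpace ℝ (Fin 1), y 0 ∂(multivariateGaussian 0 S) := by
      rw [← hS, integral_map (measurable_toLp_comp _).aemeasurable (by fun_prop)]
    have h3 : ∫ y : EuclideanSpace ℝ (Fin 1), y 0 ∂(multivariateGaussian 0 S) =
        ∫ x, x ∂(gaussianReal 0 (S 0 0).toNNReal) := by
      have := h1.map_eq
      simp only [PiLp.zero_apply] at this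
      rw [← this]
      exact (integral_map h1.measurable.aemeasurable
        (aestronglyMeasurable_id (α := ℝ))).symm
    rw [h2, h3, integral_id_gaussianReal]

/-- A process `U` in `ℓ^∞(T)` that is uniformly approximated by step processes `V n (π m p)` with
asymptotically Gaussian finite-dimensional distributions converges to a tight centred Gaussian
process. -/
theorem exists_gaussian_limit [Countable I] {P : Measure Ω} [IsProbabilityMeasure P]
    {U : ℕ → Ω → LInf T} {V : ℕ → I → Ω → ℝ} (hV : ∀ n i, Measurable (V n i))
    (hfidi : ∀ (k : ℕ) (i : Fin k → I), ∃ S, FidiTendsto P V i S)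
    (π : ℕ → T → I) (hπ : ∀ m, (Set.range (π m)).Finite) {ε η : ℕ → ℝ} (hε : Summable ε)
    (hε0 : ∀ m, 0 ≤ ε m) (hη : Summable η)
    (hstep : ∀ m, ∀ᶠ n in atTop, P {ω | ∃ p, ε m < |V n (π (m + 1) p) ω - V n (π m p) ω|} ≤
      ENNReal.ofReal (η m))
    (happrox : ∀ e : ℝ, 0 < e → ∀ d : ℝ, 0 < d → ∀ᶠ m in atTop, ∀ᶠ n in atTop,
      P {ω | ∃ p, e < |U n ω p - V n (π m p) ω|} ≤ ENNReal.ofReal d) :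
    ∃ K : Measure (LInf T), IsTightCentredGaussian K ∧ ConvergesInLaw P U K ∧
      ∃ R : I → I → ℝ, (∀ i j S, FidiTendsto P V ![i, j] S → S 0 1 = R i j) ∧
        ∀ p q, Tendsto (fun m => R (π m p) (π m q)) atTop
          (𝓝 cov[fun z : LInf T => z p, fun z => z q; K]) := by
  obtain ⟨ν, hνp, hνS, hνO⟩ := exists_limit_law hV hfidi
  obtain ⟨hgp, hmean⟩ := isGaussianProcess_of_fidi (ν := ν) fun k i => by
    obtain ⟨S, hS⟩ := hfidi k i
    exact ⟨S, hS.1, hνS k i S hS⟩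
  -- A level involves finitely many indices, so its step process is a continuous image of a
  -- finite-dimensional vector. This gives measurability into `ℓ^∞(T)` although that space need not
  -- be separable.
  have hfac : ∀ m, ∃ (k : ℕ) (i : Fin k → I) (r : T → Fin k), ∀ p, π m p = i (r p) := by
    intro m
    have := (hπ m).to_subtype
    obtain ⟨k, ⟨e⟩⟩ := Finite.exists_equiv_fin (Set.range (π m))
    exact ⟨k, fun j => e.symm j, fun p => e ⟨π m p, p, rfl⟩, fun p => by simp⟩
  choose k i r hr using hfac
  let Z : ℕ → (I → ℝ) → LInf T := fun m z => stepMap (r m) (WithLp.toLp 2 fun j => z (i m j))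
  have hZ : ∀ m z p, Z m z p = z (π m p) := fun m z p => by simp [Z, hr]
  have hZc : ∀ m, Continuous (Z m) := fun m => (continuous_stepMap _).comp (by fun_prop)
  have hZs : ∀ m, StronglyMeasurable (Z m) := fun m => (hZc m).stronglyMeasurable
  have hsmall : ∀ m, ν {z | ∃ p, ε m < |z (π (m + 1) p) - z (π m p)|} ≤ ENNReal.ofReal (η m) := by
    intro m
    -- The strict inequality makes the event a union of open sets, even for uncountable `T`, so the
    -- bound passes to the limit law.
    refine hνO _ _ ?_ (hstep m)
    simp only [Set.ofPred_exists]
    exact isOpen_iUnion fun p => isOpen_lt continuous_const (by fun_prop)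
  -- Borel-Cantelli: almost surely the increments are eventually at most `ε m`, which is summable,
  -- so the step processes are Cauchy in supremum norm.
  have hconv : ∀ᵐ z ∂ν, ∃ l, Tendsto (fun m => Z m z) atTop (𝓝 l) := by
    have hsum : ∑' m, ν {z | ∃ p, ε m < |z (π (m + 1) p) - z (π m p)|} ≠ ∞ :=
      ne_top_of_le_ne_top hη.tsum_ofReal_ne_top (ENNReal.tsum_le_tsum hsmall)
    filter_upwards [ae_eventually_notMem hsum] with z hz
    refine cauchySeq_tendsto_of_complete (cauchySeq_of_summable_dist ?_)
    refine Summable.of_norm_bounded_eventually_nat hε ?_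
    filter_upwards [hz] with m hm
    rw [Real.norm_eq_abs, abs_of_nonneg dist_nonneg, dist_comm, dist_eq_norm]
    refine lp.norm_le_of_forall_le (hε0 m) fun p => ?_
    have hm' : ¬ ∃ p, ε m < |z (π (m + 1) p) - z (π m p)| := hm
    push Not at hm'
    have := hm' p
    rwa [← hZ (m + 1) z p, ← hZ m z p] at this
  obtain ⟨Zl, hZl, hlim⟩ := exists_stronglyMeasurable_limit_of_tendsto_ae
    (fun m => (hZs m).aestronglyMeasurable) hconv
  have hlimp : ∀ p, ∀ᵐ z ∂ν, Tendsto (fun m => z (π m p)) atTop (𝓝 (Zl z p)) := by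
    intro p
    filter_upwards [hlim] with z hz
    refine (((continuous_linf_apply p).tendsto _).comp hz).congr fun m => ?_
    simp [hZ]
  have hZlp : ∀ p, Measurable fun z => Zl z p := fun p =>
    (continuous_linf_apply p).measurable.comp hZl.measurable
  obtain ⟨hG, hG0, hGcov⟩ := isGaussianProcess_of_tendsto
    (Y := fun m p z => z (π m p)) (Z := fun p z => Zl z p) (ν := ν)
    (fun m => hgp.comp_right (π m)) (fun m p => hmean _) (fun p => (hZlp p).aemeasurable) hlimp
  have hKp : IsProbabilityMeasure (ν.map Zl) :=
    Measure.isProbabilityMeasure_map hZl.measurable.aemeasurable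
  refine ⟨ν.map Zl, ⟨hKp, isTightMeasureSet_map hZl, ⟨fun A => ⟨?_⟩⟩, fun p => ?_⟩, ?_,
    fun a b => cov[fun z => z a, fun z => z b; ν], ?_, fun p q => ?_⟩
  · have hev : Measurable fun z : LInf T => A.restrict fun p => z p :=
      measurable_pi_lambda _ fun p : A => (continuous_linf_apply (p : T)).measurable
    have hmap := Measure.map_map (μ := ν) hev hZl.measurable
    exact hmap ▸ (hG.hasGaussianLaw A).isGaussian_map
  · rw [integral_map hZl.measurable.aemeasurable
      (continuous_linf_apply p).aestronglyMeasurable]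
    exact hG0 p
  · refine convergesInLaw_of_lipschitz fun φ b L hL hb hφ hφc => ?_
    rw [integral_map hZl.measurable.aemeasurable hφc.aestronglyMeasurable]
    have hbb : 0 ≤ b := (abs_nonneg _).trans (hb 0)
    have hm : Tendsto (fun m => ∫ z, φ (Z m z) ∂ν) atTop (𝓝 (∫ z, φ (Zl z) ∂ν)) :=
      tendsto_integral_of_dominated_convergence (fun _ => b)
        (fun m => (hφc.comp (hZc m)).aestronglyMeasurable) (integrable_const _)
        (fun m => ae_of_all _ fun z => hb _)
        (by filter_upwards [hlim] with z hz using (hφc.tendsto _).comp hz)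
    rw [Metric.tendsto_atTop]
    intro e he
    -- Error budget: `e/6` for the Lipschitz term, `e/6` for the exceptional set, `e/3` for `n → ∞`
    -- at fixed `m`, and `e/3` for `m → ∞`.
    set e₁ := e / 6 / (L + 1) with he₁
    set d₁ := e / 6 / (2 * b + 1) with hd₁
    have he₁0 : 0 < e₁ := by positivity
    have hd₁0 : 0 < d₁ := by positivity
    have hLe : L * e₁ ≤ e / 6 := by
      rw [he₁, mul_div_assoc', div_le_iff₀ (by positivity)]
      nlinarith
    have hbd : 2 * b * d₁ ≤ e / 6 := by
      rw [hd₁, mul_div_assoc', div_le_iff₀ (by positivity)]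
      nlinarith
    obtain ⟨m, hm1, hm2⟩ := ((happrox e₁ he₁0 d₁ hd₁0).and
      (Metric.tendsto_nhds.1 hm (e / 3) (by positivity))).exists
    obtain ⟨S, hS⟩ := hfidi (k m) (i m)
    have hS' := hνS _ _ S hS
    let ψ : EuclideanSpace ℝ (Fin (k m)) →ᵇ ℝ :=
      BoundedContinuousFunction.ofNormedAddCommGroup (fun y => φ (stepMap (r m) y))
        (hφc.comp (continuous_stepMap _)) b fun y => hb _
    have hn := ProbabilityMeasure.tendsto_iff_forall_integral_tendsto.1 hS.2.tendsto ψ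
    have hlaw : ∫ y, ψ y ∂((multivariateGaussian (0 : EuclideanSpace ℝ (Fin (k m))) S).map
        fun y => y) = ∫ z, φ (Z m z) ∂ν := by
      rw [Measure.map_id', ← hS', integral_map (measurable_toLp_comp _).aemeasurable ψ.continuous.aestronglyMeasurable]
      rfl
    have hVm : ∀ n, Measurable fun ω =>
        (WithLp.toLp 2 fun j => V n (i m j) ω : EuclideanSpace ℝ (Fin (k m))) := fun n =>
      (WithLp.measurable_toLp 2 _).comp (measurable_pi_lambda _ fun j => hV n _)
    have hn' : Tendsto (fun n => ∫ ω, φ (stepMap (r m) (WithLp.toLp 2 fun j => V n (i m j) ω)) ∂P)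
        atTop (𝓝 (∫ z, φ (Z m z) ∂ν)) := by
      rw [← hlaw]
      refine hn.congr fun n => ?_
      change ∫ y, ψ y ∂(P.map _) = _
      rw [integral_map (hVm n).aemeasurable ψ.continuous.aestronglyMeasurable]
      rfl
    obtain ⟨N, hN⟩ := eventually_atTop.1 (hm1.and (Metric.tendsto_nhds.1 hn' (e / 3) (by positivity)))
    refine ⟨N, fun n hn => ?_⟩
    obtain ⟨h1, h2⟩ := hN n hn
    have h3 := abs_outerExpectation_sub_integral_le (P := P) (U := U n)
      (V := fun ω => stepMap (r m) (WithLp.toLp 2 fun j => V n (i m j) ω)) hb hφ hL he₁0.le hd₁0.le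
      (hφc.measurable.comp ((continuous_stepMap _).measurable.comp (hVm n)))
      (le_trans (measure_mono fun ω hω => ?_) h1)
    · rw [Real.dist_eq] at h2 hm2 ⊢
      rw [abs_lt] at h2 hm2 ⊢
      rw [abs_le] at h3
      constructor <;> linarith [h3.1, h3.2, h2.1, h2.2, hm2.1, hm2.2]
    · by_contra hcon
      have hcon' : ¬ ∃ p, e₁ < |U n ω p - V n (π m p) ω| := hcon
      push Not at hcon'
      have hω' : e₁ < dist (U n ω) (stepMap (r m) (WithLp.toLp 2 fun j => V n (i m j) ω)) := hω
      refine absurd hω' (not_lt.2 ?_)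
      rw [dist_eq_norm]
      refine lp.norm_le_of_forall_le he₁0.le fun p => ?_
      have := hcon' p
      rw [hr] at this
      exact this
  · intro a b S hS
    have h := hνS 2 ![a, b] S hS
    have h1 := covariance_eval_multivariateGaussian (μ := 0) hS.1 0 1
    rw [← h1, ← h, covariance_map (by fun_prop) (by fun_prop)
      (measurable_toLp_comp _).aemeasurable]
    rfl
  · refine (hGcov p q).congr' (Eventually.of_forall fun m => rfl) |>.trans_eq ?_
    rw [covariance_map (continuous_linf_apply p).aestronglyMeasurable
      (continuous_linf_apply q).aestronglyMeasurable hZl.measurable.aemeasurable]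
    rfl

end GaussianLimit

/-! ### Bracket chains and uniform increment bounds. -/

section Chaining

variable {𝒳 Ω : Type*} [MeasurableSpace 𝒳] [MeasurableSpace Ω]

/-- The largest multiple of `4^{-k}` that is at most `t`. -/
def dyadicFloor (k : ℕ) (t : ℝ) : ℝ := ⌊(4 : ℝ) ^ k * t⌋₊ / 4 ^ k

theorem dyadicFloor_nonneg (k : ℕ) (t : ℝ) : 0 ≤ dyadicFloor k t := by
  unfold dyadicFloor
  positivity

theorem dyadicFloor_le (k : ℕ) {t : ℝ} (ht : 0 ≤ t) : dyadicFloor k t ≤ t := by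
  unfold dyadicFloor
  rw [div_le_iff₀ (by positivity), mul_comm t]
  exact Nat.floor_le (by positivity)

theorem sub_dyadicFloor_le (k : ℕ) (t : ℝ) : t - dyadicFloor k t ≤ (1 / 4) ^ k := by
  unfold dyadicFloor
  have h := (Nat.lt_floor_add_one ((4 : ℝ) ^ k * t)).le
  have h4 : (0 : ℝ) < 4 ^ k := by positivity
  rw [div_pow, one_pow, sub_le_iff_le_add, ← add_div, le_div_iff₀ h4]
  linarith

/-- The time grids are nested, so times increase along a chain, as the increment moment bound
requires. -/
theorem dyadicFloor_le_succ (k : ℕ) {t : ℝ} (ht : 0 ≤ t) :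
    dyadicFloor k t ≤ dyadicFloor (k + 1) t := by
  unfold dyadicFloor
  rw [div_le_div_iff₀ (by positivity) (by positivity), pow_succ]
  have h : 4 * ⌊(4 : ℝ) ^ k * t⌋₊ ≤ ⌊(4 : ℝ) ^ k * 4 * t⌋₊ := by
    apply Nat.le_floor
    push_cast
    have := Nat.floor_le (by positivity : 0 ≤ (4 : ℝ) ^ k * t)
    linarith
  have h' : (4 : ℝ) * ⌊(4 : ℝ) ^ k * t⌋₊ ≤ ⌊(4 : ℝ) ^ k * 4 * t⌋₊ := by exact_mod_cast h
  have h4 : (0 : ℝ) < 4 ^ k := by positivity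
  nlinarith

theorem floor_mem_range (k : ℕ) {t : ℝ} (ht1 : t ≤ 1) :
    ⌊(4 : ℝ) ^ k * t⌋₊ ∈ Finset.range (4 ^ k + 1) := by
  rw [Finset.mem_range, Nat.lt_succ_iff]
  apply Nat.floor_le_of_le
  push_cast
  exact mul_le_of_le_one_right (by positivity) ht1

/-- The possibly uncountable union over `p` depends on `p` only through finitely many values of `e`,
so a finite union bound suffices and no measurability is needed. -/
theorem measure_exists_le_card_mul {P : Measure Ω} {T J : Type*} (e : T → J) (S : Finset J)
    (he : ∀ p, e p ∈ S) (A : J → Set Ω) {b : ℝ≥0∞} (hA : ∀ p, P (A (e p)) ≤ b) :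
    P {ω | ∃ p, ω ∈ A (e p)} ≤ S.card * b := by
  classical
  calc P {ω | ∃ p, ω ∈ A (e p)} ≤ P (⋃ j ∈ S.filter fun j => ∃ p, e p = j, A j) := by
        refine measure_mono ?_
        rintro ω ⟨p, hp⟩
        simp only [Set.mem_iUnion, Finset.mem_filter]
        exact ⟨e p, ⟨he p, p, rfl⟩, hp⟩
    _ ≤ ∑ j ∈ S.filter fun j => ∃ p, e p = j, P (A j) := measure_biUnion_finset_le _ _
    _ ≤ ∑ j ∈ S.filter fun j => ∃ p, e p = j, b := by
        refine Finset.sum_le_sum fun j hj => ?_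
        obtain ⟨p, rfl⟩ := (Finset.mem_filter.1 hj).2
        exact hA p
    _ = (S.filter fun j => ∃ p, e p = j).card * b := by rw [Finset.sum_const, nsmul_eq_mul]
    _ ≤ _ := by
        gcongr
        exact Finset.filter_subset _ _

theorem integrable_seqEmp_sub_pow {P : Measure Ω} [IsProbabilityMeasure P] {μ : Measure 𝒳}
    {X : ℕ → Ω → 𝒳} (hX : ∀ i, Measurable (X i)) (hlaw : ∀ i, P.map (X i) = μ)
    {g g' : 𝒳 → ℝ} (hgm : Measurable g) (hgm' : Measurable g') {M : ℝ} (hM : 0 ≤ M)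
    (hg : eLpNorm g ∞ μ ≤ ENNReal.ofReal M) (hg' : eLpNorm g' ∞ μ ≤ ENNReal.ofReal M)
    (n : ℕ) (t t' : ℝ) (r : ℕ) :
    Integrable (fun ω => (seqEmp μ X n g' t' ω - seqEmp μ X n g t ω) ^ r) P := by
  obtain ⟨b, hb⟩ := exists_ae_abs_sum_le (P := P) hX hlaw hM hg (Finset.Icc 1 ⌊(n : ℝ) * t⌋₊)
    (∫ x, g x ∂μ)
  obtain ⟨b', hb'⟩ := exists_ae_abs_sum_le (P := P) hX hlaw hM hg' (Finset.Icc 1 ⌊(n : ℝ) * t'⌋₊)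
    (∫ x, g' x ∂μ)
  have hm := ((measurable_seqEmp (μ := μ) hX hgm' n t').sub
    (measurable_seqEmp (μ := μ) hX hgm n t)).pow_const r
  refine Integrable.of_bound hm.aestronglyMeasurable
    ((1 / √(n : ℝ) * b' + 1 / √(n : ℝ) * b) ^ r) ?_
  filter_upwards [hb, hb'] with ω h h'
  rw [Real.norm_eq_abs, abs_pow]
  refine pow_le_pow_left₀ (abs_nonneg _) ((abs_sub _ _).trans ?_) _
  unfold seqEmp
  rw [abs_mul, abs_mul, abs_of_nonneg (by positivity : (0 : ℝ) ≤ 1 / √(n : ℝ))]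
  gcongr

/-- A chain of brackets: a selection of a bracket of level `k` around each `f ∈ F`. -/
structure BracketChain (𝒞 : NormedFunctionSpace 𝒳) (μ : Measure 𝒳) (s : ℝ≥0∞) (F : Set (𝒳 → ℝ))
    (G : Set 𝒞.carrier) (C₁ β c : ℝ) (R : ℕ) where
  brackets : ℕ → Finset (𝒞.carrier × 𝒞.carrier)
  bracket : ℕ → F → 𝒞.carrier × 𝒞.carrier
  mem : ∀ k f, bracket k f ∈ brackets k
  isBracket : ∀ k, ∀ b ∈ brackets k, IsBracket 𝒞 μ s G ((1 / 2) ^ k) (Real.exp (C₁ * β ^ k)) b.1 b.2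
  le : ∀ k (f : F) x, ((bracket k f).1 : 𝒳 → ℝ) x ≤ f.1 x
  ge : ∀ k (f : F) x, f.1 x ≤ ((bracket k f).2 : 𝒳 → ℝ) x
  card_le : ∀ k, ((brackets k).card : ℝ) ≤ c * ((2 : ℝ) ^ R) ^ k

theorem ExpEntropy.exists_bracketChain {𝒞 : NormedFunctionSpace 𝒳} {μ : Measure 𝒳} {s : ℝ≥0∞}
    {F : Set (𝒳 → ℝ)} {G : Set 𝒞.carrier} {γ : ℝ} (h : ExpEntropy 𝒞 μ s F G γ) :
    ∃ (C₁ c : ℝ) (R : ℕ), 0 < C₁ ∧ 0 ≤ c ∧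
      Nonempty (BracketChain 𝒞 μ s F G C₁ ((2 : ℝ) ^ (1 / γ)) c R) := by
  obtain ⟨C₁, c, R, B, hC₁, hc, hB⟩ := h.exists_brackets
  choose b hbB hb using fun (k : ℕ) (f : F) => (hB k).2.1 f.1 f.2
  exact ⟨C₁, c, R, hC₁, hc, ⟨⟨B, b, hbB, fun k => (hB k).1, fun k f x => (hb k f x).1,
    fun k f x => (hb k f x).2, fun k => (hB k).2.2⟩⟩⟩

section

variable {𝒞 : NormedFunctionSpace 𝒳} {μ : Measure 𝒳} {s : ℝ≥0∞}
  {F : Set (𝒳 → ℝ)} {G : Set 𝒞.carrier} {C₁ β c : ℝ} {R : ℕ}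

theorem BracketChain.eLpNorm_sub_left_le (Ch : BracketChain 𝒞 μ s F G C₁ β c R) (j : ℕ) (f : F) :
    eLpNorm (fun x => f.1 x - ((Ch.bracket j f).1 : 𝒳 → ℝ) x) s μ ≤
      ENNReal.ofReal ((1 / 2) ^ j) := by
  refine (eLpNorm_mono_real fun x => ?_).trans (Ch.isBracket j _ (Ch.mem j f)).size_le
  rw [Real.norm_eq_abs, abs_of_nonneg (sub_nonneg.2 (Ch.le j f x))]
  exact sub_le_sub_right (Ch.ge j f x) _

/-- Brackets of different levels need not be nested, but both lower ends are close to the same `f`.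
-/
theorem BracketChain.eLpNorm_left_sub_le (Ch : BracketChain 𝒞 μ s F G C₁ β c R) (hs : 1 ≤ s)
    (hF : ∀ f ∈ F, Measurable f) (k : ℕ) (f : F) :
    eLpNorm (fun x => ((Ch.bracket (k + 1) f).1 : 𝒳 → ℝ) x - ((Ch.bracket k f).1 : 𝒳 → ℝ) x) s μ ≤
      ENNReal.ofReal (2 * (1 / 2) ^ k) := by
  have h1 := fun j => Ch.eLpNorm_sub_left_le j f
  have hm : ∀ j, AEStronglyMeasurable (fun x => f.1 x - ((Ch.bracket j f).1 : 𝒳 → ℝ) x) μ :=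
    fun j => ((hF _ f.2).sub (𝒞.measurable _)).aestronglyMeasurable
  have h2 := eLpNorm_sub_le (hm k) (hm (k + 1)) hs
  have h3 : ((fun x => f.1 x - ((Ch.bracket k f).1 : 𝒳 → ℝ) x) -
      fun x => f.1 x - ((Ch.bracket (k + 1) f).1 : 𝒳 → ℝ) x) =
      fun x => ((Ch.bracket (k + 1) f).1 : 𝒳 → ℝ) x - ((Ch.bracket k f).1 : 𝒳 → ℝ) x := by
    ext x
    simp
  rw [h3] at h2
  refine h2.trans ((add_le_add (h1 k) (h1 (k + 1))).trans ?_)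
  rw [← ENNReal.ofReal_add (by positivity) (by positivity)]
  apply ENNReal.ofReal_le_ofReal
  have : (0 : ℝ) < (1 / 2) ^ k := by positivity
  rw [pow_succ]
  linarith

/-- The finite set of pairs (bracket, time) of level `k`. -/
def BracketChain.level (Ch : BracketChain 𝒞 μ s F G C₁ β c R) (k : ℕ) :
    Finset ((𝒞.carrier × 𝒞.carrier) × ℕ) :=
  Ch.brackets k ×ˢ Finset.range (4 ^ k + 1)

theorem BracketChain.card_level_le (Ch : BracketChain 𝒞 μ s F G C₁ β c R) (k : ℕ) :
    ((Ch.level k).card : ℝ) ≤ 2 * c * ((2 : ℝ) ^ R * 4) ^ k := by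
  have hc0 := (Nat.cast_nonneg _).trans (Ch.card_le k)
  unfold BracketChain.level
  rw [Finset.card_product, Finset.card_range]
  push_cast
  have h4 : (1 : ℝ) ≤ 4 ^ k := one_le_pow₀ (by norm_num)
  calc ((Ch.brackets k).card : ℝ) * (4 ^ k + 1) ≤ (c * ((2 : ℝ) ^ R) ^ k) * (2 * 4 ^ k) :=
        mul_le_mul (Ch.card_le k) (by linarith) (by positivity) hc0
    _ = _ := by rw [mul_pow]; ring

end

/-- Uniform probability bounds for the increments of the empirical process along a chain of
brackets. -/
theorem BracketChain.exists_increment_measure_le {P : Measure Ω} [IsProbabilityMeasure P]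
    {μ : Measure 𝒳} [IsProbabilityMeasure μ] {X : ℕ → Ω → 𝒳} (hX : ∀ i, Measurable (X i))
    (hlaw : ∀ i, P.map (X i) = μ) {s : ℝ≥0∞} (hs : 1 ≤ s) {𝒞 : NormedFunctionSpace 𝒳} {d₀ : ℕ}
    (hmix : MultipleMixing P X μ s 𝒞 d₀) (hone : (1 : 𝒳 → ℝ) ∈ 𝒞.carrier) {M : ℝ} (hM : 1 ≤ M)
    {F : Set (𝒳 → ℝ)} (hF : ∀ f ∈ F, Measurable f) {G : Set 𝒞.carrier}
    (hG : ∀ g ∈ G, eLpNorm (g : 𝒳 → ℝ) ∞ μ ≤ ENNReal.ofReal M) {C₁ β c : ℝ} {R : ℕ}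
    (Ch : BracketChain 𝒞 μ s F G C₁ β c R) (hC₁ : 0 ≤ C₁) (hβ1 : 1 ≤ β) (hc : 0 ≤ c)
    {q : ℝ} (hq0 : 0 < q) (hq1 : q < 1) (hβq : β / 2 = q ^ 4) {c₀ : ℝ} (hc₀ : 1 ≤ c₀) :
    ∃ η : ℝ, 0 ≤ η ∧ ∀ k n : ℕ, (4 : ℝ) ^ k ≤ c₀ * n →
      P {ω | ∃ p : F × unitInterval, q ^ k <
        |seqEmp μ X n ((Ch.bracket (k + 1) p.1).1 : 𝒳 → ℝ) (dyadicFloor (k + 1) p.2) ω -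
          seqEmp μ X n ((Ch.bracket k p.1).1 : 𝒳 → ℝ) (dyadicFloor k p.2) ω|} ≤
            ENNReal.ofReal (η * (1 / 2) ^ k) ∧
      P {ω | ∃ p : F × unitInterval, q ^ k <
        |seqEmp μ X n ((Ch.bracket k p.1).2 : 𝒳 → ℝ) (dyadicFloor k p.2) ω -
          seqEmp μ X n ((Ch.bracket k p.1).1 : 𝒳 → ℝ) (dyadicFloor k p.2) ω|} ≤
            ENNReal.ofReal (η * (1 / 2) ^ k) := by
  set Q : ℝ := (2 : ℝ) ^ R * 4 with hQ
  have hQ1 : 1 ≤ Q := by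
    have : (1 : ℝ) ≤ 2 ^ R := one_le_pow₀ (by norm_num)
    rw [hQ]; linarith
  have hβ2 : β ≤ 2 := by
    have : q ^ 4 ≤ 1 := pow_le_one₀ hq0.le hq1.le
    linarith
  -- Markov's inequality with the `2r`-th moment, of order `q^(4rk)`, at threshold `q^k` leaves
  -- `q^(2rk)`. This `r` beats the number of pairs of consecutive levels, of order `Q^(2k)`, with a
  -- factor `2^{-k}` to spare.
  obtain ⟨r, hr⟩ := exists_pow_lt_of_lt_one (y := q ^ 2) (x := 1 / (2 * (Q * Q))) (by positivity)
    (pow_lt_one₀ hq0.le hq1 (by norm_num))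
  obtain ⟨C, hC0, hC⟩ := hmix.exists_increment_moment_le hX hlaw hs hone hM hC₁ hβ1 hβ2 hc₀ r
  have hM0 : 0 ≤ M := by linarith
  have hQr : (q ^ 2) ^ r * (Q * Q) ≤ 1 / 2 := by
    rw [lt_div_iff₀ (by positivity)] at hr
    linarith
  have markov : ∀ k n : ℕ, (4 : ℝ) ^ k ≤ c₀ * n → ∀ g g' : 𝒞.carrier,
      eLpNorm (g : 𝒳 → ℝ) ∞ μ ≤ ENNReal.ofReal M → eLpNorm (g' : 𝒳 → ℝ) ∞ μ ≤ ENNReal.ofReal M →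
      eLpNorm (fun x => (g' : 𝒳 → ℝ) x - (g : 𝒳 → ℝ) x) s μ ≤ ENNReal.ofReal (2 * (1 / 2) ^ k) →
      𝒞.norm g ≤ Real.exp (C₁ * β ^ (k + 1)) → 𝒞.norm g' ≤ Real.exp (C₁ * β ^ (k + 1)) →
      ∀ t t' : ℝ, 0 ≤ t → t ≤ t' → t' ≤ 1 → t' - t ≤ (1 / 4) ^ k →
      P {ω | q ^ k < |seqEmp μ X n (g' : 𝒳 → ℝ) t' ω - seqEmp μ X n (g : 𝒳 → ℝ) t ω|} ≤
        ENNReal.ofReal (C * ((q ^ 2) ^ r) ^ k) := by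
    intro k n hkn g g' hg hg' hgg' hgn hgn' t t' ht htt' ht' htk
    have hmom := hC k n hkn g g' hg hg' hgg' hgn hgn' t t' ht htt' ht' htk
    have hi := integrable_seqEmp_sub_pow (P := P) hX hlaw (𝒞.measurable g) (𝒞.measurable g') hM0
      hg hg' n t t' (2 * r)
    have hmk := mul_meas_ge_le_integral_of_nonneg (μ := P)
      (ae_of_all _ fun ω => (even_two_mul r).pow_nonneg
        (seqEmp μ X n (g' : 𝒳 → ℝ) t' ω - seqEmp μ X n (g : 𝒳 → ℝ) t ω)) hi ((q ^ k) ^ (2 * r))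
    have hsub : {ω | q ^ k < |seqEmp μ X n (g' : 𝒳 → ℝ) t' ω - seqEmp μ X n (g : 𝒳 → ℝ) t ω|} ⊆
        {ω | (q ^ k) ^ (2 * r) ≤
          (seqEmp μ X n (g' : 𝒳 → ℝ) t' ω - seqEmp μ X n (g : 𝒳 → ℝ) t ω) ^ (2 * r)} := by
      intro ω hω
      have hω' : q ^ k < |seqEmp μ X n (g' : 𝒳 → ℝ) t' ω - seqEmp μ X n (g : 𝒳 → ℝ) t ω| := hω
      have := pow_le_pow_left₀ (by positivity) hω'.le (2 * r)
      rwa [(even_two_mul r).pow_abs] at this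
    refine (measure_mono hsub).trans ?_
    rw [← ofReal_measureReal]
    apply ENNReal.ofReal_le_ofReal
    have hpos : 0 < (q ^ k) ^ (2 * r) := by positivity
    refine le_of_mul_le_mul_left ((hmk.trans hmom).trans_eq ?_) hpos
    rw [hβq]
    ring
  have hexp : ∀ k, Real.exp (C₁ * β ^ k) ≤ Real.exp (C₁ * β ^ (k + 1)) := by
    intro k
    rw [Real.exp_le_exp]
    gcongr
    · omega
  have hkey : ∀ k, Q ^ k * Q ^ k * ((q ^ 2) ^ r) ^ k ≤ (1 / 2) ^ k := by
    intro k
    rw [← mul_pow, ← mul_pow]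
    refine pow_le_pow_left₀ (by positivity) ?_ k
    linarith
  refine ⟨2 * c * (2 * c * Q + 1) * C, by positivity, fun k n hkn => ⟨?_, ?_⟩⟩
  · refine (measure_exists_le_card_mul
      (e := fun p : F × unitInterval => ((Ch.bracket k p.1, ⌊(4 : ℝ) ^ k * p.2⌋₊),
        (Ch.bracket (k + 1) p.1, ⌊(4 : ℝ) ^ (k + 1) * p.2⌋₊)))
      (Ch.level k ×ˢ Ch.level (k + 1)) (fun p => ?_)
      (fun x => {ω | q ^ k < |seqEmp μ X n (x.2.1.1 : 𝒳 → ℝ) (x.2.2 / 4 ^ (k + 1)) ω -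
          seqEmp μ X n (x.1.1.1 : 𝒳 → ℝ) (x.1.2 / 4 ^ k) ω|})
      (b := ENNReal.ofReal (C * ((q ^ 2) ^ r) ^ k)) fun p => ?_).trans ?_
    · simp only [Finset.mem_product, BracketChain.level]
      exact ⟨⟨Ch.mem _ _, floor_mem_range _ p.2.2.2⟩, ⟨Ch.mem _ _, floor_mem_range _ p.2.2.2⟩⟩
    · have hb := Ch.isBracket k _ (Ch.mem k p.1)
      have hb' := Ch.isBracket (k + 1) _ (Ch.mem (k + 1) p.1)
      refine markov k n hkn _ _ (hG _ hb.left_mem) (hG _ hb'.left_mem)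
        (Ch.eLpNorm_left_sub_le hs hF k p.1) (hb.norm_left_le.trans (hexp k)) hb'.norm_left_le
        (dyadicFloor k p.2) (dyadicFloor (k + 1) p.2) (dyadicFloor_nonneg _ _)
        (dyadicFloor_le_succ _ p.2.2.1) ((dyadicFloor_le _ p.2.2.1).trans p.2.2.2) ?_
      have h1 := sub_dyadicFloor_le k (p.2 : ℝ)
      have h2 := dyadicFloor_le (k + 1) p.2.2.1
      linarith
    · rw [← ENNReal.ofReal_natCast, ← ENNReal.ofReal_mul (by positivity), Finset.card_product]
      apply ENNReal.ofReal_le_ofReal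
      push_cast
      calc _ ≤ (2 * c * Q ^ k) * (2 * c * Q ^ (k + 1)) * (C * ((q ^ 2) ^ r) ^ k) := by
            gcongr
            · exact Ch.card_level_le k
            · exact Ch.card_level_le (k + 1)
        _ = 2 * c * (2 * c * Q) * C * (Q ^ k * Q ^ k * ((q ^ 2) ^ r) ^ k) := by
            rw [pow_succ Q k]; ring
        _ ≤ 2 * c * (2 * c * Q + 1) * C * (1 / 2) ^ k := by
            gcongr
            · linarith
            · exact hkey k
  · refine (measure_exists_le_card_mul
      (e := fun p : F × unitInterval => (Ch.bracket k p.1, ⌊(4 : ℝ) ^ k * p.2⌋₊))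
      (Ch.level k) (fun p => ?_)
      (fun x => {ω | q ^ k < |seqEmp μ X n (x.1.2 : 𝒳 → ℝ) (x.2 / 4 ^ k) ω -
          seqEmp μ X n (x.1.1 : 𝒳 → ℝ) (x.2 / 4 ^ k) ω|})
      (b := ENNReal.ofReal (C * ((q ^ 2) ^ r) ^ k)) fun p => ?_).trans ?_
    · simp only [Finset.mem_product, BracketChain.level]
      exact ⟨Ch.mem _ _, floor_mem_range _ p.2.2.2⟩
    · have hb := Ch.isBracket k _ (Ch.mem k p.1)
      refine markov k n hkn _ _ (hG _ hb.left_mem) (hG _ hb.right_mem)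
        (hb.size_le.trans (ENNReal.ofReal_le_ofReal ?_)) (hb.norm_left_le.trans (hexp k))
        (hb.norm_right_le.trans (hexp k))
        (dyadicFloor k p.2) (dyadicFloor k p.2) (dyadicFloor_nonneg _ _)
        le_rfl ((dyadicFloor_le _ p.2.2.1).trans p.2.2.2) ?_
      · have : (0 : ℝ) < (1 / 2) ^ k := by positivity
        linarith
      · rw [sub_self]; positivity
    · rw [← ENNReal.ofReal_natCast, ← ENNReal.ofReal_mul (by positivity)]
      apply ENNReal.ofReal_le_ofReal
      have hQk : Q ^ k ≤ Q ^ k * Q ^ k := le_mul_of_one_le_right (by positivity) (one_le_pow₀ hQ1)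
      calc _ ≤ (2 * c * Q ^ k) * (C * ((q ^ 2) ^ r) ^ k) := by
            gcongr
            exact Ch.card_level_le k
        _ ≤ (2 * c * (Q ^ k * Q ^ k)) * (C * ((q ^ 2) ^ r) ^ k) := by gcongr
        _ = 2 * c * 1 * C * (Q ^ k * Q ^ k * ((q ^ 2) ^ r) ^ k) := by ring
        _ ≤ 2 * c * (2 * c * Q + 1) * C * (1 / 2) ^ k := by
            gcongr
            · have : 0 ≤ 2 * c * Q := by positivity
              linarith
            · exact hkey k

end Chaining

/-! ### Uniform approximation of the empirical process by the chain. -/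

section Approximation

variable {𝒳 Ω : Type*} [MeasurableSpace 𝒳] [MeasurableSpace Ω]

/-- The empirical process at `(f, t)` is controlled by a bracket around `f` at a time `τ ≤ t`. -/
theorem abs_seqEmp_sub_le_of_bracket {𝒳 Ω : Type*} [MeasurableSpace 𝒳] {μ : Measure 𝒳}
    [IsProbabilityMeasure μ] (X : ℕ → Ω → 𝒳)
    {f l u : 𝒳 → ℝ} (hf : Integrable f μ) (hl : Integrable l μ) (hu : Integrable u μ)
    (hlf : ∀ x, l x ≤ f x) (hfu : ∀ x, f x ≤ u x) {δ : ℝ} (hδ : ∫ x, (u - l) x ∂μ ≤ δ)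
    {M : ℝ} (hM : ∀ x, |f x| ≤ M) (n : ℕ) {τ t : ℝ} (hτ : 0 ≤ τ) (hτt : τ ≤ t) (ht : t ≤ 1)
    (ω : Ω) :
    |seqEmp μ X n f t ω - seqEmp μ X n l τ ω| ≤
      |seqEmp μ X n u τ ω - seqEmp μ X n l τ ω| + √n * δ +
        2 * M * (n * (t - τ) + 1) * (1 / √n) := by
  have hn0 : (0 : ℝ) ≤ n := Nat.cast_nonneg n
  have hs0 : (0 : ℝ) ≤ 1 / √(n : ℝ) := by positivity
  rw [seqEmp_sub_seqEmp X hl hf n hτt ω, seqEmp_sub_seqEmp X hl hu n le_rfl ω, Finset.Ioc_self,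
    Finset.sum_empty, add_zero]
  set S := Finset.Icc 1 ⌊(n : ℝ) * τ⌋₊ with hS
  have hcard : (S.card : ℝ) ≤ n := by
    have : ⌊(n : ℝ) * τ⌋₊ ≤ n := by
      apply Nat.floor_le_of_le
      nlinarith
    simpa [hS] using this
  set a := ∫ x, (f - l) x ∂μ
  set b := ∫ x, (u - l) x ∂μ
  have ha0 : 0 ≤ a := integral_nonneg fun x => sub_nonneg.2 (hlf x)
  have hab : a ≤ b := integral_mono (hf.sub hl) (hu.sub hl) fun x => sub_le_sub_right (hfu x) _
  have hA : |∑ i ∈ S, ((f - l) (X i ω) - a)| ≤ |∑ i ∈ S, ((u - l) (X i ω) - b)| + n * δ := by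
    have h0 : 0 ≤ ∑ i ∈ S, (f - l) (X i ω) := Finset.sum_nonneg fun i _ => sub_nonneg.2 (hlf _)
    have h1 : ∑ i ∈ S, (f - l) (X i ω) ≤ ∑ i ∈ S, (u - l) (X i ω) :=
      Finset.sum_le_sum fun i _ => sub_le_sub_right (hfu _) _
    rw [Finset.sum_sub_distrib, Finset.sum_sub_distrib, Finset.sum_const, Finset.sum_const,
      nsmul_eq_mul, nsmul_eq_mul]
    have h2 : (S.card : ℝ) * a ≤ S.card * b := by gcongr
    have h3 : (S.card : ℝ) * b ≤ n * δ := by gcongr; exact ha0.trans hab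
    have h4 := le_abs_self (∑ i ∈ S, (u - l) (X i ω) - S.card * b)
    have h5 := abs_nonneg (∑ i ∈ S, (u - l) (X i ω) - S.card * b)
    have h6 : 0 ≤ (S.card : ℝ) * a := by positivity
    rw [abs_le]
    constructor <;> linarith
  have hmean : |∫ x, f x ∂μ| ≤ M := by
    have h := norm_integral_le_of_norm_le_const (μ := μ) (f := f) (C := M) (ae_of_all _ hM)
    simpa using h
  have hM0 : 0 ≤ M := (abs_nonneg _).trans hmean
  have hB : |∑ i ∈ Finset.Ioc ⌊(n : ℝ) * τ⌋₊ ⌊(n : ℝ) * t⌋₊, (f (X i ω) - ∫ x, f x ∂μ)| ≤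
      2 * M * (n * (t - τ) + 1) := by
    refine (Finset.abs_sum_le_sum_abs _ _).trans
      ((Finset.sum_le_card_nsmul _ _ (2 * M) fun i _ => ?_).trans ?_)
    · have := abs_sub (f (X i ω)) (∫ x, f x ∂μ)
      have := hM (X i ω)
      linarith
    · have hle : ⌊(n : ℝ) * τ⌋₊ ≤ ⌊(n : ℝ) * t⌋₊ := Nat.floor_mono (by gcongr)
      rw [nsmul_eq_mul, Nat.card_Ioc, Nat.cast_sub hle, mul_comm]
      have h1 := Nat.floor_le (mul_nonneg hn0 (hτ.trans hτt))
      have h2 := (Nat.lt_floor_add_one ((n : ℝ) * τ)).le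
      gcongr
      linarith
  have hsq : 1 / √(n : ℝ) * (n * δ) = √n * δ := by
    rw [← mul_assoc, one_div_mul_eq_div, Real.div_sqrt]
  rw [abs_mul, abs_mul, abs_of_nonneg hs0]
  calc _ ≤ 1 / √(n : ℝ) * ((|∑ i ∈ S, ((u - l) (X i ω) - b)| + n * δ) +
        2 * M * (n * (t - τ) + 1)) := by
        gcongr
        exact (abs_add_le _ _).trans (add_le_add hA hB)
    _ = _ := by rw [mul_add, mul_add, hsq]; ring

theorem integral_le_of_eLpNorm_le {μ : Measure 𝒳} [IsProbabilityMeasure μ] {s : ℝ≥0∞} (hs : 1 ≤ s)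
    {f : 𝒳 → ℝ} (hf : AEStronglyMeasurable f μ) {δ : ℝ} (hδ : 0 ≤ δ)
    (h : eLpNorm f s μ ≤ ENNReal.ofReal δ) : ∫ x, |f x| ∂μ ≤ δ :=
  (integral_abs_le_eLpNorm_toReal hs ⟨hf, h.trans_lt ENNReal.ofReal_lt_top⟩).trans
    (ENNReal.toReal_le_of_le_ofReal hδ h)

theorem integrable_of_eLpNorm_top_le {μ : Measure 𝒳} [IsProbabilityMeasure μ] {f : 𝒳 → ℝ}
    (hf : AEStronglyMeasurable f μ) {M : ℝ} (h : eLpNorm f ∞ μ ≤ ENNReal.ofReal M) :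
    Integrable f μ :=
  have h' : MemLp f ∞ μ := ⟨hf, h.trans_lt ENNReal.ofReal_lt_top⟩
  h'.integrable le_top

theorem IsBracket.integral_sub_le {μ : Measure 𝒳} [IsProbabilityMeasure μ] {s : ℝ≥0∞} (hs : 1 ≤ s)
    {𝒞 : NormedFunctionSpace 𝒳} {G : Set 𝒞.carrier} {ε A : ℝ} (hε : 0 ≤ ε) {l u : 𝒞.carrier}
    (h : IsBracket 𝒞 μ s G ε A l u) : ∫ x, ((u : 𝒳 → ℝ) - (l : 𝒳 → ℝ)) x ∂μ ≤ ε := by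
  refine le_trans (le_of_eq ?_) (integral_le_of_eLpNorm_le hs
    ((𝒞.measurable u).sub (𝒞.measurable l)).aestronglyMeasurable hε h.size_le)
  refine integral_congr_ae (ae_of_all _ fun x => ?_)
  exact (abs_of_nonneg (sub_nonneg.2 (h.le x))).symm

/-- A level `m` with `2^m` of the order of `√n`. -/
theorem exists_level {e : ℝ} (he : 0 < e) {n : ℕ} (hn : e ≤ 4 * √n) :
    ∃ m : ℕ, 4 * √n / e < 2 ^ m ∧ (2 : ℝ) ^ m ≤ 8 * √n / e := by
  obtain ⟨m, h1, h2⟩ := exists_nat_pow_near (x := 4 * √n / e) (y := 2)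
    (by rwa [le_div_iff₀ he, one_mul]) (by norm_num)
  refine ⟨m + 1, h2, ?_⟩
  rw [pow_succ]
  calc (2 : ℝ) ^ m * 2 ≤ 4 * √n / e * 2 := by gcongr
    _ = _ := by ring

/-- The values of the empirical process along a chain of brackets approximate the empirical process
uniformly in probability. -/
theorem BracketChain.eventually_measure_le {P : Measure Ω} [IsProbabilityMeasure P]
    {μ : Measure 𝒳} [IsProbabilityMeasure μ] {X : ℕ → Ω → 𝒳} (hX : ∀ i, Measurable (X i))
    (hlaw : ∀ i, P.map (X i) = μ) {s : ℝ≥0∞} (hs : 1 ≤ s) {𝒞 : NormedFunctionSpace 𝒳} {d₀ : ℕ}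
    (hmix : MultipleMixing P X μ s 𝒞 d₀) (hone : (1 : 𝒳 → ℝ) ∈ 𝒞.carrier) {M : ℝ} (hM : 1 ≤ M)
    {F : Set (𝒳 → ℝ)} (hF : ∀ f ∈ F, Measurable f) {B : ℝ} (hB : ∀ f ∈ F, ∀ x, |f x| ≤ B)
    {G : Set 𝒞.carrier}
    (hG : ∀ g ∈ G, eLpNorm (g : 𝒳 → ℝ) ∞ μ ≤ ENNReal.ofReal M) {C₁ β c : ℝ} {R : ℕ}
    (Ch : BracketChain 𝒞 μ s F G C₁ β c R) (hC₁ : 0 ≤ C₁) (hβ1 : 1 ≤ β) (hc : 0 ≤ c)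
    {q : ℝ} (hq0 : 0 < q) (hq1 : q < 1) (hβq : β / 2 = q ^ 4)
    {e : ℝ} (he : 0 < e) {d : ℝ} (hd : 0 < d) :
    ∀ᶠ m in atTop, ∀ᶠ n in atTop,
      P {ω | ∃ p : F × unitInterval, e < |seqEmp μ X n p.1 p.2 ω -
        seqEmp μ X n ((Ch.bracket m p.1).1 : 𝒳 → ℝ) (dyadicFloor m p.2) ω|} ≤
          ENNReal.ofReal d := by
  -- The chain will stop at a level `N` with `2^N ≤ 8 √n / e`, hence `4^N ≤ (64 / e²) n`.
  have hc₀ : 1 ≤ max 1 (64 / e ^ 2) := le_max_left _ _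
  obtain ⟨η, hη0, hη⟩ := Ch.exists_increment_measure_le hX hlaw hs hmix hone hM hF hG hC₁ hβ1 hc
    hq0 hq1 hβq hc₀
  have hq1' : 0 < 1 - q := by linarith
  have hlimq := tendsto_pow_atTop_nhds_zero_of_lt_one hq0.le hq1
  have hev1 : ∀ᶠ m : ℕ in atTop, q ^ m / (1 - q) ≤ e / 8 := by
    have := hlimq.div_const (1 - q)
    rw [zero_div] at this
    exact this.eventually_le_const (by positivity)
  have hev2 : ∀ᶠ m : ℕ in atTop, 2 * η * (1 / 2) ^ m ≤ d := by
    have := (tendsto_pow_atTop_nhds_zero_of_lt_one (r := (1 / 2 : ℝ)) (by norm_num)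
      (by norm_num)).const_mul (2 * η)
    rw [mul_zero] at this
    exact this.eventually_le_const hd
  filter_upwards [hev1, hev2] with m hm1 hm2
  have hsqrt : Tendsto (fun n : ℕ => √(n : ℝ)) atTop atTop :=
    Real.tendsto_sqrt_atTop.comp tendsto_natCast_atTop_atTop
  have hB0 : ∀ f : F, 0 ≤ B := fun f => by
    obtain ⟨x⟩ := μ.nonempty_of_neZero
    exact (abs_nonneg _).trans (hB f.1 f.2 x)
  have hev3 : ∀ᶠ n : ℕ in atTop, 2 * B * (e ^ 2 / 16 + 1) * (1 / √(n : ℝ)) ≤ e / 8 := by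
    have := (hsqrt.const_div_atTop 1).const_mul (2 * B * (e ^ 2 / 16 + 1))
    rw [mul_zero] at this
    exact this.eventually_le_const (by positivity)
  filter_upwards [hev3, hsqrt.eventually_ge_atTop (e / 4), hsqrt.eventually_ge_atTop 1,
    hsqrt.eventually_ge_atTop (2 ^ m * e / 4)] with n hn1 hn2 hn3 hn4
  obtain ⟨N, hN1, hN2⟩ := exists_level he (n := n) (by linarith)
  have hsq : √(n : ℝ) * √n = n := Real.mul_self_sqrt (Nat.cast_nonneg n)
  have h4N : (4 : ℝ) ^ N ≤ max 1 (64 / e ^ 2) * n := by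
    calc (4 : ℝ) ^ N = 2 ^ N * 2 ^ N := by rw [← mul_pow]; norm_num
      _ ≤ (8 * √n / e) * (8 * √n / e) := by gcongr
      _ = 64 / e ^ 2 * (√n * √n) := by field_simp; norm_num
      _ ≤ _ := by rw [hsq]; gcongr; exact le_max_right _ _
  have hNm : m ≤ N := by
    have : (2 : ℝ) ^ m < 2 ^ N := by
      refine lt_of_le_of_lt ?_ hN1
      rw [le_div_iff₀ he]
      linarith
    exact ((pow_lt_pow_iff_right₀ (by norm_num : (1 : ℝ) < 2)).1 this).le
  have hk : ∀ k ≤ N, (4 : ℝ) ^ k ≤ max 1 (64 / e ^ 2) * n := fun k hk =>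
    (pow_le_pow_right₀ (by norm_num) hk).trans h4N
  set V : ℕ → F × unitInterval → Ω → ℝ := fun k p =>
    seqEmp μ X n ((Ch.bracket k p.1).1 : 𝒳 → ℝ) (dyadicFloor k p.2) with hV
  set E : ℕ → Set Ω := fun k => {ω | ∃ p, q ^ k < |V (k + 1) p ω - V k p ω|} with hE
  set E' : Set Ω := {ω | ∃ p : F × unitInterval, q ^ N <
    |seqEmp μ X n ((Ch.bracket N p.1).2 : 𝒳 → ℝ) (dyadicFloor N p.2) ω - V N p ω|} with hE'
  -- Off the exceptional sets the error is at most `5e/8`: `e/8` for the links from `m` to `N`,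
  -- `e/8` for the final bracket, `e/4` for its bias, and `e/8` for the remaining time.
  have hsub : {ω | ∃ p : F × unitInterval, e < |seqEmp μ X n p.1 p.2 ω - V m p ω|} ⊆
      (⋃ k ∈ Finset.Ico m N, E k) ∪ E' := by
    rintro ω ⟨p, hp⟩
    by_contra hcon
    simp only [Set.mem_union, Set.mem_iUnion, not_or, not_exists, hE, hE', Set.mem_ofPred_eq,
      not_lt, Finset.mem_Ico] at hcon
    obtain ⟨hcon1, hcon2⟩ := hcon
    have hsum : |V N p ω - V m p ω| ≤ q ^ m / (1 - q) := by
      rw [← Finset.sum_Ico_sub (fun k => V k p ω) hNm]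
      exact (Finset.abs_sum_le_sum_abs _ _).trans
        ((Finset.sum_le_sum fun k hk => hcon1 k (Finset.mem_Ico.1 hk) p).trans
          (geom_sum_Ico_le_of_lt_one hq0.le hq1))
    have hb := Ch.isBracket N _ (Ch.mem N p.1)
    have happ := abs_seqEmp_sub_le_of_bracket X (f := p.1.1) (τ := dyadicFloor N p.2) (t := p.2)
      (Integrable.of_bound (hF _ p.1.2).aestronglyMeasurable B (ae_of_all μ (hB _ p.1.2)))
      (integrable_of_eLpNorm_top_le (𝒞.measurable _).aestronglyMeasurable (hG _ hb.left_mem))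
      (integrable_of_eLpNorm_top_le (𝒞.measurable _).aestronglyMeasurable (hG _ hb.right_mem))
      (Ch.le N p.1) (Ch.ge N p.1) (hb.integral_sub_le hs (by positivity)) (hB _ p.1.2) n
      (dyadicFloor_nonneg _ _) (dyadicFloor_le _ p.2.2.1) p.2.2.2 ω
    have h1 : √(n : ℝ) * (1 / 2) ^ N ≤ e / 4 := by
      rw [div_lt_iff₀ he] at hN1
      rw [one_div, inv_pow, ← div_eq_mul_inv, div_le_iff₀ (by positivity)]
      linarith
    have h2 : (n : ℝ) * (p.2 - dyadicFloor N p.2) ≤ e ^ 2 / 16 := by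
      calc (n : ℝ) * (p.2 - dyadicFloor N p.2) ≤ n * (1 / 4) ^ N := by
            gcongr
            exact sub_dyadicFloor_le _ _
        _ = (√(n : ℝ) * (1 / 2) ^ N) * (√(n : ℝ) * (1 / 2) ^ N) := by
            rw [← hsq, mul_mul_mul_comm, ← mul_pow]; norm_num
        _ ≤ (e / 4) * (e / 4) := by gcongr
        _ = _ := by ring
    have h3 : 2 * B * (n * (p.2 - dyadicFloor N p.2) + 1) * (1 / √n) ≤ e / 8 := by
      refine le_trans ?_ hn1
      have := hB0 p.1
      gcongr
    have h4 : q ^ N ≤ e / 8 := by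
      refine (pow_le_pow_of_le_one hq0.le hq1.le hNm).trans (le_trans ?_ hm1)
      rw [le_div_iff₀ hq1']
      have : 0 < q ^ m := by positivity
      nlinarith
    have h5 := hcon2 p
    have h6 := abs_sub_le (seqEmp μ X n p.1 p.2 ω) (V N p ω) (V m p ω)
    simp only [hV] at h5 h6 hsum hp
    linarith
  calc _ ≤ P ((⋃ k ∈ Finset.Ico m N, E k) ∪ E') := measure_mono hsub
    _ ≤ (∑ k ∈ Finset.Ico m N, P (E k)) + P E' :=
        (measure_union_le _ _).trans (add_le_add (measure_biUnion_finset_le _ _) le_rfl)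
    _ ≤ (∑ k ∈ Finset.Ico m N, ENNReal.ofReal (η * (1 / 2) ^ k)) +
          ENNReal.ofReal (η * (1 / 2) ^ N) := by
        refine add_le_add (Finset.sum_le_sum fun k hk' => ?_) (hη N n h4N).2
        exact (hη k n (hk k (Finset.mem_Ico.1 hk').2.le)).1
    _ = ENNReal.ofReal (η * ∑ k ∈ Finset.Ico m (N + 1), (1 / 2 : ℝ) ^ k) := by
        rw [← ENNReal.ofReal_sum_of_nonneg fun k _ => by positivity,
          ← ENNReal.ofReal_add (Finset.sum_nonneg fun k _ => by positivity) (by positivity),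
          Finset.sum_Ico_succ_top hNm, mul_add, Finset.mul_sum]
    _ ≤ ENNReal.ofReal d := by
        apply ENNReal.ofReal_le_ofReal
        have := geom_sum_Ico_le_of_lt_one (m := m) (n := N + 1) (x := (1 / 2 : ℝ)) (by norm_num)
          (by norm_num)
        calc _ ≤ η * ((1 / 2) ^ m / (1 - 1 / 2)) := by gcongr
          _ = 2 * η * (1 / 2) ^ m := by ring
          _ ≤ d := hm2

end Approximation

/-! ### Approximation and summability of covariances. -/

section Covariance

variable {𝒳 Ω : Type*} [MeasurableSpace 𝒳] [MeasurableSpace Ω]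

theorem memLp_comp_of_ae_abs_le {P : Measure Ω} [IsProbabilityMeasure P] {μ : Measure 𝒳}
    {X : ℕ → Ω → 𝒳} (hX : ∀ i, Measurable (X i)) (hlaw : ∀ i, P.map (X i) = μ) {φ : 𝒳 → ℝ}
    (hφ : Measurable φ) {M : ℝ} (hφM : ∀ᵐ x ∂μ, |φ x| ≤ M) (i : ℕ) (p : ℝ≥0∞) :
    MemLp (fun ω => φ (X i ω)) p P :=
  MemLp.of_bound (hφ.comp (hX i)).aestronglyMeasurable M
    (ae_of_ae_map (hX i).aemeasurable ((hlaw i).symm ▸ hφM))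

/-- This Hölder bound holds uniformly in the lag, so small `L¹` errors of brackets carry over to
every covariance. -/
theorem abs_covariance_le_mul_integral {P : Measure Ω} [IsProbabilityMeasure P] {μ : Measure 𝒳}
    {X : ℕ → Ω → 𝒳} (hX : ∀ i, Measurable (X i)) (hlaw : ∀ i, P.map (X i) = μ) {φ h : 𝒳 → ℝ}
    (hφ : Measurable φ) (hh : Measurable h) {M M' : ℝ} (hφM : ∀ᵐ x ∂μ, |φ x| ≤ M)
    (hhM : ∀ᵐ x ∂μ, |h x| ≤ M') (i j : ℕ) :
    |cov[fun ω => φ (X i ω), fun ω => h (X j ω); P]| ≤ 2 * M * ∫ x, |h x| ∂μ := by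
  have hφP : ∀ᵐ ω ∂P, |φ (X i ω)| ≤ M := ae_of_ae_map (hX i).aemeasurable ((hlaw i).symm ▸ hφM)
  have hhi : Integrable (fun ω => |h (X j ω)|) P :=
    ((memLp_comp_of_ae_abs_le hX hlaw hh hhM j 1).integrable le_rfl).abs
  have hint : ∫ ω, |h (X j ω)| ∂P = ∫ x, |h x| ∂μ := by
    rw [← hlaw j, integral_map (hX j).aemeasurable hh.abs.aestronglyMeasurable]
  have hmean : |∫ ω, φ (X i ω) ∂P| ≤ M := by
    have := norm_integral_le_of_norm_le_const (μ := P) (f := fun ω => φ (X i ω)) (C := M) hφP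
    simpa using this
  have hmean' : |∫ ω, h (X j ω) ∂P| ≤ ∫ x, |h x| ∂μ := by
    rw [← hint]
    exact abs_integral_le_integral_abs
  have hprod : |∫ ω, φ (X i ω) * h (X j ω) ∂P| ≤ M * ∫ x, |h x| ∂μ := by
    rw [← hint, ← integral_const_mul, ← Real.norm_eq_abs]
    refine norm_integral_le_of_norm_le (hhi.const_mul M) ?_
    filter_upwards [hφP] with ω hω
    rw [norm_mul, Real.norm_eq_abs, Real.norm_eq_abs]
    gcongr
  rw [covariance_eq_sub (memLp_comp_of_ae_abs_le hX hlaw hφ hφM i 2)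
    (memLp_comp_of_ae_abs_le hX hlaw hh hhM j 2)]
  refine (abs_sub _ _).trans ?_
  rw [abs_mul]
  have h1 : |∫ ω, φ (X i ω) ∂P| * |∫ ω, h (X j ω) ∂P| ≤ M * ∫ x, |h x| ∂μ :=
    mul_le_mul hmean hmean' (abs_nonneg _) ((abs_nonneg _).trans hmean)
  have h2 : |P[(fun ω => φ (X i ω)) * fun ω => h (X j ω)]| ≤ M * ∫ x, |h x| ∂μ := hprod
  linarith

theorem tendsto_covariance {P : Measure Ω} [IsProbabilityMeasure P] {μ : Measure 𝒳}
    {X : ℕ → Ω → 𝒳} (hX : ∀ i, Measurable (X i)) (hlaw : ∀ i, P.map (X i) = μ) {φ h : 𝒳 → ℝ}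
    (hφ : Measurable φ) (hh : Measurable h) {M : ℝ} (hφM : ∀ᵐ x ∂μ, |φ x| ≤ M)
    (hhM : ∀ᵐ x ∂μ, |h x| ≤ M) {φ' h' : ℕ → 𝒳 → ℝ} (hφ' : ∀ m, Measurable (φ' m))
    (hh' : ∀ m, Measurable (h' m)) (hφM' : ∀ m, ∀ᵐ x ∂μ, |φ' m x| ≤ M)
    (hhM' : ∀ m, ∀ᵐ x ∂μ, |h' m x| ≤ M)
    (hφlim : Tendsto (fun m => ∫ x, |φ' m x - φ x| ∂μ) atTop (𝓝 0))
    (hhlim : Tendsto (fun m => ∫ x, |h' m x - h x| ∂μ) atTop (𝓝 0)) (i j : ℕ) :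
    Tendsto (fun m => cov[fun ω => φ' m (X i ω), fun ω => h' m (X j ω); P]) atTop
      (𝓝 cov[fun ω => φ (X i ω), fun ω => h (X j ω); P]) := by
  rw [tendsto_iff_dist_tendsto_zero]
  have hsub : ∀ {a b : 𝒳 → ℝ}, (∀ᵐ x ∂μ, |a x| ≤ M) → (∀ᵐ x ∂μ, |b x| ≤ M) →
      ∀ᵐ x ∂μ, |a x - b x| ≤ M + M := fun ha hb => by
    filter_upwards [ha, hb] with x h1 h2
    exact (abs_sub _ _).trans (add_le_add h1 h2)
  refine squeeze_zero (fun m => dist_nonneg) (fun m => ?_)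
    (g := fun m => 2 * M * ∫ x, |h' m x - h x| ∂μ + 2 * M * ∫ x, |φ' m x - φ x| ∂μ)
    (by simpa using (hhlim.const_mul (2 * M)).add (hφlim.const_mul (2 * M)))
  have h1 := abs_covariance_le_mul_integral hX hlaw (hφ' m) ((hh' m).sub hh) (hφM' m)
    (hsub (hhM' m) hhM) i j
  have h2 := abs_covariance_le_mul_integral hX hlaw hh ((hφ' m).sub hφ) hhM
    (hsub (hφM' m) hφM) j i
  have e1 := covariance_fun_sub_right (memLp_comp_of_ae_abs_le hX hlaw (hφ' m) (hφM' m) i 2)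
    (memLp_comp_of_ae_abs_le hX hlaw (hh' m) (hhM' m) j 2)
    (memLp_comp_of_ae_abs_le hX hlaw hh hhM j 2)
  have e2 := covariance_fun_sub_right (memLp_comp_of_ae_abs_le hX hlaw hh hhM j 2)
    (memLp_comp_of_ae_abs_le hX hlaw (hφ' m) (hφM' m) i 2)
    (memLp_comp_of_ae_abs_le hX hlaw hφ hφM i 2)
  simp only [Pi.sub_apply] at h1 h2
  rw [e1] at h1
  rw [e2, covariance_comm, covariance_comm (fun ω => h (X j ω)) (fun ω => φ (X i ω))] at h2
  rw [Real.dist_eq]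
  refine (abs_sub_le _ cov[fun ω => φ' m (X i ω), fun ω => h (X j ω); P] _).trans (add_le_add h1 h2)

/-- A summable bound for the covariances along a chain of brackets. -/
theorem BracketChain.exists_summable_cov_bound {P : Measure Ω} [IsProbabilityMeasure P]
    {μ : Measure 𝒳} [IsProbabilityMeasure μ] {X : ℕ → Ω → 𝒳} (hX : ∀ i, Measurable (X i))
    (hlaw : ∀ i, P.map (X i) = μ) {s : ℝ≥0∞} (hs : 1 ≤ s) {𝒞 : NormedFunctionSpace 𝒳} {M : ℝ}
    (hM : 0 ≤ M) {F : Set (𝒳 → ℝ)} (hF : ∀ f ∈ F, Measurable f) (hFM : ∀ f ∈ F, ∀ x, |f x| ≤ M)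
    {G : Set 𝒞.carrier} (hG : ∀ g ∈ G, eLpNorm (g : 𝒳 → ℝ) ∞ μ ≤ ENNReal.ofReal M)
    (hdecay : GeometricCovDecay P X μ s 𝒞 G) {C₁ β c γ : ℝ} {R : ℕ} (hγ : 1 < γ)
    (hβ1 : 1 < β) (hβγ : β ^ γ = 2) (Ch : BracketChain 𝒞 μ s F G C₁ β c R) (hC₁ : 0 < C₁) :
    ∃ b : ℕ → ℝ, Summable b ∧ ∀ φ : 𝒳 → ℝ, Measurable φ → (∀ᵐ x ∂μ, |φ x| ≤ M) →
      ∀ (g : F) (k : ℕ), |cov[fun ω => φ (X 0 ω), fun ω => g.1 (X k ω); P]| ≤ b k ∧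
        ∀ m, |cov[fun ω => φ (X 0 ω), fun ω => ((Ch.bracket m g).1 : 𝒳 → ℝ) (X k ω); P]| ≤ b k := by
  obtain ⟨θ, D, hθ0, hθ1, hD, hdec⟩ := hdecay
  have hlog : Real.log θ < 0 := Real.log_neg hθ0 hθ1
  -- With this slope, `β^j ≤ 1 + κ k` costs at most `exp C₁ · θ^{-k/2}` in the norm of a level-`j`
  -- bracket, leaving half of the decay `θ^k`.
  set κ := -Real.log θ / (2 * C₁) with hκ
  have hκ0 : 0 < κ := div_pos (by linarith) (by positivity)
  set b₁ : ℕ → ℝ := fun k => (1 + κ * k) ^ (-γ)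
  set b₂ : ℕ → ℝ := fun k => Real.exp (Real.log θ / 2) ^ k
  have hsum₁ : Summable b₁ := by
    have h1 : Summable fun k : ℕ => ((k + 1 : ℕ) : ℝ) ^ (-γ) :=
      (summable_nat_add_iff 1).2 (Real.summable_nat_rpow.2 (by linarith))
    refine Summable.of_nonneg_of_le (fun k => by positivity) (fun k => ?_)
      (h1.mul_left (min 1 κ ^ (-γ)))
    have hmin : 0 < min 1 κ := lt_min one_pos hκ0
    rw [← Real.mul_rpow hmin.le (by positivity)]
    refine Real.rpow_le_rpow_of_nonpos (by positivity) ?_ (by linarith)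
    push_cast
    have := min_le_left 1 κ
    have h2 : min 1 κ * (k : ℝ) ≤ κ * k := by gcongr; exact min_le_right 1 κ
    linarith
  have hsum₂ : Summable b₂ :=
    summable_geometric_of_lt_one (Real.exp_pos _).le (Real.exp_lt_one_iff.2 (by linarith))
  refine ⟨fun k => 8 * M * b₁ k + D * M * Real.exp C₁ * b₂ k,
    (hsum₁.mul_left _).add (hsum₂.mul_left _), fun φ hφ hφM g k => ?_⟩
  -- The level is matched to the lag: it is the largest one whose norm the mixing can afford. Since
  -- `β^γ = 2`, its bracket size is at most `2 (1 + κ k)^{-γ}`.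
  obtain ⟨j, hj1, hj2⟩ := exists_nat_pow_near (x := 1 + κ * k) (y := β)
    (by linarith [mul_nonneg hκ0.le (Nat.cast_nonneg (α := ℝ) k)]) hβ1
  have hlevel : ((1 : ℝ) / 2) ^ j ≤ 2 * b₁ k := by
    have h1 : (β ^ (j + 1)) ^ (-γ) ≤ b₁ k :=
      Real.rpow_le_rpow_of_nonpos (by positivity) hj2.le (by linarith)
    have h2 : (β ^ (j + 1)) ^ (-γ) = (1 / 2) ^ (j + 1) := by
      rw [← Real.rpow_natCast, ← Real.rpow_mul (by positivity), mul_comm, Real.rpow_mul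
        (by positivity), Real.rpow_neg (by positivity), hβγ, Real.rpow_natCast, one_div]
    rw [h2, pow_succ] at h1
    linarith
  have hexp : Real.exp (C₁ * β ^ j) * θ ^ k ≤ Real.exp C₁ * b₂ k := by
    have h1 : C₁ * β ^ j ≤ C₁ + -Real.log θ / 2 * k := by
      calc C₁ * β ^ j ≤ C₁ * (1 + κ * k) := by gcongr
        _ = _ := by rw [hκ]; field_simp
    calc Real.exp (C₁ * β ^ j) * θ ^ k ≤ Real.exp (C₁ + -Real.log θ / 2 * k) * θ ^ k := by gcongr
      _ = Real.exp (C₁ + -Real.log θ / 2 * k) * Real.exp (k * Real.log θ) := by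
        rw [Real.exp_nat_mul, Real.exp_log hθ0]
      _ = Real.exp C₁ * b₂ k := by
        simp only [b₂]
        rw [← Real.exp_nat_mul, ← Real.exp_add, ← Real.exp_add]
        congr 1
        ring
  have hφs : MemLp φ s μ := MemLp.of_bound hφ.aestronglyMeasurable M hφM
  have hφn : (eLpNorm φ s μ).toReal ≤ M := by
    refine ENNReal.toReal_le_of_le_ofReal hM ((eLpNorm_le_of_ae_bound hφM).trans ?_)
    simp
  have hbr : ∀ m, IsBracket 𝒞 μ s G _ _ (Ch.bracket m g).1 (Ch.bracket m g).2 :=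
    fun m => Ch.isBracket m _ (Ch.mem m g)
  have hlm : ∀ m, Measurable ((Ch.bracket m g).1 : 𝒳 → ℝ) := fun m => 𝒞.measurable _
  have hlM : ∀ m, ∀ᵐ x ∂μ, |((Ch.bracket m g).1 : 𝒳 → ℝ) x| ≤ M := fun m =>
    ae_abs_le_of_eLpNorm_top_le hM (hG _ (hbr m).left_mem)
  have hgM : ∀ᵐ x ∂μ, |g.1 x| ≤ M := ae_of_all _ (hFM _ g.2)
  have hsmall : ∀ m ≤ j, |cov[fun ω => φ (X 0 ω),
      fun ω => ((Ch.bracket m g).1 : 𝒳 → ℝ) (X k ω); P]| ≤ D * M * Real.exp C₁ * b₂ k := by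
    intro m hm
    refine (hdec _ (Or.inl (hbr m).left_mem) φ hφ hφs k).trans ?_
    have h1 : 𝒞.norm (Ch.bracket m g).1 ≤ Real.exp (C₁ * β ^ j) := by
      refine (hbr m).norm_left_le.trans ?_
      rw [Real.exp_le_exp]
      gcongr
      exact hβ1.le
    calc _ ≤ D * M * Real.exp (C₁ * β ^ j) * θ ^ k := by
          gcongr
      _ = D * M * (Real.exp (C₁ * β ^ j) * θ ^ k) := by ring
      _ ≤ D * M * (Real.exp C₁ * b₂ k) := by gcongr
      _ = _ := by ring
  have hgl : ∀ m, ∫ x, |g.1 x - ((Ch.bracket m g).1 : 𝒳 → ℝ) x| ∂μ ≤ (1 / 2) ^ m := fun m =>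
    integral_le_of_eLpNorm_le hs ((hF _ g.2).sub (hlm m)).aestronglyMeasurable (by positivity)
      (Ch.eLpNorm_sub_left_le m g)
  have hsubM : ∀ {a a' : 𝒳 → ℝ}, (∀ᵐ x ∂μ, |a x| ≤ M) → (∀ᵐ x ∂μ, |a' x| ≤ M) →
      ∀ᵐ x ∂μ, |a x - a' x| ≤ M + M := fun h h' => by
    filter_upwards [h, h'] with x h1 h2
    exact (abs_sub _ _).trans (add_le_add h1 h2)
  have hgen : ∀ h : 𝒳 → ℝ, Measurable h → (∀ᵐ x ∂μ, |h x| ≤ M) →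
      ∫ x, |h x - ((Ch.bracket j g).1 : 𝒳 → ℝ) x| ∂μ ≤ 2 * (1 / 2) ^ j →
      |cov[fun ω => φ (X 0 ω), fun ω => h (X k ω); P]| ≤
        8 * M * b₁ k + D * M * Real.exp C₁ * b₂ k := by
    intro h hh hhM hhl
    have h1 := abs_covariance_le_mul_integral hX hlaw hφ (hh.sub (hlm j)) hφM
      (hsubM hhM (hlM j)) 0 k
    simp only [Pi.sub_apply] at h1
    rw [covariance_fun_sub_right (memLp_comp_of_ae_abs_le hX hlaw hφ hφM 0 2)
      (memLp_comp_of_ae_abs_le hX hlaw hh hhM k 2)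
      (memLp_comp_of_ae_abs_le hX hlaw (hlm j) (hlM j) k 2)] at h1
    have h2 := hsmall j le_rfl
    have h3 : 2 * M * ∫ x, |h x - ((Ch.bracket j g).1 : 𝒳 → ℝ) x| ∂μ ≤ 8 * M * b₁ k := by
      calc _ ≤ 2 * M * (2 * (2 * b₁ k)) := by gcongr; linarith
        _ = _ := by ring
    have h4 := abs_add_le (cov[fun ω => φ (X 0 ω), fun ω => h (X k ω); P] -
      cov[fun ω => φ (X 0 ω), fun ω => ((Ch.bracket j g).1 : 𝒳 → ℝ) (X k ω); P])
      cov[fun ω => φ (X 0 ω), fun ω => ((Ch.bracket j g).1 : 𝒳 → ℝ) (X k ω); P]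
    rw [sub_add_cancel] at h4
    linarith
  have hpos : ∀ i : ℕ, (0 : ℝ) ≤ (1 / 2) ^ i := fun i => by positivity
  refine ⟨hgen _ (hF _ g.2) hgM (by linarith [hgl j, hpos j]), fun m => ?_⟩
  -- For coarse brackets the decay hypothesis applies directly; finer ones are compared with the
  -- level-`j` bracket, which makes the bound uniform in `m`.
  rcases le_total m j with hm | hm
  · refine (hsmall m hm).trans ?_
    have : 0 ≤ 8 * M * b₁ k := by positivity
    linarith
  · refine hgen _ (hlm m) (hlM m) ?_
    have hi : ∀ m, Integrable (fun x => g.1 x - ((Ch.bracket m g).1 : 𝒳 → ℝ) x) μ := fun m =>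
      Integrable.of_bound ((hF _ g.2).sub (hlm m)).aestronglyMeasurable (M + M) (hsubM hgM (hlM m))
    calc _ ≤ ∫ x, (|g.1 x - ((Ch.bracket j g).1 : 𝒳 → ℝ) x| +
          |g.1 x - ((Ch.bracket m g).1 : 𝒳 → ℝ) x|) ∂μ := by
          refine integral_mono_of_nonneg (ae_of_all _ fun x => abs_nonneg _)
            ((hi j).abs.add (hi m).abs) (ae_of_all _ fun x => ?_)
          have := abs_sub (g.1 x - ((Ch.bracket j g).1 : 𝒳 → ℝ) x)
            (g.1 x - ((Ch.bracket m g).1 : 𝒳 → ℝ) x)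
          rwa [sub_sub_sub_cancel_left] at this
      _ ≤ (1 / 2) ^ j + (1 / 2) ^ m := by
          rw [integral_add (hi j).abs (hi m).abs]
          exact add_le_add (hgl j) (hgl m)
      _ ≤ 2 * (1 / 2) ^ j := by
          have : ((1 : ℝ) / 2) ^ m ≤ (1 / 2) ^ j :=
            pow_le_pow_of_le_one (by norm_num) (by norm_num) hm
          linarith

end Covariance

/-! ### Long-run covariances along a chain and its countable index set. -/

section Main

variable {𝒳 Ω : Type*} [MeasurableSpace 𝒳] [MeasurableSpace Ω]

theorem tendsto_dyadicFloor {t : ℝ} (ht : 0 ≤ t) :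
    Tendsto (fun m => dyadicFloor m t) atTop (𝓝 t) := by
  have h := tendsto_pow_atTop_nhds_zero_of_lt_one (r := (1 / 4 : ℝ)) (by norm_num) (by norm_num)
  refine tendsto_of_tendsto_of_tendsto_of_le_of_le (g := fun m => t - (1 / 4) ^ m)
    (by simpa using h.const_sub t) tendsto_const_nhds (fun m => ?_) fun m => dyadicFloor_le m ht
  have := sub_dyadicFloor_le m t
  simp only
  linarith

/-- Convergence of the long-run covariances along a chain of brackets. -/
theorem BracketChain.tendsto_longRunCov {P : Measure Ω} [IsProbabilityMeasure P]
    {μ : Measure 𝒳} [IsProbabilityMeasure μ] {X : ℕ → Ω → 𝒳} (hX : ∀ i, Measurable (X i))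
    (hlaw : ∀ i, P.map (X i) = μ) {s : ℝ≥0∞} (hs : 1 ≤ s) {𝒞 : NormedFunctionSpace 𝒳} {M : ℝ}
    (hM : 0 ≤ M) {F : Set (𝒳 → ℝ)} (hF : ∀ f ∈ F, Measurable f) (hFM : ∀ f ∈ F, ∀ x, |f x| ≤ M)
    {G : Set 𝒞.carrier} (hG : ∀ g ∈ G, eLpNorm (g : 𝒳 → ℝ) ∞ μ ≤ ENNReal.ofReal M)
    (hdecay : GeometricCovDecay P X μ s 𝒞 G) {C₁ β c γ : ℝ} {R : ℕ} (hγ : 1 < γ)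
    (hβ1 : 1 < β) (hβγ : β ^ γ = 2) (Ch : BracketChain 𝒞 μ s F G C₁ β c R) (hC₁ : 0 < C₁)
    (f g : F) (t u : unitInterval) :
    Summable (fun k : ℕ => cov[fun ω => f.1 (X 0 ω), fun ω => g.1 (X k ω); P]) ∧
    Summable (fun k : ℕ => cov[fun ω => g.1 (X 0 ω), fun ω => f.1 (X (k + 1) ω); P]) ∧
    Tendsto (fun m => longRunCov P X ((Ch.bracket m f).1 : 𝒳 → ℝ) ((Ch.bracket m g).1 : 𝒳 → ℝ)
      (dyadicFloor m t) (dyadicFloor m u)) atTop (𝓝 (longRunCov P X f.1 g.1 t u)) := by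
  obtain ⟨b, hb, hbound⟩ := Ch.exists_summable_cov_bound hX hlaw hs hM hF hFM hG hdecay hγ hβ1 hβγ
    hC₁
  have hb' : Summable fun k => b (k + 1) := (summable_nat_add_iff 1).2 hb
  have hlm : ∀ (f : F) m, Measurable ((Ch.bracket m f).1 : 𝒳 → ℝ) := fun f m => 𝒞.measurable _
  have hlM : ∀ (f : F) m, ∀ᵐ x ∂μ, |((Ch.bracket m f).1 : 𝒳 → ℝ) x| ≤ M := fun f m =>
    ae_abs_le_of_eLpNorm_top_le hM (hG _ (Ch.isBracket m _ (Ch.mem m f)).left_mem)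
  have hfM : ∀ f : F, ∀ᵐ x ∂μ, |f.1 x| ≤ M := fun f => ae_of_all _ (hFM _ f.2)
  have hlim : ∀ f : F,
      Tendsto (fun m => ∫ x, |((Ch.bracket m f).1 : 𝒳 → ℝ) x - f.1 x| ∂μ) atTop (𝓝 0) := by
    intro f
    refine squeeze_zero (fun m => integral_nonneg fun x => abs_nonneg _) (fun m => ?_)
      (tendsto_pow_atTop_nhds_zero_of_lt_one (r := (1 / 2 : ℝ)) (by norm_num) (by norm_num))
    simp_rw [abs_sub_comm _ (f.1 _)]
    exact integral_le_of_eLpNorm_le hs ((hF _ f.2).sub (hlm f m)).aestronglyMeasurable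
      (by positivity) (Ch.eLpNorm_sub_left_le m f)
  have hcov : ∀ (f g : F) (k : ℕ), Tendsto (fun m =>
      cov[fun ω => ((Ch.bracket m f).1 : 𝒳 → ℝ) (X 0 ω),
        fun ω => ((Ch.bracket m g).1 : 𝒳 → ℝ) (X k ω); P]) atTop
      (𝓝 cov[fun ω => f.1 (X 0 ω), fun ω => g.1 (X k ω); P]) := fun f g k =>
    tendsto_covariance hX hlaw (hF _ f.2) (hF _ g.2) (hfM f) (hfM g) (hlm f) (hlm g) (hlM f)
      (hlM g) (hlim f) (hlim g) 0 k
  refine ⟨hb.of_norm_bounded fun k => (hbound _ (hF _ f.2) (hfM f) g k).1,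
    hb'.of_norm_bounded fun k => (hbound _ (hF _ g.2) (hfM g) f (k + 1)).1, ?_⟩
  refine ((tendsto_dyadicFloor t.2.1).min (tendsto_dyadicFloor u.2.1)).mul
    (Tendsto.add ?_ ?_)
  · exact tendsto_tsum_of_dominated_convergence hb (hcov f g)
      (Eventually.of_forall fun m k => (hbound _ (hlm f m) (hlM f m) g k).2 m)
  · exact tendsto_tsum_of_dominated_convergence hb' (fun k => hcov g f (k + 1))
      (Eventually.of_forall fun m k => (hbound _ (hlm g m) (hlM g m) f (k + 1)).2 m)

/-- The dyadic time `j / 4^k`, truncated to the unit interval. -/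
def dyadicTime (i : ℕ × ℕ) : unitInterval :=
  ⟨min 1 (i.2 / 4 ^ i.1), le_min zero_le_one (by positivity), min_le_left _ _⟩

theorem coe_dyadicTime_floor (k : ℕ) (t : unitInterval) :
    (dyadicTime (k, ⌊(4 : ℝ) ^ k * t⌋₊) : ℝ) = dyadicFloor k t :=
  min_eq_right ((dyadicFloor_le k t.2.1).trans t.2.2)

/-- The index set of all brackets and dyadic times of a chain. -/
abbrev BracketChain.Index {𝒞 : NormedFunctionSpace 𝒳} {μ : Measure 𝒳} {s : ℝ≥0∞}
    {F : Set (𝒳 → ℝ)} {G : Set 𝒞.carrier} {C₁ β c : ℝ} {R : ℕ}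
    (Ch : BracketChain 𝒞 μ s F G C₁ β c R) : Type _ :=
  (Σ k, Ch.brackets k) × (ℕ × ℕ)

/-- The index of level `k` assigned to `(f, t)`. -/
def BracketChain.proj {𝒞 : NormedFunctionSpace 𝒳} {μ : Measure 𝒳} {s : ℝ≥0∞}
    {F : Set (𝒳 → ℝ)} {G : Set 𝒞.carrier} {C₁ β c : ℝ} {R : ℕ}
    (Ch : BracketChain 𝒞 μ s F G C₁ β c R) (k : ℕ) (p : F × unitInterval) : Ch.Index :=
  (⟨k, Ch.bracket k p.1, Ch.mem k p.1⟩, (k, ⌊(4 : ℝ) ^ k * p.2⌋₊))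

theorem BracketChain.finite_range_proj {𝒞 : NormedFunctionSpace 𝒳} {μ : Measure 𝒳} {s : ℝ≥0∞}
    {F : Set (𝒳 → ℝ)} {G : Set 𝒞.carrier} {C₁ β c : ℝ} {R : ℕ}
    (Ch : BracketChain 𝒞 μ s F G C₁ β c R) (k : ℕ) : (Set.range (Ch.proj k)).Finite := by
  refine (((Set.finite_univ (α := Ch.brackets k)).image (Sigma.mk k)).prod
    ((Finset.range (4 ^ k + 1)).finite_toSet.image (Prod.mk k))).subset ?_
  rintro _ ⟨p, rfl⟩
  exact ⟨⟨_, Set.mem_univ _, rfl⟩, ⟨_, floor_mem_range k p.2.2.2, rfl⟩⟩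

end Main

end SeqEmp

end

/-! ### Proof of the theorem. -/

open SeqEmp

theorem mainTheorem3 {𝒳 Ω : Type*} [MeasurableSpace 𝒳] [MeasurableSpace Ω]
    (P : Measure Ω) [IsProbabilityMeasure P] (μ : Measure 𝒳) [IsProbabilityMeasure μ]
    (X : ℕ → Ω → 𝒳) (hX : ∀ i, Measurable (X i)) (hstat : SeqEmp.IsStationary P X)
    (hμ : P.map (X 0) = μ)
    (F : Set (𝒳 → ℝ)) (hFmeas : ∀ f ∈ F, Measurable f) (hF : SeqEmp.UniformlyBounded F)
    (s : ℝ≥0∞) (hs : 1 ≤ s)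
    (𝒞 : SeqEmp.NormedFunctionSpace 𝒳) (hone : (1 : 𝒳 → ℝ) ∈ 𝒞.carrier)
    (d₀ : ℕ) (hmix : SeqEmp.MultipleMixing P X μ s 𝒞 d₀)
    (G : Set 𝒞.carrier) (hG : SeqEmp.EssBounded 𝒞 μ G)
    (hfidi : SeqEmp.FidiCLT P X μ 𝒞 G)
    (γ : ℝ) (hγ : (d₀ : ℝ) + 1 < γ) (hent : SeqEmp.ExpEntropy 𝒞 μ s F G γ) :
    ∃ K : Measure (SeqEmp.LInf (F × unitInterval)),
      SeqEmp.IsTightCentredGaussian K ∧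
      SeqEmp.ConvergesInLaw P (SeqEmp.seqEmpProcess μ X hF) K ∧
      (SeqEmp.FidiCovIsLongRun P X μ 𝒞 G → SeqEmp.GeometricCovDecay P X μ s 𝒞 G →
        SeqEmp.HasKieferCovariance P X K) := by
  have hlaw : ∀ i, P.map (X i) = μ := fun i => (hstat.map_eq hX i).trans hμ
  have hγ1 : 1 < γ := by
    have : (0 : ℝ) ≤ d₀ := Nat.cast_nonneg _
    linarith
  obtain ⟨B, hB⟩ := id hF
  obtain ⟨M₀, hM₀⟩ := hG
  set M := max 1 (max B M₀) with hMdef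
  have hM1 : 1 ≤ M := le_max_left _ _
  have hFM : ∀ f ∈ F, ∀ x, |f x| ≤ M := fun f hf x =>
    (hB f hf x).trans ((le_max_left _ _).trans (le_max_right _ _))
  have hGM : ∀ g ∈ G, eLpNorm (g : 𝒳 → ℝ) ∞ μ ≤ ENNReal.ofReal M := fun g hg =>
    (hM₀ g hg).trans (ENNReal.ofReal_le_ofReal ((le_max_right _ _).trans (le_max_right _ _)))
  obtain ⟨C₁, c, R, hC₁, hc, ⟨Ch⟩⟩ := hent.exists_bracketChain
  have hβ1 : 1 < (2 : ℝ) ^ (1 / γ) := Real.one_lt_rpow (by norm_num) (by positivity)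
  have hβ2 : (2 : ℝ) ^ (1 / γ) < 2 := by
    calc (2 : ℝ) ^ (1 / γ) < 2 ^ (1 : ℝ) :=
          Real.rpow_lt_rpow_of_exponent_lt (by norm_num) ((div_lt_one (by linarith)).2 hγ1)
      _ = 2 := Real.rpow_one 2
  have hβγ : ((2 : ℝ) ^ (1 / γ)) ^ γ = 2 := by
    rw [← Real.rpow_mul (by norm_num), one_div_mul_cancel (by linarith), Real.rpow_one]
  generalize (2 : ℝ) ^ (1 / γ) = β at Ch hβ1 hβ2 hβγ
  -- A fourth root leaves room in Markov's inequality: increments have standard deviation of order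
  -- `q^(2k)`, while the thresholds are the larger but still summable `q^k`.
  obtain ⟨q, hq0, hq1, hβq⟩ : ∃ q : ℝ, 0 < q ∧ q < 1 ∧ β / 2 = q ^ 4 := by
    have h0 : 0 < β / 2 := by linarith
    refine ⟨√√(β / 2), by positivity, ?_, ?_⟩
    · rw [Real.sqrt_lt' one_pos, Real.sqrt_lt' (by norm_num)]
      linarith
    · rw [show 4 = 2 * 2 from rfl, pow_mul, Real.sq_sqrt (by positivity), Real.sq_sqrt h0.le]
  obtain ⟨η, hη0, hη⟩ := Ch.exists_increment_measure_le hX hlaw hs hmix hone hM1 hFmeas hGM hC₁.le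
    hβ1.le hc hq0 hq1 hβq le_rfl
  have hmemG : ∀ i : Ch.Index, i.1.2.1.1 ∈ G := fun i => (Ch.isBracket _ _ i.1.2.2).left_mem
  set V : ℕ → Ch.Index → Ω → ℝ := fun n i =>
    seqEmp μ X n (i.1.2.1.1 : 𝒳 → ℝ) (dyadicTime i.2) with hV
  have hVproj : ∀ n m p ω, V n (Ch.proj m p) ω =
      seqEmp μ X n ((Ch.bracket m p.1).1 : 𝒳 → ℝ) (dyadicFloor m p.2) ω := fun n m p ω => by
    rw [← coe_dyadicTime_floor]
    rfl
  have hfd : ∀ k (i : Fin k → Ch.Index), ∃ S, FidiTendsto P V i S := fun k i =>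
    hfidi k (fun j => (i j).1.2.1.1) (fun j => dyadicTime (i j).2) fun j => hmemG _
  obtain ⟨K, hK, hKlim, r, hr, hrcov⟩ := exists_gaussian_limit (P := P)
    (U := seqEmpProcess μ X hF) (V := V) (fun n i => measurable_seqEmp hX (𝒞.measurable _) n _)
    hfd Ch.proj Ch.finite_range_proj (ε := fun m => q ^ m) (η := fun m => η * (1 / 2) ^ m)
    (summable_geometric_of_lt_one hq0.le hq1) (fun m => by positivity)
    ((summable_geometric_of_lt_one (by norm_num) (by norm_num)).mul_left η)
    (fun m => by
      filter_upwards [tendsto_natCast_atTop_atTop.eventually_ge_atTop ((4 : ℝ) ^ m)] with n hn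
      simp only [hVproj]
      exact (hη m n (by linarith)).1)
    (fun e he d hd => by
      simp only [hVproj]
      exact Ch.eventually_measure_le hX hlaw hs hmix hone hM1 hFmeas hFM hGM hC₁.le hβ1.le hc
        hq0 hq1 hβq he hd)
  refine ⟨K, hK, hKlim, fun hlong hdecay f g t u => ?_⟩
  obtain ⟨hs1, hs2, hlim⟩ := Ch.tendsto_longRunCov hX hlaw hs (by linarith) hFmeas hFM hGM hdecay
    hγ1 hβ1 hβγ hC₁ f g t u
  -- At each level the covariance of the limit law and the long-run covariance of the lower brackets
  -- are the same matrix entry, so both limits agree.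
  refine ⟨hs1, hs2, tendsto_nhds_unique (hrcov (f, t) (g, u)) (hlim.congr fun m => ?_)⟩
  obtain ⟨S, hS⟩ := hfd 2 ![Ch.proj m (f, t), Ch.proj m (g, u)]
  rw [← hr _ _ S hS, hlong 2 (fun j => (![Ch.proj m (f, t), Ch.proj m (g, u)] j).1.2.1.1)
    (fun j => dyadicTime (![Ch.proj m (f, t), Ch.proj m (g, u)] j).2) (fun j => hmemG _) S hS 0 1]
  simp only [Matrix.cons_val_zero, Matrix.cons_val_one]
  rw [← coe_dyadicTime_floor, ← coe_dyadicTime_floor]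
  rfl
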